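/- Let $k$ be a commutative ring and $A$ a $k$-algebra; all bimodules are $k$-central. Let $C$ be an $A$-coring with comultiplication $\Delta(c)=c_{(1)}\otimes c_{(2)}$ and counit $\varepsilon$, flat both as a left and as a right $A$-module. Definitions. $\mathrm{Aut}(C)$ is the group (under composition) of pairs $(\varphi,\rho)$ where $\rho$ is a $k$-algebra automorphism of $A$ and $\varphi:C\to C$ is a bijective additive map with $\varphi(ac)=\rho(a)\varphi(c)$, $\varphi(ca)=\varphi(c)\rho(a)$, $\Delta(\varphi(c))=\varphi(c_{(1)})\otimes\varphi(c_{(2)})$ and $\varepsilon\varphi=\rho\varepsilon$. $C^*=\mathrm{Hom}_{-A}(C,A)$ is the ring of right $A$-linear maps, with product $(p*q)(c)=q(p(c_{(1)})c_{(2)})$ and unit $\varepsilon$. $\mathrm{Inn}_r(C)$ is the set of all $(\varphi,\rho)\in\mathrm{Aut}(C)$ for which there is an invertible $p\in C^*$ with $$\varphi(c_{(1)})p(c_{(2)})=p(c_{(1)})c_{(2)}\qquad\text{for all } c\in C,$$ meaning that $\sum_i\varphi(x_i)p(y_i)=\sum_i p(x_i)y_i$ for every expression $\Delta(c)=\sum_i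 x_i\otimes_A y_i$. For a $B$-coring $D$ (with $B$ a $k$-algebra), flat on both sides, a $(C,D)$-bicomodule $X$ is right invertible if the cotensor functor $-\square_C X$ from right $C$-comodules to right $D$-comodules is an equivalence of categories; $C$ and $D$ are Morita–Takeuchi right equivalent if such an $X$ exists. $\mathrm{Pic}_r(C)$ is the set of isomorphism classes $(X)$ of right invertible $(C,C)$-bicomodules. For $f=(\varphi,\rho)\in\mathrm{Aut}(C)$, ${}_fC$ is the $(C,C)$-bicomodule which is $C$ as a right comodule, with left action $a\cdot c=\rho^{-1}(a)c$ and left coaction $c\mapsto\varphi(c_{(1)})\otimes c_{(2)}$. Theorem. The cotensor product of right invertible bicomodules is right invertible, and $\mathrm{Pic}_r(C)$ is a group under $(X)(Y)=(X\square_C Y)$, with unit $(C)$. Moreover: (1) Each ${}_fC$ is right invertible, $\Omega(f)=({}_fC)$ defines a group homomorphism $\Omega:\mathrm{Aut}(C)\to\mathrm{Pic}_r(C)$, $\mathrm{Inn}_r(C)$ is a normal subgroup of $\mathrm{Aut}(C)$, and $$1\to\mathrm{Inn}_r(C)\to\mathrm{Aut}(C)\xrightarrow{\ \Omega\ }\mathrm{Pic}_r(C)$$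 is exact. In particular $\Omega$ induces a monomorphism of groups from $\mathrm{Out}_r(C)=\mathrm{Aut}(C)/\mathrm{Inn}_r(C)$ to $\mathrm{Pic}_r(C)$. (2) If $D$ is a coring over a $k$-algebra $B$, flat on both sides, and $C$ and $D$ are Morita–Takeuchi right equivalent, then $\mathrm{Pic}_r(C)\cong\mathrm{Pic}_r(D)$ as groups. -/

import Mathlib

open CategoryTheory MulOpposite
open scoped TensorProduct

universe u v

noncomputable section

/-! ### Tensor products over a noncommutative ring -/

section BTensor

variable (A : Type u) [Ring A] (M N : Type u) [AddCommGroup M] [Module Aᵐᵒᵖ M]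
  [AddCommGroup N] [Module A N]

/-- The subgroup of `M ⊗[ℤ] N` generated by the elements `m a ⊗ n - m ⊗ a n`. -/
def BTensor.rel : AddSubgroup (M ⊗[ℤ] N) :=
  AddSubgroup.closure {t | ∃ (m : M) (a : A) (n : N), t = (op a • m) ⊗ₜ[ℤ] n - m ⊗ₜ[ℤ] (a • n)}

/-- The tensor product over the (noncommutative) ring `A` of a right `A`-module `M`
(a module over `Aᵐᵒᵖ`) and a left `A`-module `N`. -/
def BTensor : Type u := (M ⊗[ℤ] N) ⧸ BTensor.rel A M N

instance : AddCommGroup (BTensor A M N) :=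
  inferInstanceAs (AddCommGroup ((M ⊗[ℤ] N) ⧸ BTensor.rel A M N))

end BTensor

/-- Regard an additive map that commutes with scalars as a linear map. -/
def mkLin {S X Y : Type*} [Ring S] [AddCommGroup X] [AddCommGroup Y] [Module S X] [Module S Y]
    (f : X →+ Y) (h : ∀ (s : S) (x : X), f (s • x) = s • f x) : X →ₗ[S] Y :=
  { f with map_smul' := h }

@[simp] theorem mkLin_apply {S X Y : Type*} [Ring S] [AddCommGroup X] [AddCommGroup Y]
    [Module S X] [Module S Y] (f : X →+ Y) (h : ∀ (s : S) (x : X), f (s • x) = s • f x) (x : X) :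
    mkLin f h x = f x := rfl

namespace BTensor

section basic

variable {A : Type u} [Ring A] {M N P : Type u} [AddCommGroup M] [Module Aᵐᵒᵖ M]
  [AddCommGroup N] [Module A N] [AddCommGroup P]

/-- The quotient map `M ⊗[ℤ] N → M ⊗[A] N`. -/
def mk (A : Type u) [Ring A] (M N : Type u) [AddCommGroup M] [Module Aᵐᵒᵖ M]
    [AddCommGroup N] [Module A N] : (M ⊗[ℤ] N) →+ BTensor A M N :=
  QuotientAddGroup.mk' (rel A M N)

/-- The pure tensor `m ⊗ n`. -/
def tmul (A : Type u) [Ring A] {M N : Type u} [AddCommGroup M] [Module Aᵐᵒᵖ M]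
    [AddCommGroup N] [Module A N] (m : M) (n : N) : BTensor A M N :=
  mk A M N (m ⊗ₜ[ℤ] n)

theorem add_tmul (m m' : M) (n : N) : tmul A (m + m') n = tmul A m n + tmul A m' n := by
  rw [tmul, TensorProduct.add_tmul, map_add]; rfl

theorem tmul_add (m : M) (n n' : N) : tmul A m (n + n') = tmul A m n + tmul A m n' := by
  rw [tmul, TensorProduct.tmul_add, map_add]; rfl

@[simp] theorem zero_tmul (n : N) : tmul A (0 : M) n = 0 := by
  rw [tmul, TensorProduct.zero_tmul, map_zero]

@[simp] theorem tmul_zero (m : M) : tmul A m (0 : N) = 0 := by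
  rw [tmul, TensorProduct.tmul_zero, map_zero]

theorem op_smul_tmul (a : A) (m : M) (n : N) : tmul A (op a • m) n = tmul A m (a • n) := by
  rw [← sub_eq_zero, tmul, tmul, ← map_sub]
  exact (QuotientAddGroup.eq_zero_iff _).2 (AddSubgroup.subset_closure ⟨m, a, n, rfl⟩)

@[elab_as_elim]
theorem induction_on {motive : BTensor A M N → Prop} (z : BTensor A M N)
    (zero : motive 0) (tmul : ∀ m n, motive (tmul A m n))
    (add : ∀ x y, motive x → motive y → motive (x + y)) : motive z := by
  obtain ⟨t, rfl⟩ : ∃ t, mk A M N t = z := QuotientAddGroup.mk'_surjective (rel A M N) z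
  induction t using TensorProduct.induction_on with
  | zero => rw [map_zero]; exact zero
  | tmul x y => exact tmul x y
  | add x y hx hy => rw [map_add]; exact add _ _ hx hy

theorem hom_ext {f g : BTensor A M N →+ P} (h : ∀ m n, f (tmul A m n) = g (tmul A m n)) :
    f = g := by
  ext z
  induction z using induction_on with
  | zero => simp
  | tmul m n => exact h m n
  | add x y hx hy => rw [map_add, map_add, hx, hy]

/-- The universal property: a balanced biadditive map factors through the tensor product. -/
def lift (f : M →+ N →+ P) (h : ∀ m (a : A) n, f (op a • m) n = f m (a • n)) :
    BTensor A M N →+ P :=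
  QuotientAddGroup.lift (rel A M N)
    (TensorProduct.liftAddHom f (fun r m n => by simp))
    (by
      rw [rel, AddSubgroup.closure_le]
      rintro _ ⟨m, a, n, rfl⟩
      simp [h])

@[simp] theorem lift_tmul (f : M →+ N →+ P)
    (h : ∀ m (a : A) n, f (op a • m) n = f m (a • n)) (m : M) (n : N) :
    lift f h (tmul A m n) = f m n := rfl

/-- Biadditive maps from unbundled data. -/
def mkBi {X Y Z : Type*} [AddCommGroup X] [AddCommGroup Y] [AddCommGroup Z] (f : X → Y → Z)
    (h₁ : ∀ x x' y, f (x + x') y = f x y + f x' y)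
    (h₂ : ∀ x y y', f x (y + y') = f x y + f x y') : X →+ Y →+ Z :=
  AddMonoidHom.mk' (fun x => AddMonoidHom.mk' (f x) (h₂ x))
    (fun x x' => by ext y; exact h₁ x x' y)

@[simp] theorem mkBi_apply {X Y Z : Type*} [AddCommGroup X] [AddCommGroup Y] [AddCommGroup Z]
    (f : X → Y → Z) (h₁ h₂) (x : X) (y : Y) : mkBi f h₁ h₂ x y = f x y := rfl

variable {M' N' : Type u} [AddCommGroup M'] [Module Aᵐᵒᵖ M'] [AddCommGroup N'] [Module A N']
  {M'' N'' : Type u} [AddCommGroup M''] [Module Aᵐᵒᵖ M''] [AddCommGroup N''] [Module A N'']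

/-- The map `f ⊗ g`. -/
def map (f : M →ₗ[Aᵐᵒᵖ] M') (g : N →ₗ[A] N') : BTensor A M N →+ BTensor A M' N' :=
  lift (mkBi (fun m n => tmul A (f m) (g n)) (fun _ _ _ => by rw [map_add, add_tmul])
    (fun _ _ _ => by rw [map_add, tmul_add]))
    (fun m a n => by simp [op_smul_tmul])

@[simp] theorem map_tmul (f : M →ₗ[Aᵐᵒᵖ] M') (g : N →ₗ[A] N') (m : M) (n : N) :
    map f g (tmul A m n) = tmul A (f m) (g n) := by
  simp [map]

theorem map_map (f : M →ₗ[Aᵐᵒᵖ] M') (g : N →ₗ[A] N') (f' : M' →ₗ[Aᵐᵒᵖ] M'')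
    (g' : N' →ₗ[A] N'') (z : BTensor A M N) :
    map f' g' (map f g z) = map (f' ∘ₗ f) (g' ∘ₗ g) z := by
  induction z using induction_on with
  | zero => simp
  | tmul m n => simp
  | add x y hx hy => simp only [map_add, hx, hy]

@[simp] theorem map_id_id (z : BTensor A M N) :
    map (LinearMap.id : M →ₗ[Aᵐᵒᵖ] M) (LinearMap.id : N →ₗ[A] N) z = z := by
  induction z using induction_on with
  | zero => simp
  | tmul m n => simp
  | add x y hx hy => simp only [map_add, hx, hy]

/-- The map `f ⊗ g` from a tensor product over `A` to a tensor product over `B`, for maps `f`, `g`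
that are semilinear along `σ : A → B`. -/
def smap {B : Type u} [Ring B] {X Y : Type u} [AddCommGroup X] [Module Bᵐᵒᵖ X] [AddCommGroup Y]
    [Module B Y] (σ : A → B) (f : M →+ X) (g : N →+ Y)
    (hf : ∀ (a : A) (m : M), f (op a • m) = op (σ a) • f m)
    (hg : ∀ (a : A) (n : N), g (a • n) = σ a • g n) : BTensor A M N →+ BTensor B X Y :=
  lift (mkBi (fun m n => tmul B (f m) (g n)) (fun _ _ _ => by rw [map_add, add_tmul])
    (fun _ _ _ => by rw [map_add, tmul_add]))
    (fun m a n => by simp only [mkBi_apply, hf, hg, op_smul_tmul])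

@[simp] theorem smap_tmul {B : Type u} [Ring B] {X Y : Type u} [AddCommGroup X] [Module Bᵐᵒᵖ X]
    [AddCommGroup Y] [Module B Y] (σ : A → B) (f : M →+ X) (g : N →+ Y)
    (hf : ∀ (a : A) (m : M), f (op a • m) = op (σ a) • f m)
    (hg : ∀ (a : A) (n : N), g (a • n) = σ a • g n) (m : M) (n : N) :
    smap σ f g hf hg (tmul A m n) = tmul B (f m) (g n) := rfl

end basic

section actions

variable {A : Type u} [Ring A] {M N : Type u} [AddCommGroup M] [Module Aᵐᵒᵖ M]
  [AddCommGroup N] [Module A N] {S T : Type u} [Ring S] [Ring T]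

/-- A left action commuting with the right `A`-action, as right `A`-linear maps. -/
def smulLeft (N : Type u) (s : S) {M : Type u} [AddCommGroup M] [Module Aᵐᵒᵖ M]
    [AddCommGroup N] [Module A N] [Module S M] [SMulCommClass S Aᵐᵒᵖ M] :
    BTensor A M N →+ BTensor A M N :=
  map (mkLin (AddMonoidHom.mk' (fun m => s • m) (smul_add s)) (fun a m => smul_comm s a m))
    LinearMap.id

/-- A right action on `N` commuting with the left `A`-action acts on the tensor product. -/
def smulRight (M : Type u) (t : Tᵐᵒᵖ) {N : Type u} [AddCommGroup M] [Module Aᵐᵒᵖ M]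
    [AddCommGroup N] [Module A N] [Module Tᵐᵒᵖ N] [SMulCommClass A Tᵐᵒᵖ N] :
    BTensor A M N →+ BTensor A M N :=
  map LinearMap.id
    (mkLin (AddMonoidHom.mk' (fun n => t • n) (smul_add t)) (fun a n => (smul_comm a t n).symm))

theorem smulLeft_tmul [Module S M] [SMulCommClass S Aᵐᵒᵖ M] (s : S) (m : M) (n : N) :
    smulLeft N s (tmul A m n) = tmul A (s • m) n := rfl

theorem smulRight_tmul [Module Tᵐᵒᵖ N] [SMulCommClass A Tᵐᵒᵖ N] (t : Tᵐᵒᵖ) (m : M) (n : N) :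
    smulRight M t (tmul A m n) = tmul A m (t • n) := rfl

/-- A left action on the first factor induces a left action on the tensor product. -/
instance leftModule [Module S M] [SMulCommClass S Aᵐᵒᵖ M] :
    Module S (BTensor A M N) where
  smul s := smulLeft N s
  one_smul z := by
    change smulLeft N _ z = z
    induction z using induction_on with
    | zero => exact map_zero _
    | tmul m n => rw [smulLeft_tmul, one_smul]
    | add x y hx hy => rw [map_add, hx, hy]
  mul_smul s t z := by
    change smulLeft N _ z = smulLeft N _ (smulLeft N _ z)
    induction z using induction_on with
    | zero => simp only [map_zero]
    | tmul m n => simp only [smulLeft_tmul, mul_smul]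
    | add x y hx hy => simp only [map_add, hx, hy]
  smul_zero s := map_zero (smulLeft N s)
  smul_add s := map_add (smulLeft N s)
  add_smul s t z := by
    change smulLeft N _ z = smulLeft N _ z + smulLeft N _ z
    induction z using induction_on with
    | zero => simp only [map_zero, add_zero]
    | tmul m n => simp only [smulLeft_tmul, add_smul, add_tmul]
    | add x y hx hy => simp only [map_add, hx, hy]; abel
  zero_smul z := by
    change smulLeft N _ z = 0
    induction z using induction_on with
    | zero => exact map_zero _
    | tmul m n => simp only [smulLeft_tmul, zero_smul, zero_tmul]
    | add x y hx hy => rw [map_add, hx, hy, add_zero]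

/-- A right action on the second factor induces a right action on the tensor product. -/
instance rightModule [Module Tᵐᵒᵖ N] [SMulCommClass A Tᵐᵒᵖ N] :
    Module Tᵐᵒᵖ (BTensor A M N) where
  smul s := smulRight M s
  one_smul z := by
    change smulRight M _ z = z
    induction z using induction_on with
    | zero => exact map_zero _
    | tmul m n => rw [smulRight_tmul, one_smul]
    | add x y hx hy => rw [map_add, hx, hy]
  mul_smul s t z := by
    change smulRight M _ z = smulRight M _ (smulRight M _ z)
    induction z using induction_on with
    | zero => simp only [map_zero]
    | tmul m n => simp only [smulRight_tmul, mul_smul]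
    | add x y hx hy => simp only [map_add, hx, hy]
  smul_zero s := map_zero (smulRight M s)
  smul_add s := map_add (smulRight M s)
  add_smul s t z := by
    change smulRight M _ z = smulRight M _ z + smulRight M _ z
    induction z using induction_on with
    | zero => simp only [map_zero, add_zero]
    | tmul m n => simp only [smulRight_tmul, add_smul, tmul_add]
    | add x y hx hy => simp only [map_add, hx, hy]; abel
  zero_smul z := by
    change smulRight M _ z = 0
    induction z using induction_on with
    | zero => exact map_zero _
    | tmul m n => simp only [smulRight_tmul, zero_smul, tmul_zero]
    | add x y hx hy => rw [map_add, hx, hy, add_zero]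

@[simp] theorem smul_tmul [Module S M] [SMulCommClass S Aᵐᵒᵖ M] (s : S) (m : M) (n : N) :
    s • tmul A m n = tmul A (s • m) n := rfl

@[simp] theorem smul_tmul_right [Module Tᵐᵒᵖ N] [SMulCommClass A Tᵐᵒᵖ N] (t : Tᵐᵒᵖ) (m : M)
    (n : N) : t • tmul A m n = tmul A m (t • n) := rfl

instance [Module S M] [SMulCommClass S Aᵐᵒᵖ M] [Module Tᵐᵒᵖ N] [SMulCommClass A Tᵐᵒᵖ N] :
    SMulCommClass S Tᵐᵒᵖ (BTensor A M N) where
  smul_comm s t z := by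
    induction z using induction_on with
    | zero => simp
    | tmul m n => simp
    | add x y hx hy => simp only [smul_add, hx, hy]

end actions

section maps

variable {A : Type u} [Ring A] {M N M' N' : Type u} [AddCommGroup M] [Module Aᵐᵒᵖ M]
  [AddCommGroup N] [Module A N] [AddCommGroup M'] [Module Aᵐᵒᵖ M']
  [AddCommGroup N'] [Module A N'] {S T : Type u} [Ring S] [Ring T]

theorem map_smul_left [Module S M] [SMulCommClass S Aᵐᵒᵖ M] [Module S M']
    [SMulCommClass S Aᵐᵒᵖ M'] (f : M →ₗ[Aᵐᵒᵖ] M') (g : N →ₗ[A] N')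
    (hf : ∀ (s : S) m, f (s • m) = s • f m) (s : S) (z : BTensor A M N) :
    map f g (s • z) = s • map f g z := by
  induction z using induction_on with
  | zero => simp
  | tmul m n => simp [hf]
  | add x y hx hy => simp only [smul_add, map_add, hx, hy]

theorem map_smul_right [Module Tᵐᵒᵖ N] [SMulCommClass A Tᵐᵒᵖ N] [Module Tᵐᵒᵖ N']
    [SMulCommClass A Tᵐᵒᵖ N'] (f : M →ₗ[Aᵐᵒᵖ] M') (g : N →ₗ[A] N')
    (hg : ∀ (t : Tᵐᵒᵖ) n, g (t • n) = t • g n) (t : Tᵐᵒᵖ) (z : BTensor A M N) :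
    map f g (t • z) = t • map f g z := by
  induction z using induction_on with
  | zero => simp
  | tmul m n => simp [hg]
  | add x y hx hy => simp only [smul_add, map_add, hx, hy]

/-- The canonical map `A ⊗ N → N`. -/
def lid : BTensor A A N →+ N :=
  lift (mkBi (fun a n => a • n) (fun _ _ _ => add_smul _ _ _) (fun _ _ _ => smul_add _ _ _))
    (fun m a n => by simp [mul_smul])

@[simp] theorem lid_tmul (a : A) (n : N) : lid (tmul A a n) = a • n := rfl

/-- The canonical map `M ⊗ A → M`. -/
def rid : BTensor A M A →+ M :=
  lift (mkBi (fun m a => op a • m) (fun _ _ _ => smul_add _ _ _)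
    (fun _ _ _ => by rw [MulOpposite.op_add, add_smul]))
    (fun m a n => by simp [mul_smul])

@[simp] theorem rid_tmul (a : A) (m : M) : rid (tmul A m a) = op a • m := rfl

end maps

section assoc

variable {A B : Type u} [Ring A] [Ring B] {M N P : Type u} [AddCommGroup M] [Module Aᵐᵒᵖ M]
  [AddCommGroup N] [Module A N] [Module Bᵐᵒᵖ N] [SMulCommClass A Bᵐᵒᵖ N]
  [AddCommGroup P] [Module B P]

/-- For fixed `p`, the map `M ⊗ N → M ⊗ (N ⊗ P)`, `m ⊗ n ↦ m ⊗ (n ⊗ p)`. -/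
def assocAux (p : P) : BTensor A M N →+ BTensor A M (BTensor B N P) :=
  map LinearMap.id (mkLin (AddMonoidHom.mk' (fun n => tmul B n p) (fun _ _ => add_tmul _ _ _))
    (fun s x => by simp))

/-- For fixed `m`, the map `N ⊗ P → (M ⊗ N) ⊗ P`, `n ⊗ p ↦ (m ⊗ n) ⊗ p`. -/
def assocAux' (m : M) : BTensor B N P →+ BTensor B (BTensor A M N) P :=
  map (mkLin (AddMonoidHom.mk' (fun n => tmul A m n) (fun _ _ => tmul_add _ _ _))
    (fun s x => by simp)) LinearMap.id

@[simp] theorem assocAux_tmul (p : P) (m : M) (n : N) :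
    assocAux p (tmul A m n) = tmul A m (tmul B n p) := rfl

@[simp] theorem assocAux'_tmul (p : P) (m : M) (n : N) :
    assocAux' m (tmul B n p) = tmul B (tmul A m n) p := rfl

/-- The associativity isomorphism `(M ⊗ N) ⊗ P ≃ M ⊗ (N ⊗ P)`. -/
def assoc : BTensor B (BTensor A M N) P ≃+ BTensor A M (BTensor B N P) :=
  AddMonoidHom.toAddEquiv
    (lift (mkBi (fun z p => assocAux p z) (fun _ _ _ => map_add _ _ _)
        (fun z p p' => by
          induction z using induction_on with
          | zero => simp
          | tmul m n => simp [tmul_add]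
          | add x y hx hy => simp only [map_add, hx, hy]; abel))
      (fun z b p => by
          induction z using induction_on with
          | zero => simp
          | tmul m n => simp [op_smul_tmul]
          | add x y hx hy =>
            simp only [mkBi_apply] at hx hy ⊢
            rw [smul_add, map_add, map_add, hx, hy]))
    (lift (mkBi (fun m z => assocAux' m z)
        (fun m m' z => by
          induction z using induction_on with
          | zero => simp
          | tmul m n => simp [add_tmul]
          | add x y hx hy => simp only [map_add, hx, hy]; abel)
        (fun _ _ _ => map_add _ _ _))
      (fun m a z => by
          induction z using induction_on with
          | zero => simp
          | tmul m n => simp [op_smul_tmul]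
          | add x y hx hy =>
            simp only [mkBi_apply] at hx hy ⊢
            rw [smul_add, map_add, map_add, hx, hy]))
    (by
      refine hom_ext fun z p => ?_
      induction z using induction_on with
      | zero => simp
      | tmul m n => simp
      | add x y hx hy => simp only [add_tmul, map_add, hx, hy])
    (by
      refine hom_ext fun m z => ?_
      induction z using induction_on with
      | zero => simp
      | tmul m n => simp
      | add x y hx hy => simp only [tmul_add, map_add, hx, hy])

@[simp] theorem assoc_tmul (m : M) (n : N) (p : P) :
    assoc (tmul B (tmul A m n) p) = tmul A m (tmul B n p) := rfl

@[simp] theorem assoc_symm_tmul (m : M) (n : N) (p : P) :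
    assoc.symm (tmul A m (tmul B n p)) = tmul B (tmul A m n) p := by
  rw [AddEquiv.symm_apply_eq, assoc_tmul]

theorem assoc_smul_left {S : Type u} [Ring S] [Module S M] [SMulCommClass S Aᵐᵒᵖ M] (s : S)
    (z : BTensor B (BTensor A M N) P) : assoc (s • z) = s • assoc z := by
  induction z using induction_on with
  | zero => simp
  | tmul z p =>
    induction z using induction_on with
    | zero => simp
    | tmul m n => simp
    | add x y hx hy => simp only [add_tmul, smul_add, map_add, hx, hy]
  | add x y hx hy => simp only [smul_add, map_add, hx, hy]

theorem assoc_smul_right {T : Type u} [Ring T] [Module Tᵐᵒᵖ P] [SMulCommClass B Tᵐᵒᵖ P]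
    (t : Tᵐᵒᵖ) (z : BTensor B (BTensor A M N) P) : assoc (t • z) = t • assoc z := by
  induction z using induction_on with
  | zero => simp
  | tmul z p =>
    induction z using induction_on with
    | zero => simp
    | tmul m n => simp
    | add x y hx hy =>
      rw [smul_tmul_right] at hx hy ⊢
      rw [add_tmul, add_tmul, map_add, map_add, smul_add, hx, hy]
  | add x y hx hy => simp only [smul_add, map_add, hx, hy]

end assoc

end BTensor

/-! ### Flat modules over a noncommutative ring -/

/-- The left `A`-module `N` is flat: `- ⊗[A] N` preserves injective maps of right `A`-modules. -/
def IsFlatLeft (A : Type u) [Ring A] (N : Type u) [AddCommGroup N] [Module A N] : Prop :=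
  ∀ (M M' : Type u) [AddCommGroup M] [Module Aᵐᵒᵖ M] [AddCommGroup M'] [Module Aᵐᵒᵖ M']
    (f : M →ₗ[Aᵐᵒᵖ] M'), Function.Injective f →
    Function.Injective (BTensor.map f (LinearMap.id : N →ₗ[A] N))

/-- The right `A`-module `M` is flat: `M ⊗[A] -` preserves injective maps of left `A`-modules. -/
def IsFlatRight (A : Type u) [Ring A] (M : Type u) [AddCommGroup M] [Module Aᵐᵒᵖ M] : Prop :=
  ∀ (N N' : Type u) [AddCommGroup N] [Module A N] [AddCommGroup N'] [Module A N']
    (g : N →ₗ[A] N'), Function.Injective g →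
    Function.Injective (BTensor.map (LinearMap.id : M →ₗ[Aᵐᵒᵖ] M) g)

namespace BTensor

section exact

variable {A : Type u} [Ring A] {M N M' N' : Type u} [AddCommGroup M] [Module Aᵐᵒᵖ M]
  [AddCommGroup N] [Module A N] [AddCommGroup M'] [Module Aᵐᵒᵖ M']
  [AddCommGroup N'] [Module A N']

/-- Right exactness: an element of `M ⊗ N` that dies in `(M / K) ⊗ N` comes from `K ⊗ N`. -/
theorem exists_of_map_mkQ_left (K : Submodule Aᵐᵒᵖ M) (z : BTensor A M N)
    (hz : map K.mkQ LinearMap.id z = 0) :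
    ∃ y : BTensor A K N, map K.subtype LinearMap.id y = z := by
  let R : AddSubgroup (BTensor A M N) :=
    (map K.subtype (LinearMap.id : N →ₗ[A] N)).range
  let π := QuotientAddGroup.mk' R
  let F : N →+ M →+ (BTensor A M N ⧸ R) :=
    mkBi (fun n m => π (tmul A m n)) (fun _ _ _ => by rw [tmul_add, map_add])
      (fun _ _ _ => by rw [add_tmul, map_add])
  have hF : ∀ n, ∀ m ∈ K.toAddSubgroup, F n m = 0 := fun n m hm =>
    (QuotientAddGroup.eq_zero_iff _).2 ⟨tmul A ⟨m, hm⟩ n, rfl⟩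
  let G : (M ⧸ K) →+ N →+ (BTensor A M N ⧸ R) :=
    (AddMonoidHom.mk' (fun n => (QuotientAddGroup.lift K.toAddSubgroup (F n) (hF n) :
        (M ⧸ K) →+ (BTensor A M N ⧸ R)))
      (fun n n' => by
        refine AddMonoidHom.ext fun q => ?_
        obtain ⟨m, rfl⟩ := K.mkQ_surjective q
        exact DFunLike.congr_fun (map_add F n n') m)).flip
  have hG : ∀ m n, G (K.mkQ m) n = π (tmul A m n) := fun m n => rfl
  let H : BTensor A (M ⧸ K) N →+ (BTensor A M N ⧸ R) := lift G (by
    intro q a n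
    obtain ⟨m, rfl⟩ := K.mkQ_surjective q
    rw [← map_smul, hG, hG, op_smul_tmul])
  have hH : ∀ t : BTensor A M N, H (map K.mkQ LinearMap.id t) = π t := by
    intro t
    induction t using induction_on with
    | zero => simp only [map_zero]
    | tmul m n => rfl
    | add x y hx hy => rw [map_add, map_add, map_add, hx, hy]
  have h0 : π z = 0 := by rw [← hH, hz, map_zero]
  exact (QuotientAddGroup.eq_zero_iff _).1 h0

theorem exists_of_map_mkQ_right (K : Submodule A N) (z : BTensor A M N)
    (hz : map LinearMap.id K.mkQ z = 0) :
    ∃ y : BTensor A M K, map LinearMap.id K.subtype y = z := by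
  let R : AddSubgroup (BTensor A M N) :=
    (map (LinearMap.id : M →ₗ[Aᵐᵒᵖ] M) K.subtype).range
  let π := QuotientAddGroup.mk' R
  let F : M →+ N →+ (BTensor A M N ⧸ R) :=
    mkBi (fun m n => π (tmul A m n)) (fun _ _ _ => by rw [add_tmul, map_add])
      (fun _ _ _ => by rw [tmul_add, map_add])
  have hF : ∀ m, ∀ n ∈ K.toAddSubgroup, F m n = 0 := fun m n hn =>
    (QuotientAddGroup.eq_zero_iff _).2 ⟨tmul A m ⟨n, hn⟩, rfl⟩
  let G : M →+ (N ⧸ K) →+ (BTensor A M N ⧸ R) :=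
    AddMonoidHom.mk' (fun m => (QuotientAddGroup.lift K.toAddSubgroup (F m) (hF m) :
        (N ⧸ K) →+ (BTensor A M N ⧸ R)))
      (fun m m' => by
        refine AddMonoidHom.ext fun q => ?_
        obtain ⟨n, rfl⟩ := K.mkQ_surjective q
        exact DFunLike.congr_fun (map_add F m m') n)
  have hG : ∀ m n, G m (K.mkQ n) = π (tmul A m n) := fun m n => rfl
  let H : BTensor A M (N ⧸ K) →+ (BTensor A M N ⧸ R) := lift G (by
    intro m a q
    obtain ⟨n, rfl⟩ := K.mkQ_surjective q
    rw [← map_smul, hG, hG, op_smul_tmul])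
  have hH : ∀ t : BTensor A M N, H (map LinearMap.id K.mkQ t) = π t := by
    intro t
    induction t using induction_on with
    | zero => simp only [map_zero]
    | tmul m n => rfl
    | add x y hx hy => rw [map_add, map_add, map_add, hx, hy]
  have h0 : π z = 0 := by rw [← hH, hz, map_zero]
  exact (QuotientAddGroup.eq_zero_iff _).1 h0

/-- Tensoring with a flat left module preserves kernels. -/
theorem exists_of_map_eq_zero_left (hN : IsFlatLeft A N) (f : M →ₗ[Aᵐᵒᵖ] M')
    (z : BTensor A M N) (hz : map f LinearMap.id z = 0) :
    ∃ y : BTensor A (LinearMap.ker f) N, map (LinearMap.ker f).subtype LinearMap.id y = z := by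
  apply exists_of_map_mkQ_left
  let g := (LinearMap.ker f).liftQ f le_rfl
  have hg : Function.Injective g :=
    LinearMap.ker_eq_bot.1 (Submodule.ker_liftQ_eq_bot _ _ _ le_rfl)
  apply hN _ _ g hg
  rw [map_map, map_zero, ← hz]
  congr 1

theorem exists_of_map_eq_zero_right (hM : IsFlatRight A M) (g : N →ₗ[A] N')
    (z : BTensor A M N) (hz : map LinearMap.id g z = 0) :
    ∃ y : BTensor A M (LinearMap.ker g), map LinearMap.id (LinearMap.ker g).subtype y = z := by
  apply exists_of_map_mkQ_right
  let h := (LinearMap.ker g).liftQ g le_rfl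
  have hh : Function.Injective h :=
    LinearMap.ker_eq_bot.1 (Submodule.ker_liftQ_eq_bot _ _ _ le_rfl)
  apply hM _ _ h hh
  rw [map_map, map_zero, ← hz]
  congr 1

end exact

end BTensor

/-! ### Corings -/

/-- A homomorphism of `(A, B)`-bimodules. -/
structure BimodHom (A B : Type u) [Ring A] [Ring B] (X Y : Type u) [AddCommGroup X] [Module A X]
    [Module Bᵐᵒᵖ X] [AddCommGroup Y] [Module A Y] [Module Bᵐᵒᵖ Y] extends X →+ Y where
  map_smul : ∀ (a : A) (x : X), toFun (a • x) = a • toFun x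
  map_op_smul : ∀ (b : Bᵐᵒᵖ) (x : X), toFun (b • x) = b • toFun x

namespace BimodHom

variable {A B : Type u} [Ring A] [Ring B] {X Y : Type u} [AddCommGroup X] [Module A X]
  [Module Bᵐᵒᵖ X] [AddCommGroup Y] [Module A Y] [Module Bᵐᵒᵖ Y]

/-- The underlying left linear map. -/
def l (f : BimodHom A B X Y) : X →ₗ[A] Y := mkLin f.toAddMonoidHom f.map_smul

/-- The underlying right linear map. -/
def r (f : BimodHom A B X Y) : X →ₗ[Bᵐᵒᵖ] Y := mkLin f.toAddMonoidHom f.map_op_smul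

instance : CoeFun (BimodHom A B X Y) (fun _ => X → Y) := ⟨fun f => f.toAddMonoidHom⟩

@[simp] theorem l_apply (f : BimodHom A B X Y) (x : X) : f.l x = f x := rfl

@[simp] theorem r_apply (f : BimodHom A B X Y) (x : X) : f.r x = f x := rfl

theorem apply_smul (f : BimodHom A B X Y) (a : A) (x : X) : f (a • x) = a • f x := f.map_smul a x

theorem apply_op_smul (f : BimodHom A B X Y) (b : Bᵐᵒᵖ) (x : X) : f (b • x) = b • f x :=
  f.map_op_smul b x

end BimodHom

/-- An `A`-coring, for an algebra `A` over a commutative ring `k`. All bimodules are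
`k`-central. -/
structure Coring (k : Type v) [CommRing k] (A : Type u) [Ring A] [Algebra k A] where
  /-- The underlying set. -/
  carrier : Type u
  [addCommGroup : AddCommGroup carrier]
  [leftModule : Module A carrier]
  [rightModule : Module Aᵐᵒᵖ carrier]
  [smulComm : SMulCommClass A Aᵐᵒᵖ carrier]
  central : ∀ (r : k) (c : carrier), algebraMap k A r • c = op (algebraMap k A r) • c
  /-- The comultiplication `Δ : C → C ⊗[A] C`. -/
  comul : BimodHom A A carrier (BTensor A carrier carrier)
  /-- The counit `ε : C → A`. -/
  counit : BimodHom A A carrier A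
  coassoc : ∀ c, BTensor.assoc (BTensor.map comul.r LinearMap.id (comul c)) =
    BTensor.map LinearMap.id comul.l (comul c)
  counit_comul : ∀ c, BTensor.lid (BTensor.map counit.r LinearMap.id (comul c)) = c
  comul_counit : ∀ c, BTensor.rid (BTensor.map LinearMap.id counit.l (comul c)) = c

namespace Coring

instance {k : Type v} [CommRing k] {A : Type u} [Ring A] [Algebra k A] :
    CoeSort (Coring k A) (Type u) := ⟨carrier⟩

attribute [instance] addCommGroup leftModule rightModule smulComm

variable {k : Type v} [CommRing k] {A : Type u} [Ring A] [Algebra k A]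

/-- The coring `C` is flat as a left and as a right `A`-module. -/
class IsFlat (C : Coring k A) : Prop where
  left : IsFlatLeft A C
  right : IsFlatRight A C

/-- The elements of the right dual `C* = Hom_A(C, A)` of `C` act on `C` by
`c ↦ p(c₁) c₂`. -/
def dualAct (C : Coring k A) (p : C →ₗ[Aᵐᵒᵖ] A) : C →ₗ[Aᵐᵒᵖ] C :=
  mkLin (BTensor.lid.comp ((BTensor.map p LinearMap.id).comp C.comul.toAddMonoidHom))
    (fun a c => by
      change BTensor.lid (BTensor.map p LinearMap.id (C.comul (a • c))) =
        a • BTensor.lid (BTensor.map p LinearMap.id (C.comul c))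
      rw [C.comul.apply_op_smul a c]
      generalize C.comul c = z
      induction z using BTensor.induction_on with
      | zero => simp
      | tmul m n => simp [smul_comm]
      | add x y hx hy => simp only [smul_add, map_add, hx, hy])

/-- The product of `C*`: `(p * q)(c) = q(p(c₁) c₂)`. -/
def dualMul (C : Coring k A) (p q : C →ₗ[Aᵐᵒᵖ] A) : C →ₗ[Aᵐᵒᵖ] A := q ∘ₗ C.dualAct p

/-- Invertibility in the ring `C*`, whose unit is the counit. -/
def IsInvertibleDual (C : Coring k A) (p : C →ₗ[Aᵐᵒᵖ] A) : Prop :=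
  ∃ q : C →ₗ[Aᵐᵒᵖ] A, C.dualMul p q = C.counit.r ∧ C.dualMul q p = C.counit.r

/-- An automorphism of the `A`-coring `C`: a pair `(φ, ρ)` consisting of an automorphism `ρ` of the
`k`-algebra `A` and a bijective map `φ : C → C` which is semilinear along `ρ` on both sides and
is compatible with comultiplication and counit. -/
@[ext]
structure Auto (C : Coring k A) where
  φ : C ≃+ C
  ρ : A ≃ₐ[k] A
  map_smul : ∀ (a : A) (c : C), φ (a • c) = ρ a • φ c
  map_op_smul : ∀ (a : A) (c : C), φ (op a • c) = op (ρ a) • φ c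
  map_comul : ∀ c, C.comul (φ c) =
    BTensor.smap ρ φ.toAddMonoidHom φ.toAddMonoidHom map_op_smul map_smul (C.comul c)
  map_counit : ∀ c, C.counit (φ c) = ρ (C.counit c)

namespace Auto

variable {C : Coring k A}

/-- The map `φ ⊗ φ`. -/
def tensor (f : Auto C) : BTensor A C C →+ BTensor A C C :=
  BTensor.smap f.ρ f.φ.toAddMonoidHom f.φ.toAddMonoidHom f.map_op_smul f.map_smul

@[simp] theorem tensor_tmul (f : Auto C) (x y : C) :
    f.tensor (BTensor.tmul A x y) = BTensor.tmul A (f.φ x) (f.φ y) := rfl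

theorem comul_φ (f : Auto C) (c : C) : C.comul (f.φ c) = f.tensor (C.comul c) := f.map_comul c

instance : One (Auto C) where
  one :=
    { φ := AddEquiv.refl _
      ρ := AlgEquiv.refl
      map_smul := fun _ _ => rfl
      map_op_smul := fun _ _ => rfl
      map_comul := fun c => by
        change C.comul c = _
        generalize C.comul c = z
        induction z using BTensor.induction_on with
        | zero => simp only [map_zero]
        | tmul m n => rfl
        | add x y hx hy => rw [map_add, ← hx, ← hy]
      map_counit := fun _ => rfl }

/-- The product of automorphisms is composition. -/
instance : Mul (Auto C) where
  mul f g :=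
    { φ := g.φ.trans f.φ
      ρ := g.ρ.trans f.ρ
      map_smul := fun a c => by simp [g.map_smul, f.map_smul]
      map_op_smul := fun a c => by simp [g.map_op_smul, f.map_op_smul]
      map_comul := fun c => by
        change C.comul (f.φ (g.φ c)) = _
        rw [f.comul_φ, g.comul_φ]
        generalize C.comul c = z
        induction z using BTensor.induction_on with
        | zero => simp only [map_zero]
        | tmul m n => rfl
        | add x y hx hy => rw [map_add, map_add, map_add, ← hx, ← hy]
      map_counit := fun c => by simp [f.map_counit, g.map_counit] }

theorem φ_symm_smul (f : Auto C) (a : A) (c : C) : f.φ.symm (a • c) = f.ρ.symm a • f.φ.symm c := by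
  rw [AddEquiv.symm_apply_eq, f.map_smul]; simp

theorem φ_symm_op_smul (f : Auto C) (a : A) (c : C) :
    f.φ.symm (op a • c) = op (f.ρ.symm a) • f.φ.symm c := by
  rw [AddEquiv.symm_apply_eq, f.map_op_smul]; simp

instance : Inv (Auto C) where
  inv f :=
    { φ := f.φ.symm
      ρ := f.ρ.symm
      map_smul := f.φ_symm_smul
      map_op_smul := f.φ_symm_op_smul
      map_comul := fun c => by
        obtain ⟨c, rfl⟩ := f.φ.surjective c
        rw [f.comul_φ, AddEquiv.symm_apply_apply]
        generalize C.comul c = z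
        induction z using BTensor.induction_on with
        | zero => simp only [map_zero]
        | tmul m n => simp
        | add x y hx hy => rw [map_add, map_add, ← hx, ← hy]
      map_counit := fun c => by
        obtain ⟨c, rfl⟩ := f.φ.surjective c
        rw [f.map_counit, AddEquiv.symm_apply_apply, AlgEquiv.symm_apply_apply] }

/-- The group `Aut(C)` of coring automorphisms. -/
instance : Group (Auto C) where
  mul_assoc _ _ _ := rfl
  one_mul _ := rfl
  mul_one _ := rfl
  inv_mul_cancel f := Auto.ext (AddEquiv.ext fun c => f.φ.symm_apply_apply c)
    (AlgEquiv.ext fun a => f.ρ.symm_apply_apply a)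

end Auto

/-- The set `Inn_r(C)` of right inner automorphisms: those `(φ, ρ)` for which there is an invertible
`p ∈ C*` with `φ(c₁) p(c₂) = p(c₁) c₂` for all `c ∈ C`. As `p` is only right linear, the left
hand side is spelled out on representatives: the identity is required for
every expression `Δ(c) = ∑ xᵢ ⊗ yᵢ`. -/
def rInn (C : Coring k A) : Set (Auto C) :=
  {f | ∃ p : C →ₗ[Aᵐᵒᵖ] A, C.IsInvertibleDual p ∧
    ∀ (c : C) (n : ℕ) (x y : Fin n → C), C.comul c = ∑ i, BTensor.tmul A (x i) (y i) →
      ∑ i, op (p (y i)) • f.φ (x i) = ∑ i, p (x i) • y i}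

end Coring

/-! ### Comodules and bicomodules -/

section comodules

variable {k : Type v} [CommRing k] {A B : Type u} [Ring A] [Algebra k A] [Ring B] [Algebra k B]

/-- A right comodule over the `A`-coring `C`. -/
structure RComod (C : Coring k A) where
  /-- The underlying set. -/
  carrier : Type u
  [addCommGroup : AddCommGroup carrier]
  [rightModule : Module Aᵐᵒᵖ carrier]
  /-- The coaction `M → M ⊗[A] C`. -/
  coact : carrier →ₗ[Aᵐᵒᵖ] BTensor A carrier C
  coassoc : ∀ m, BTensor.assoc (BTensor.map coact LinearMap.id (coact m)) =
    BTensor.map LinearMap.id C.comul.l (coact m)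
  coact_counit : ∀ m, BTensor.rid (BTensor.map LinearMap.id C.counit.l (coact m)) = m

namespace RComod

instance {C : Coring k A} : CoeSort (RComod C) (Type u) := ⟨carrier⟩

attribute [instance] addCommGroup rightModule

/-- A morphism of right comodules: a colinear right `A`-linear map. -/
@[ext]
structure Hom {C : Coring k A} (M N : RComod C) where
  lin : M →ₗ[Aᵐᵒᵖ] N
  comm : ∀ m, BTensor.map lin LinearMap.id (M.coact m) = N.coact (lin m)

/-- The category of right `C`-comodules. -/
instance (C : Coring k A) : Category (RComod C) where
  Hom M N := Hom M N
  id M := ⟨LinearMap.id, fun m => BTensor.map_id_id _⟩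
  comp f g := ⟨g.lin ∘ₗ f.lin, fun m => by
    rw [LinearMap.comp_apply, ← g.comm, ← f.comm, BTensor.map_map]; rfl⟩

end RComod

/-- A `(C, D)`-bicomodule, for an `A`-coring `C` and a `B`-coring `D`. -/
structure Bicomod (C : Coring k A) (D : Coring k B) extends RComod D where
  [leftModule : Module A carrier]
  [smulComm : SMulCommClass A Bᵐᵒᵖ carrier]
  central : ∀ (r : k) (x : carrier), algebraMap k A r • x = op (algebraMap k B r) • x
  coact_smul : ∀ (a : A) (x : carrier), coact (a • x) = a • coact x
  /-- The left coaction `X → C ⊗[A] X`. -/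
  lcoact : BimodHom A B carrier (BTensor A C carrier)
  lcoassoc : ∀ x, BTensor.assoc (BTensor.map C.comul.r LinearMap.id (lcoact x)) =
    BTensor.map LinearMap.id lcoact.l (lcoact x)
  counit_lcoact : ∀ x, BTensor.lid (BTensor.map C.counit.r LinearMap.id (lcoact x)) = x
  /-- The two coactions commute. -/
  compat : ∀ x, BTensor.assoc (BTensor.map lcoact.r LinearMap.id (coact x)) =
    BTensor.map LinearMap.id (mkLin coact.toAddMonoidHom coact_smul) (lcoact x)

namespace Bicomod

instance {C : Coring k A} {D : Coring k B} : CoeSort (Bicomod C D) (Type u) :=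
  ⟨fun X => X.carrier⟩

attribute [instance] leftModule smulComm

/-- The right coaction as a left linear map. -/
def coactL {C : Coring k A} {D : Coring k B} (X : Bicomod C D) : X →ₗ[A] BTensor B X D :=
  mkLin X.coact.toAddMonoidHom X.coact_smul

@[simp] theorem coactL_apply {C : Coring k A} {D : Coring k B} (X : Bicomod C D) (x : X) :
    X.coactL x = X.coact x := rfl

/-- A morphism of bicomodules: a morphism of right and of left comodules. -/
@[ext]
structure Hom {C : Coring k A} {D : Coring k B} (X Y : Bicomod C D) extends
    RComod.Hom X.toRComod Y.toRComod where
  map_smul : ∀ (a : A) (x : X), lin (a • x) = a • lin x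
  lcomm : ∀ x, BTensor.map LinearMap.id (mkLin lin.toAddMonoidHom map_smul) (X.lcoact x) =
    Y.lcoact (lin x)

/-- The category of `(C, D)`-bicomodules. -/
instance (C : Coring k A) (D : Coring k B) : Category (Bicomod C D) where
  Hom X Y := Hom X Y
  id X :=
    { lin := LinearMap.id
      comm := fun m => BTensor.map_id_id _
      map_smul := fun _ _ => rfl
      lcomm := fun m => BTensor.map_id_id _ }
  comp f g :=
    { lin := g.lin ∘ₗ f.lin
      comm := fun m => by
        rw [LinearMap.comp_apply, ← g.comm, ← f.comm, BTensor.map_map]; rfl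
      map_smul := fun a x => by
        rw [LinearMap.comp_apply, f.map_smul, g.map_smul]; rfl
      lcomm := fun m => by
        rw [LinearMap.comp_apply, ← g.lcomm, ← f.lcomm, BTensor.map_map]; rfl }

end Bicomod

/-- The coring `C` as a bicomodule over itself. -/
def Coring.regular (C : Coring k A) : Bicomod C C where
  carrier := C
  coact := C.comul.r
  coassoc := C.coassoc
  coact_counit := C.comul_counit
  central := C.central
  coact_smul := C.comul.map_smul
  lcoact := C.comul
  lcoassoc := C.coassoc
  counit_lcoact := C.counit_comul
  compat := C.coassoc

/-- The underlying right `A`-module of the bicomodule `_fC`, equal to that of `C`. -/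
def Coring.Twisted (C : Coring k A) (_ : C.Auto) : Type u := C.carrier

namespace Coring.Twisted

variable {C : Coring k A} (f : C.Auto)

instance : AddCommGroup (C.Twisted f) := inferInstanceAs (AddCommGroup C.carrier)

instance : Module Aᵐᵒᵖ (C.Twisted f) := inferInstanceAs (Module Aᵐᵒᵖ C.carrier)

/-- The identity map `C → _fC`, right linear. -/
def of : C.carrier ≃ₗ[Aᵐᵒᵖ] C.Twisted f := LinearEquiv.refl Aᵐᵒᵖ C.carrier

/-- The left action `a · c = ρ⁻¹(a) c`. -/
instance : Module A (C.Twisted f) :=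
  (Module.compHom C.carrier (f.ρ.symm : A →+* A) : Module A C.carrier)

@[simp] theorem smul_of (a : A) (c : C) : a • of f c = of f (f.ρ.symm a • c) := rfl

instance : SMulCommClass A Aᵐᵒᵖ (C.Twisted f) where
  smul_comm a b c := smul_comm (f.ρ.symm a) b (show C.carrier from c)

theorem of_smul (a : A) (c : C) : of f (a • c) = f.ρ a • of f c := by simp

/-- The right coaction of `C`. -/
def coact : C.Twisted f →ₗ[Aᵐᵒᵖ] BTensor A (C.Twisted f) C :=
  mkLin ((BTensor.map (of f).toLinearMap LinearMap.id).comp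
      (C.comul.toAddMonoidHom.comp (of f).symm.toLinearMap.toAddMonoidHom))
    (fun a c => by
      change BTensor.map _ _ (C.comul (a • (of f).symm c)) = _
      rw [C.comul.apply_op_smul, BTensor.map_smul_right _ _ (fun _ _ => rfl)]
      rfl)

theorem coact_of (c : C) :
    coact f (of f c) = BTensor.map (of f).toLinearMap LinearMap.id (C.comul c) := rfl

/-- The map `φ ⊗ id : C ⊗ C → C ⊗ _fC`. -/
def twist : BTensor A C C →+ BTensor A C (C.Twisted f) :=
  BTensor.smap f.ρ f.φ.toAddMonoidHom (of f).toLinearMap.toAddMonoidHom f.map_op_smul (of_smul f)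

@[simp] theorem twist_tmul (x y : C) :
    twist f (BTensor.tmul A x y) = BTensor.tmul A (f.φ x) (of f y) := rfl

theorem twist_smul (a : A) (z : BTensor A C C) : twist f (a • z) = f.ρ a • twist f z := by
  induction z using BTensor.induction_on with
  | zero => simp
  | tmul m n => simp [f.map_smul]
  | add x y hx hy => simp only [smul_add, map_add, hx, hy]

theorem twist_op_smul (a : Aᵐᵒᵖ) (z : BTensor A C C) : twist f (a • z) = a • twist f z := by
  induction z using BTensor.induction_on with
  | zero => simp
  | tmul m n => simp
  | add x y hx hy => simp only [smul_add, map_add, hx, hy]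

/-- The left coaction `c ↦ φ(c₁) ⊗ c₂`. -/
def lcoact : BimodHom A A (C.Twisted f) (BTensor A C (C.Twisted f)) where
  toAddMonoidHom := (twist f).comp
      (C.comul.toAddMonoidHom.comp (of f).symm.toLinearMap.toAddMonoidHom)
  map_smul a c := by
    change twist f (C.comul (f.ρ.symm a • (of f).symm c)) = _
    rw [C.comul.apply_smul, twist_smul, AlgEquiv.apply_symm_apply]
    rfl
  map_op_smul a c := by
    change twist f (C.comul (a • (of f).symm c)) = _
    rw [C.comul.apply_op_smul, twist_op_smul]
    rfl

theorem lcoact_of (c : C) : lcoact f (of f c) = twist f (C.comul c) := rfl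

end Coring.Twisted

/-- The bicomodule `_fC` for an automorphism `f = (φ, ρ)` of `C`: as a right comodule it is `C`, its
left action is `a · c = ρ⁻¹(a) c` and its left coaction is `c ↦ φ(c₁) ⊗ c₂`. -/
def Coring.twisted (C : Coring k A) (f : C.Auto) : Bicomod C C where
  carrier := C.Twisted f
  coact := Twisted.coact f
  coassoc m := by
    obtain ⟨c, rfl⟩ := (Twisted.of f).surjective m
    have h := congrArg (BTensor.map (Twisted.of f).toLinearMap LinearMap.id) (C.coassoc c)
    rw [Twisted.coact_of]
    generalize C.comul c = z at h ⊢
    have h1 : ∀ z : BTensor A C C,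
        BTensor.assoc (BTensor.map (Twisted.coact f) LinearMap.id
          (BTensor.map (Twisted.of f).toLinearMap LinearMap.id z)) =
        BTensor.map (Twisted.of f).toLinearMap LinearMap.id
          (BTensor.assoc (BTensor.map C.comul.r LinearMap.id z)) := by
      intro z
      induction z using BTensor.induction_on with
      | zero => simp only [map_zero]
      | tmul m n =>
        simp only [BTensor.map_tmul, LinearEquiv.coe_coe, Twisted.coact_of, BimodHom.r_apply,
          LinearMap.id_apply]
        generalize C.comul m = w
        induction w using BTensor.induction_on with
        | zero => simp
        | tmul m n => simp
        | add x y hx hy => simp only [map_add, BTensor.add_tmul, hx, hy]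
      | add x y hx hy => simp only [map_add, hx, hy]
    rw [h1, h, BTensor.map_map, BTensor.map_map]
    rfl
  coact_counit m := by
    obtain ⟨c, rfl⟩ := (Twisted.of f).surjective m
    have h := congrArg (Twisted.of f) (C.comul_counit c)
    rw [← h, Twisted.coact_of]
    have h1 : ∀ z : BTensor A C C,
        BTensor.rid (BTensor.map LinearMap.id C.counit.l
          (BTensor.map (Twisted.of f).toLinearMap LinearMap.id z)) =
        Twisted.of f (BTensor.rid (BTensor.map LinearMap.id C.counit.l z)) := by
      intro z
      induction z using BTensor.induction_on with
      | zero => simp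
      | tmul m n => simp
      | add x y hx hy => simp only [map_add, hx, hy]
    rw [h1, C.comul_counit, C.comul_counit]
  central r m := by
    obtain ⟨c, rfl⟩ := (Twisted.of f).surjective m
    rw [Twisted.smul_of, AlgEquiv.commutes, C.central]
    rfl
  coact_smul a m := by
    obtain ⟨c, rfl⟩ := (Twisted.of f).surjective m
    rw [Twisted.smul_of, Twisted.coact_of, Twisted.coact_of, C.comul.apply_smul]
    generalize C.comul c = z
    induction z using BTensor.induction_on with
    | zero => simp
    | tmul m n => simp
    | add x y hx hy => simp only [smul_add, map_add, hx, hy]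
  lcoact := Twisted.lcoact f
  lcoassoc m := by
    obtain ⟨c, rfl⟩ := (Twisted.of f).surjective m
    let Φ : BTensor A C (BTensor A C C) →+ BTensor A C (BTensor A C (C.Twisted f)) :=
      BTensor.smap f.ρ f.φ.toAddMonoidHom (Twisted.twist f) f.map_op_smul (Twisted.twist_smul f)
    have h := congrArg Φ (C.coassoc c)
    rw [Twisted.lcoact_of]
    have h1 : ∀ z : BTensor A C C,
        BTensor.assoc (BTensor.map C.comul.r LinearMap.id (Twisted.twist f z)) =
        Φ (BTensor.assoc (BTensor.map C.comul.r LinearMap.id z)) := by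
      intro z
      induction z using BTensor.induction_on with
      | zero => simp only [map_zero]
      | tmul m n =>
        simp only [BTensor.map_tmul, Twisted.twist_tmul, BimodHom.r_apply, LinearMap.id_apply,
          Coring.Auto.comul_φ]
        generalize C.comul m = w
        induction w using BTensor.induction_on with
        | zero => simp
        | tmul m n => simp [Φ]
        | add x y hx hy => simp only [map_add, BTensor.add_tmul, hx, hy]
      | add x y hx hy => simp only [map_add, hx, hy]
    have h2 : ∀ z : BTensor A C C,
        BTensor.map LinearMap.id (Twisted.lcoact f).l (Twisted.twist f z) =
        Φ (BTensor.map LinearMap.id C.comul.l z) := by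
      intro z
      induction z using BTensor.induction_on with
      | zero => simp only [map_zero]
      | tmul m n => rfl
      | add x y hx hy => simp only [map_add, hx, hy]
    rw [h1, h2, h]
  counit_lcoact m := by
    obtain ⟨c, rfl⟩ := (Twisted.of f).surjective m
    have h1 : ∀ z : BTensor A C C,
        BTensor.lid (BTensor.map C.counit.r LinearMap.id (Twisted.twist f z)) =
        Twisted.of f (BTensor.lid (BTensor.map C.counit.r LinearMap.id z)) := by
      intro z
      induction z using BTensor.induction_on with
      | zero => simp
      | tmul m n => simp [f.map_counit]
      | add x y hx hy => simp only [map_add, hx, hy]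
    rw [Twisted.lcoact_of, h1, C.counit_comul]
  compat m := by
    obtain ⟨c, rfl⟩ := (Twisted.of f).surjective m
    let Ψ : BTensor A C (BTensor A C C) →+ BTensor A C (BTensor A (C.Twisted f) C) :=
      BTensor.smap f.ρ f.φ.toAddMonoidHom (BTensor.map (Twisted.of f).toLinearMap LinearMap.id)
        f.map_op_smul (fun a z => by
          induction z using BTensor.induction_on with
          | zero => simp
          | tmul m n => simp
          | add x y hx hy => simp only [smul_add, map_add, hx, hy])
    rw [Twisted.lcoact_of, Twisted.coact_of]
    have h1 : ∀ z : BTensor A C C,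
        BTensor.assoc (BTensor.map (Twisted.lcoact f).r LinearMap.id
          (BTensor.map (Twisted.of f).toLinearMap LinearMap.id z)) =
        Ψ (BTensor.assoc (BTensor.map C.comul.r LinearMap.id z)) := by
      intro z
      induction z using BTensor.induction_on with
      | zero => simp only [map_zero]
      | tmul m n =>
        simp only [BTensor.map_tmul, BimodHom.r_apply, LinearMap.id_apply, LinearEquiv.coe_coe,
          Twisted.lcoact_of]
        generalize C.comul m = w
        induction w using BTensor.induction_on with
        | zero => simp
        | tmul m n => simp [Ψ]
        | add x y hx hy => simp only [map_add, BTensor.add_tmul, hx, hy]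
      | add x y hx hy => simp only [map_add, hx, hy]
    rw [h1, C.coassoc]
    generalize C.comul c = z
    induction z using BTensor.induction_on with
    | zero => simp only [map_zero]
    | tmul m n => rfl
    | add x y hx hy => simp only [map_add, hx, hy]

end comodules

/-! ### The cotensor product -/

section lifting

variable {S K P Q : Type*} [Ring S] [AddCommGroup K] [AddCommGroup P] [AddCommGroup Q] [Module S K]
  [Module S P] [Module S Q]

/-- The factorization of a linear map through an injective linear map. -/
def liftInj (j : P →ₗ[S] Q) (hj : Function.Injective j) (γ : K →ₗ[S] Q)
    (h : ∀ z, ∃ y, j y = γ z) : K →ₗ[S] P :=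
  (LinearEquiv.ofInjective j hj).symm.toLinearMap ∘ₗ
    γ.codRestrict (LinearMap.range j) (fun z => h z)

theorem liftInj_spec (j : P →ₗ[S] Q) (hj : Function.Injective j) (γ : K →ₗ[S] Q)
    (h : ∀ z, ∃ y, j y = γ z) (z : K) : j (liftInj j hj γ h z) = γ z := by
  exact congrArg Subtype.val ((LinearEquiv.ofInjective j hj).apply_symm_apply
    (γ.codRestrict (LinearMap.range j) (fun z => h z) z))

end lifting

namespace BTensor

section

variable {A B : Type u} [Ring A] [Ring B] {M M' N P : Type u} [AddCommGroup M] [Module Aᵐᵒᵖ M]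
  [AddCommGroup M'] [Module Aᵐᵒᵖ M'] [AddCommGroup N] [Module A N] [Module Bᵐᵒᵖ N]
  [SMulCommClass A Bᵐᵒᵖ N] [AddCommGroup P] [Module B P]

/-- `f ⊗ N` as a right linear map. -/
def mapR (f : M →ₗ[Aᵐᵒᵖ] M') (N : Type u) [AddCommGroup N] [Module A N] [Module Bᵐᵒᵖ N]
    [SMulCommClass A Bᵐᵒᵖ N] : BTensor A M N →ₗ[Bᵐᵒᵖ] BTensor A M' N :=
  mkLin (map f LinearMap.id) (map_smul_right _ _ (fun _ _ => rfl))

@[simp] theorem mapR_apply (f : M →ₗ[Aᵐᵒᵖ] M') (z : BTensor A M N) :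
    (mapR f N : BTensor A M N →ₗ[Bᵐᵒᵖ] _) z = map f LinearMap.id z := rfl

theorem assoc_map_left (f : M →ₗ[Aᵐᵒᵖ] M') (z : BTensor B (BTensor A M N) P) :
    assoc (map (mapR f N) LinearMap.id z) = map f LinearMap.id (assoc z) := by
  induction z using induction_on with
  | zero => simp
  | tmul w p =>
    induction w using induction_on with
    | zero => simp
    | tmul m n => simp
    | add x y hx hy => simp only [add_tmul, map_add, hx, hy]
  | add x y hx hy => simp only [map_add, hx, hy]

theorem assoc_symm_map_left (f : M →ₗ[Aᵐᵒᵖ] M') (z : BTensor A M (BTensor B N P)) :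
    assoc.symm (map f LinearMap.id z) = map (mapR f N) LinearMap.id (assoc.symm z) := by
  rw [AddEquiv.symm_apply_eq, assoc_map_left, AddEquiv.apply_symm_apply]

variable {N' P' : Type u} [AddCommGroup N'] [Module A N'] [Module Bᵐᵒᵖ N'] [SMulCommClass A Bᵐᵒᵖ N']
  [AddCommGroup P'] [Module B P']

/-- `M ⊗ g` as a left linear map. -/
def mapL {S : Type u} [Ring S] (M : Type u) [AddCommGroup M] [Module Aᵐᵒᵖ M] [Module S M]
    [SMulCommClass S Aᵐᵒᵖ M] {N N' : Type u} [AddCommGroup N] [Module A N] [AddCommGroup N']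
    [Module A N'] (g : N →ₗ[A] N') : BTensor A M N →ₗ[S] BTensor A M N' :=
  mkLin (map LinearMap.id g) (map_smul_left _ _ (fun _ _ => rfl))

@[simp] theorem mapL_apply {S : Type u} [Ring S] [Module S M] [SMulCommClass S Aᵐᵒᵖ M]
    (g : N →ₗ[A] N') (z : BTensor A M N) :
    (mapL M g : BTensor A M N →ₗ[S] _) z = map LinearMap.id g z := rfl

theorem assoc_map_right (g : P →ₗ[B] P') (z : BTensor B (BTensor A M N) P) :
    assoc (map LinearMap.id g z) = map LinearMap.id (mapL N g) (assoc z) := by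
  induction z using induction_on with
  | zero => simp
  | tmul w p =>
    induction w using induction_on with
    | zero => simp
    | tmul m n => simp
    | add x y hx hy => simp only [add_tmul, map_add, hx, hy]
  | add x y hx hy => simp only [map_add, hx, hy]

theorem assoc_symm_map_right (g : P →ₗ[B] P') (z : BTensor A M (BTensor B N P)) :
    assoc.symm (map LinearMap.id (mapL N g) z) = map LinearMap.id g (assoc.symm z) := by
  rw [AddEquiv.symm_apply_eq, assoc_map_right, AddEquiv.apply_symm_apply]

/-- Iterated tensor products with a flat left module preserve injective maps. -/
theorem injective_map_twice {D : Type u} [AddCommGroup D] [Module B D] [Module Bᵐᵒᵖ D]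
    [SMulCommClass B Bᵐᵒᵖ D] (hD : IsFlatLeft B D) {K T : Type u} [AddCommGroup K] [Module Bᵐᵒᵖ K]
    [AddCommGroup T] [Module Bᵐᵒᵖ T] (j : K →ₗ[Bᵐᵒᵖ] T) (hj : Function.Injective j) :
    Function.Injective (map j (LinearMap.id : BTensor B D D →ₗ[B] _)) := by
  intro x y hxy
  apply assoc.symm.injective
  apply hD _ _ (mapR j D) (hD _ _ j hj)
  rw [← assoc_symm_map_left, ← assoc_symm_map_left, hxy]

theorem injective_map_twice' {D : Type u} [AddCommGroup D] [Module B D] [Module Bᵐᵒᵖ D]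
    [SMulCommClass B Bᵐᵒᵖ D] (hD : IsFlatRight B D) {K T : Type u} [AddCommGroup K] [Module B K]
    [AddCommGroup T] [Module B T] (j : K →ₗ[B] T) (hj : Function.Injective j) :
    Function.Injective (map (LinearMap.id : BTensor B D D →ₗ[Bᵐᵒᵖ] _) j) := by
  intro x y hxy
  apply assoc.injective
  apply hD _ _ (mapL D j) (hD _ _ j hj)
  rw [← assoc_map_right, ← assoc_map_right, hxy]

end

section

variable {A B : Type u} [Ring A] [Ring B] {M N P : Type u} [AddCommGroup M] [Module Aᵐᵒᵖ M]
  [AddCommGroup N] [Module A N] [Module Bᵐᵒᵖ N]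
  [SMulCommClass A Bᵐᵒᵖ N] [AddCommGroup P] [Module B P]

theorem assoc_symm_smul_left {S : Type u} [Ring S] [Module S M] [SMulCommClass S Aᵐᵒᵖ M] (s : S)
    (z : BTensor A M (BTensor B N P)) : assoc.symm (s • z) = s • assoc.symm z := by
  rw [AddEquiv.symm_apply_eq, assoc_smul_left, AddEquiv.apply_symm_apply]

theorem assoc_symm_smul_right {T : Type u} [Ring T] [Module Tᵐᵒᵖ P] [SMulCommClass B Tᵐᵒᵖ P]
    (t : Tᵐᵒᵖ) (z : BTensor A M (BTensor B N P)) : assoc.symm (t • z) = t • assoc.symm z := by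
  rw [AddEquiv.symm_apply_eq, assoc_smul_right, AddEquiv.apply_symm_apply]

/-- The right coaction on `M ⊗ N` induced by a right coaction `ρ : N → N ⊗ P`. -/
def coactR (M : Type u) [AddCommGroup M] [Module Aᵐᵒᵖ M] [Module Bᵐᵒᵖ P] [SMulCommClass B Bᵐᵒᵖ P]
    (ρ : BimodHom A B N (BTensor B N P)) :
    BTensor A M N →ₗ[Bᵐᵒᵖ] BTensor B (BTensor A M N) P :=
  mkLin (assoc.symm.toAddMonoidHom.comp (map LinearMap.id ρ.l))
    (fun b z => (congrArg assoc.symm (map_smul_right LinearMap.id ρ.l ρ.map_op_smul b z)).trans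
      (assoc_symm_smul_right b _))

theorem coactR_apply [Module Bᵐᵒᵖ P] [SMulCommClass B Bᵐᵒᵖ P]
    (ρ : BimodHom A B N (BTensor B N P)) (z : BTensor A M N) :
    coactR M ρ z = assoc.symm (map LinearMap.id ρ.l z) := rfl

theorem coactR_tmul [Module Bᵐᵒᵖ P] [SMulCommClass B Bᵐᵒᵖ P]
    (ρ : BimodHom A B N (BTensor B N P)) (m : M) (n : N) :
    coactR M ρ (tmul A m n) = assoc.symm (tmul A m (ρ n)) := rfl

/-- The left coaction on `M ⊗ N` induced by a left coaction `P → Q ⊗ P`. -/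
def coactL {Q : Type u} [AddCommGroup Q] [Module A Q] [Module Aᵐᵒᵖ Q] [SMulCommClass A Aᵐᵒᵖ Q]
    (P : Type u) [AddCommGroup P] [Module B P] (ρ : BimodHom A B N (BTensor A Q N)) :
    BTensor B N P →ₗ[A] BTensor A Q (BTensor B N P) :=
  mkLin (assoc.toAddMonoidHom.comp (map ρ.r LinearMap.id))
    (fun b z => (congrArg assoc (map_smul_left ρ.r LinearMap.id ρ.map_smul b z)).trans
      (assoc_smul_left b _))

theorem coactL_apply {Q : Type u} [AddCommGroup Q] [Module A Q] [Module Aᵐᵒᵖ Q]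
    [SMulCommClass A Aᵐᵒᵖ Q] (ρ : BimodHom A B N (BTensor A Q N)) (z : BTensor B N P) :
    coactL P ρ z = assoc (map ρ.r LinearMap.id z) := rfl

theorem coactL_tmul {Q : Type u} [AddCommGroup Q] [Module A Q] [Module Aᵐᵒᵖ Q]
    [SMulCommClass A Aᵐᵒᵖ Q] (ρ : BimodHom A B N (BTensor A Q N)) (n : N) (p : P) :
    coactL P ρ (tmul B n p) = assoc (tmul B (ρ n) p) := rfl

end

section

variable {B : Type u} [Ring B] {D T : Type u} [AddCommGroup D] [Module B D] [Module Bᵐᵒᵖ D]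
  [SMulCommClass B Bᵐᵒᵖ D] [AddCommGroup T] [Module Bᵐᵒᵖ T]

/-- The restriction of a coaction `T → T ⊗ D` to a stable submodule. -/
def subCoact (hD : IsFlatLeft B D) (ρ : T →ₗ[Bᵐᵒᵖ] BTensor B T D) (K : Submodule Bᵐᵒᵖ T)
    (h : ∀ z : K, ∃ y : BTensor B K D, map K.subtype LinearMap.id y = ρ z) :
    K →ₗ[Bᵐᵒᵖ] BTensor B K D :=
  liftInj (mapR K.subtype D : BTensor B K D →ₗ[Bᵐᵒᵖ] BTensor B T D)
    (hD K T K.subtype K.subtype_injective) (ρ ∘ₗ K.subtype) h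

theorem subCoact_spec (hD : IsFlatLeft B D) (ρ : T →ₗ[Bᵐᵒᵖ] BTensor B T D)
    (K : Submodule Bᵐᵒᵖ T)
    (h : ∀ z : K, ∃ y : BTensor B K D, map K.subtype LinearMap.id y = ρ z) (z : K) :
    map K.subtype LinearMap.id (subCoact hD ρ K h z) = ρ z :=
  liftInj_spec (mapR K.subtype D : BTensor B K D →ₗ[Bᵐᵒᵖ] BTensor B T D)
    (hD K T K.subtype K.subtype_injective) (ρ ∘ₗ K.subtype) h z

end

end BTensor

section cotensor

variable {k : Type v} [CommRing k] {A B E : Type u} [Ring A] [Algebra k A] [Ring B] [Algebra k B]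
  [Ring E] [Algebra k E]

/-- A submodule of a comodule that is stable under the coaction is a comodule. -/
def RComod.sub {D : Coring k B} (hD : IsFlatLeft B D) (T : RComod D) (K : Submodule Bᵐᵒᵖ T)
    (h : ∀ z : K, ∃ y : BTensor B K D, BTensor.map K.subtype LinearMap.id y = T.coact z) :
    RComod D where
  carrier := K
  coact := BTensor.subCoact hD T.coact K h
  coassoc z := by
    apply BTensor.injective_map_twice hD K.subtype K.subtype_injective
    have hδz := BTensor.subCoact_spec hD T.coact K h
    generalize BTensor.subCoact hD T.coact K h = δ at hδz
    have hc : BTensor.mapR K.subtype D ∘ₗ δ = T.coact ∘ₗ K.subtype := LinearMap.ext hδz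
    rw [← BTensor.assoc_map_left, BTensor.map_map, BTensor.map_map, hc]
    have h1 := T.coassoc z
    rw [← hδz, BTensor.map_map, BTensor.map_map] at h1
    exact h1
  coact_counit z := by
    have hδz := BTensor.subCoact_spec hD T.coact K h
    generalize BTensor.subCoact hD T.coact K h = δ at hδz
    apply K.subtype_injective
    have h1 := T.coact_counit z
    rw [← hδz] at h1
    refine Eq.trans ?_ h1
    generalize δ z = w
    induction w using BTensor.induction_on with
    | zero => simp
    | tmul m n => simp
    | add x y hx hy => simp only [map_add, hx, hy]

/-- The right coaction of a bicomodule as a bimodule homomorphism. -/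
def Bicomod.coactB {C : Coring k A} {D : Coring k B} (X : Bicomod C D) :
    BimodHom A B X (BTensor B X D) where
  toAddMonoidHom := X.coact.toAddMonoidHom
  map_smul := X.coact_smul
  map_op_smul := X.coact.map_smul

@[simp] theorem Bicomod.coactB_apply {C : Coring k A} {D : Coring k B} (X : Bicomod C D) (x : X) :
    X.coactB x = X.coact x := rfl

section rtensor

variable {C : Coring k A} {D : Coring k B} (M : Type u) [AddCommGroup M] [Module Aᵐᵒᵖ M]
  (X : Bicomod C D)

theorem BTensor.coactR_coassoc (z : BTensor A M X) :
    BTensor.assoc (BTensor.map (BTensor.coactR M X.coactB) LinearMap.id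
      (BTensor.coactR M X.coactB z)) =
    BTensor.map LinearMap.id D.comul.l (BTensor.coactR M X.coactB z) := by
  induction z using BTensor.induction_on with
  | zero => simp only [map_zero]
  | tmul m x =>
    have h1 : ∀ w : BTensor B X D,
        BTensor.assoc (BTensor.map (BTensor.coactR M X.coactB) LinearMap.id
          (BTensor.assoc.symm (BTensor.tmul A m w))) =
        BTensor.assoc.symm (BTensor.tmul A m
          (BTensor.assoc (BTensor.map X.coact LinearMap.id w))) := by
      intro w
      induction w using BTensor.induction_on with
      | zero => simp only [map_zero, BTensor.tmul_zero]
      | tmul x d =>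
        rw [BTensor.assoc_symm_tmul, BTensor.map_tmul, BTensor.map_tmul, BTensor.coactR_tmul,
          Bicomod.coactB_apply, LinearMap.id_apply]
        generalize X.coact x = v
        induction v using BTensor.induction_on with
        | zero => simp only [map_zero, BTensor.tmul_zero, BTensor.zero_tmul]
        | tmul m n => simp only [BTensor.assoc_symm_tmul, BTensor.assoc_tmul]
        | add x y hx hy =>
          simp only [map_add, BTensor.add_tmul, BTensor.tmul_add, hx, hy]
      | add x y hx hy => simp only [map_add, BTensor.tmul_add, hx, hy]
    rw [BTensor.coactR_tmul, Bicomod.coactB_apply, h1, X.coassoc]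
    generalize X.coact x = w
    induction w using BTensor.induction_on with
    | zero => simp only [map_zero, BTensor.tmul_zero]
    | tmul x d => simp only [BTensor.map_tmul, BTensor.assoc_symm_tmul, LinearMap.id_apply]
    | add x y hx hy => simp only [map_add, BTensor.tmul_add, hx, hy]
  | add x y hx hy => simp only [map_add, hx, hy]

theorem BTensor.coactR_counit (z : BTensor A M X) :
    BTensor.rid (BTensor.map LinearMap.id D.counit.l (BTensor.coactR M X.coactB z)) = z := by
  induction z using BTensor.induction_on with
  | zero => simp only [map_zero]
  | tmul m x =>
    refine Eq.trans ?_ (congrArg (BTensor.tmul A m) (X.coact_counit x))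
    rw [BTensor.coactR_tmul, Bicomod.coactB_apply]
    generalize X.coact x = w
    induction w using BTensor.induction_on with
    | zero => simp only [map_zero, BTensor.tmul_zero]
    | tmul x d =>
      simp only [BTensor.map_tmul, BTensor.assoc_symm_tmul, LinearMap.id_apply, BTensor.rid_tmul,
        BTensor.smul_tmul_right]
    | add x y hx hy => simp only [map_add, BTensor.tmul_add, hx, hy]
  | add x y hx hy => simp only [map_add, hx, hy]

/-- The right comodule `M ⊗[A] X`, for a right module `M` and a bicomodule `X`. -/
def RComod.tensor : RComod D where
  carrier := BTensor A M X
  coact := BTensor.coactR M X.coactB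
  coassoc := BTensor.coactR_coassoc M X
  coact_counit := BTensor.coactR_counit M X

end rtensor

section omega

variable {C : Coring k A} {D : Coring k B} (M : RComod C) (X : Bicomod C D)

/-- The map `ω = ρ_M ⊗ X - M ⊗ λ_X : M ⊗ X → M ⊗ C ⊗ X`. -/
def RComod.omega : BTensor A M X →ₗ[Bᵐᵒᵖ] BTensor A M (BTensor A C X) :=
  mkLin (BTensor.assoc.toAddMonoidHom.comp (BTensor.map M.coact LinearMap.id) -
      BTensor.map LinearMap.id X.lcoact.l)
    (fun b z => by
      change BTensor.assoc (BTensor.map M.coact LinearMap.id (b • z)) -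
          BTensor.map LinearMap.id X.lcoact.l (b • z) =
        b • (BTensor.assoc (BTensor.map M.coact LinearMap.id z) -
          BTensor.map LinearMap.id X.lcoact.l z)
      rw [BTensor.map_smul_right _ _ (fun _ _ => rfl),
        BTensor.map_smul_right _ X.lcoact.l X.lcoact.map_op_smul, BTensor.assoc_smul_right,
        smul_sub])

theorem RComod.omega_apply (z : BTensor A M X) :
    M.omega X z = BTensor.assoc (BTensor.map M.coact LinearMap.id z) -
      BTensor.map LinearMap.id X.lcoact.l z := rfl

theorem RComod.omega_tmul (m : M) (x : X) : M.omega X (BTensor.tmul A m x) =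
      BTensor.assoc (BTensor.tmul A (M.coact m) x) - BTensor.tmul A m (X.lcoact x) := rfl

/-- The right coaction of the bicomodule `C ⊗ X`. -/
def Bicomod.coactCX : BTensor A C X →ₗ[A] BTensor B (BTensor A C X) D :=
  mkLin (BTensor.coactR C X.coactB).toAddMonoidHom (fun a z =>
    (congrArg BTensor.assoc.symm (BTensor.map_smul_left LinearMap.id X.coactB.l
      (fun _ _ => rfl) a z)).trans (BTensor.assoc_symm_smul_left a _))

theorem Bicomod.coactCX_tmul (c : C) (x : X) :
    X.coactCX (BTensor.tmul A c x) = BTensor.assoc.symm (BTensor.tmul A c (X.coact x)) := rfl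

/-- The map `ω` is right colinear. -/
theorem RComod.map_omega_coact (z : BTensor A M X) :
    BTensor.map (M.omega X) LinearMap.id (BTensor.coactR M X.coactB z) =
      BTensor.assoc.symm (BTensor.map LinearMap.id X.coactCX (M.omega X z)) := by
  induction z using BTensor.induction_on with
  | zero => simp only [map_zero]
  | tmul m x =>
    have h2 : X.coactCX (X.lcoact x) =
        BTensor.assoc.symm (BTensor.assoc (BTensor.map X.lcoact.r LinearMap.id (X.coact x))) := by
      rw [X.compat]; rfl
    have h1 : ∀ w : BTensor B X D,
        BTensor.map (M.omega X) LinearMap.id (BTensor.assoc.symm (BTensor.tmul A m w)) =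
        BTensor.assoc.symm (BTensor.map LinearMap.id
          (mkLin BTensor.assoc.symm.toAddMonoidHom BTensor.assoc_symm_smul_left)
          (BTensor.assoc (BTensor.tmul A (M.coact m) w))) -
        BTensor.assoc.symm (BTensor.tmul A m (BTensor.assoc.symm (BTensor.assoc
          (BTensor.map X.lcoact.r LinearMap.id w)))) := by
      intro w
      induction w using BTensor.induction_on with
      | zero => simp only [map_zero, BTensor.tmul_zero, sub_zero]
      | tmul x d =>
        rw [AddEquiv.symm_apply_apply, BTensor.assoc_symm_tmul, BTensor.map_tmul,
          RComod.omega_tmul, LinearMap.id_apply, eq_sub_iff_add_eq, BTensor.map_tmul,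
          BTensor.assoc_symm_tmul, LinearMap.id_apply, ← BTensor.add_tmul, BimodHom.r_apply, sub_add_cancel]
        generalize M.coact m = v
        induction v using BTensor.induction_on with
        | zero => simp only [map_zero, BTensor.zero_tmul]
        | tmul m n =>
          rw [BTensor.assoc_tmul, BTensor.assoc_tmul, BTensor.map_tmul]
          change _ = BTensor.assoc.symm (BTensor.tmul A m
            (BTensor.assoc.symm (BTensor.tmul A n (BTensor.tmul B x d))))
          rw [BTensor.assoc_symm_tmul, BTensor.assoc_symm_tmul]
        | add x y hx hy => simp only [map_add, BTensor.add_tmul, hx, hy]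
      | add x y hx hy =>
        simp only [map_add, BTensor.tmul_add, hx, hy]
        abel
    rw [BTensor.coactR_tmul, Bicomod.coactB_apply, h1, RComod.omega_tmul, map_sub, map_sub,
      BTensor.map_tmul, h2, LinearMap.id_apply]
    congr 2
    generalize M.coact m = v
    induction v using BTensor.induction_on with
    | zero => simp only [map_zero, BTensor.zero_tmul]
    | tmul m n =>
      rw [BTensor.assoc_tmul, BTensor.assoc_tmul]
      rfl
    | add x y hx hy => simp only [map_add, BTensor.add_tmul, hx, hy]
  | add x y hx hy => simp only [map_add, hx, hy]

theorem RComod.exists_coact (hD : IsFlatLeft B D) (z : LinearMap.ker (M.omega X)) :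
    ∃ y : BTensor B (LinearMap.ker (M.omega X)) D,
      BTensor.map (LinearMap.ker (M.omega X)).subtype LinearMap.id y =
        BTensor.coactR M X.coactB z := by
  apply BTensor.exists_of_map_eq_zero_left hD
  rw [RComod.map_omega_coact, z.2, map_zero, map_zero]

/-- The cotensor product `M □_C X`, the kernel of `ω`, as a right `D`-comodule. -/
def RComod.cotensor [D.IsFlat] : RComod D :=
  (RComod.tensor M X).sub Coring.IsFlat.left (LinearMap.ker (M.omega X))
    (RComod.exists_coact M X Coring.IsFlat.left)

/-- The inclusion of `M □_C X` into `M ⊗[A] X`. -/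
def RComod.cotensorι [D.IsFlat] : M.cotensor X →ₗ[Bᵐᵒᵖ] BTensor A M X :=
  (LinearMap.ker (M.omega X)).subtype

theorem RComod.cotensorι_injective [D.IsFlat] : Function.Injective (M.cotensorι X) :=
  Submodule.subtype_injective _

theorem RComod.omega_cotensorι [D.IsFlat] (z : M.cotensor X) :
    M.omega X (M.cotensorι X z) = 0 :=
  Subtype.property (p := fun z => z ∈ LinearMap.ker (M.omega X)) z

theorem RComod.cotensor_coact [D.IsFlat] (z : M.cotensor X) :
    BTensor.map (M.cotensorι X) LinearMap.id ((M.cotensor X).coact z) =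
      BTensor.coactR M X.coactB (M.cotensorι X z) :=
  BTensor.subCoact_spec (T := BTensor A M X) Coring.IsFlat.left (BTensor.coactR M X.coactB)
    (LinearMap.ker (M.omega X)) (M.exists_coact X Coring.IsFlat.left) z

end omega

theorem RComod.omega_map {C : Coring k A} {D : Coring k B} {M N : RComod C} (f : M ⟶ N)
    (X : Bicomod C D) (z : BTensor A M X) :
    N.omega X (BTensor.map f.lin LinearMap.id z) =
      BTensor.map f.lin LinearMap.id (M.omega X z) := by
  rw [RComod.omega_apply, RComod.omega_apply, map_sub, BTensor.map_map, BTensor.map_map,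
    BTensor.map_map]
  congr 1
  rw [← BTensor.assoc_map_left, BTensor.map_map]
  congr 3
  exact LinearMap.ext fun m => (f.comm m).symm

/-- The map `f □ X` on cotensor products. -/
def RComod.cotensorMap {C : Coring k A} {D : Coring k B} [D.IsFlat] {M N : RComod C} (f : M ⟶ N)
    (X : Bicomod C D) : M.cotensor X →ₗ[Bᵐᵒᵖ] N.cotensor X :=
  ((BTensor.mapR f.lin X : BTensor A M X →ₗ[Bᵐᵒᵖ] BTensor A N X).restrict
    (p := LinearMap.ker (M.omega X)) (q := LinearMap.ker (N.omega X)) (fun z hz => by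
      rw [LinearMap.mem_ker, BTensor.mapR_apply, RComod.omega_map, LinearMap.mem_ker.1 hz,
        map_zero]) : LinearMap.ker (M.omega X) →ₗ[Bᵐᵒᵖ] LinearMap.ker (N.omega X))

theorem RComod.cotensorι_map {C : Coring k A} {D : Coring k B} [D.IsFlat] {M N : RComod C}
    (f : M ⟶ N) (X : Bicomod C D) (z : M.cotensor X) :
    N.cotensorι X (RComod.cotensorMap f X z) =
      BTensor.map f.lin LinearMap.id (M.cotensorι X z) := rfl

theorem RComod.cotensorMap_id {C : Coring k A} {D : Coring k B} [D.IsFlat] (M : RComod C)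
    (X : Bicomod C D) : RComod.cotensorMap (𝟙 M) X = LinearMap.id := by
  refine LinearMap.ext fun z => M.cotensorι_injective X ?_
  rw [RComod.cotensorι_map]
  exact BTensor.map_id_id _

theorem RComod.cotensorMap_comp {C : Coring k A} {D : Coring k B} [D.IsFlat] {M N P : RComod C}
    (f : M ⟶ N) (g : N ⟶ P) (X : Bicomod C D) :
    RComod.cotensorMap (f ≫ g) X = RComod.cotensorMap g X ∘ₗ RComod.cotensorMap f X := by
  refine LinearMap.ext fun z => P.cotensorι_injective X ?_
  rw [LinearMap.comp_apply, RComod.cotensorι_map, RComod.cotensorι_map, RComod.cotensorι_map,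
    BTensor.map_map]
  rfl

theorem BTensor.coactR_map {C : Coring k A} {D : Coring k B} {M N : Type u} [AddCommGroup M]
    [Module Aᵐᵒᵖ M] [AddCommGroup N] [Module Aᵐᵒᵖ N] (f : M →ₗ[Aᵐᵒᵖ] N)
    (X : Bicomod C D) (z : BTensor A M X) :
    BTensor.coactR N X.coactB (BTensor.map f LinearMap.id z) =
      BTensor.map (BTensor.mapR f X) LinearMap.id (BTensor.coactR M X.coactB z) := by
  rw [BTensor.coactR_apply, BTensor.coactR_apply, ← BTensor.assoc_symm_map_left, BTensor.map_map,
    BTensor.map_map]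
  rfl

/-- The functor `- □_C X` from right `C`-comodules to right `D`-comodules. -/
def cotensorFunctor {C : Coring k A} {D : Coring k B} [D.IsFlat] (X : Bicomod C D) :
    RComod C ⥤ RComod D where
  obj M := M.cotensor X
  map {M N} f :=
    { lin := RComod.cotensorMap f X
      comm := fun z => by
        apply Coring.IsFlat.left (C := D) (N.cotensor X) (BTensor A N X) (N.cotensorι X)
          (N.cotensorι_injective X)
        rw [RComod.cotensor_coact, RComod.cotensorι_map, BTensor.coactR_map,
          ← RComod.cotensor_coact, BTensor.map_map, BTensor.map_map]
        rfl }
  map_id M := RComod.Hom.ext (RComod.cotensorMap_id M X)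
  map_comp f g := RComod.Hom.ext (RComod.cotensorMap_comp f g X)

/-- A `(C, D)`-bicomodule `X` is right invertible if the functor `- □_C X` is an equivalence. -/
def Bicomod.IsRightInvertible {C : Coring k A} {D : Coring k B} [D.IsFlat] (X : Bicomod C D) :
    Prop :=
  (cotensorFunctor X).IsEquivalence

end cotensor

namespace BTensor

variable {A B S : Type u} [Ring A] [Ring B] [Ring S] {M N N' P : Type u} [AddCommGroup M]
  [Module Aᵐᵒᵖ M] [Module S M] [SMulCommClass S Aᵐᵒᵖ M] [AddCommGroup N] [Module A N]
  [Module Bᵐᵒᵖ N] [SMulCommClass A Bᵐᵒᵖ N] [AddCommGroup N'] [Module A N'] [Module Bᵐᵒᵖ N']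
  [SMulCommClass A Bᵐᵒᵖ N'] [AddCommGroup P] [Module B P]

theorem assoc_map_mid (f : BimodHom A B N N') (z : BTensor B (BTensor A M N) P) :
    assoc (map (mkLin (map (LinearMap.id : M →ₗ[Aᵐᵒᵖ] M) f.l)
      (map_smul_right _ _ f.map_op_smul)) LinearMap.id z) =
      map LinearMap.id (mkLin (map f.r LinearMap.id) (map_smul_left _ _ f.map_smul)) (assoc z) := by
  induction z using induction_on with
  | zero => simp only [map_zero]
  | tmul w p =>
    induction w using induction_on with
    | zero => simp only [map_zero, zero_tmul]
    | tmul m n => rfl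
    | add x y hx hy => simp only [add_tmul, map_add, hx, hy]
  | add x y hx hy => simp only [map_add, hx, hy]

end BTensor

section bicotensor

variable {k : Type v} [CommRing k] {A B E : Type u} [Ring A] [Algebra k A] [Ring B] [Algebra k B]
  [Ring E] [Algebra k E]

section sub

variable {F : Coring k E} {D : Coring k B} (T : Bicomod F D) (K : Submodule Bᵐᵒᵖ T)

/-- The left module structure on a submodule stable under the left action. -/
@[reducible] def Bicomod.subModule (hE : ∀ (e : E), ∀ z ∈ K, e • z ∈ K) : Module E K where
  smul e z := ⟨e • (z : T), hE e z z.2⟩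
  one_smul z := Subtype.ext (one_smul E (z : T))
  mul_smul e e' z := Subtype.ext (mul_smul e e' (z : T))
  smul_zero e := Subtype.ext (smul_zero (A := T) e)
  smul_add e z z' := Subtype.ext (smul_add e (z : T) (z' : T))
  add_smul e e' z := Subtype.ext (add_smul e e' (z : T))
  zero_smul z := Subtype.ext (zero_smul E (z : T))

/-- A submodule stable under the left action. -/
def Bicomod.Sub (_ : ∀ (e : E), ∀ z ∈ K, e • z ∈ K) : Type u := K

variable (hE : ∀ (e : E), ∀ z ∈ K, e • z ∈ K)

instance : AddCommGroup (T.Sub K hE) := inferInstanceAs (AddCommGroup K)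

instance : Module Bᵐᵒᵖ (T.Sub K hE) := inferInstanceAs (Module Bᵐᵒᵖ K)

instance : Module E (T.Sub K hE) := T.subModule K hE

/-- The inclusion of a stable submodule. -/
def Bicomod.subι : BimodHom E B (T.Sub K hE) T where
  toAddMonoidHom := K.subtype.toAddMonoidHom
  map_smul _ _ := rfl
  map_op_smul _ _ := rfl

theorem Bicomod.subι_injective : Function.Injective (T.subι K hE) := Subtype.val_injective

instance : SMulCommClass E Bᵐᵒᵖ (T.Sub K hE) where
  smul_comm e b z := T.subι_injective K hE (smul_comm e b (T.subι K hE z))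

variable (hD : IsFlatLeft B D) (hF : IsFlatRight E F)
  (h : ∀ z : K, ∃ y : BTensor B K D, BTensor.map K.subtype LinearMap.id y = T.coact z)
  (h' : ∀ z : T.Sub K hE, ∃ y : BTensor E F (T.Sub K hE),
    BTensor.map LinearMap.id (T.subι K hE).l y = T.lcoact (T.subι K hE z))

/-- The right coaction of a stable submodule. -/
def Bicomod.subCoact : T.Sub K hE →ₗ[Bᵐᵒᵖ] BTensor B (T.Sub K hE) D :=
  (T.toRComod.sub hD K h).coact

theorem Bicomod.subCoact_spec (z : T.Sub K hE) :
    BTensor.map (T.subι K hE).r LinearMap.id (T.subCoact K hE hD h z) =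
      T.coact (T.subι K hE z) :=
  BTensor.subCoact_spec hD T.coact K h z

theorem Bicomod.subCoact_smul (e : E) (z : T.Sub K hE) :
    T.subCoact K hE hD h (e • z) = e • T.subCoact K hE hD h z := by
  apply hD _ _ (T.subι K hE).r (T.subι_injective K hE)
  rw [BTensor.map_smul_left (T.subι K hE).r LinearMap.id (T.subι K hE).map_smul,
    T.subCoact_spec, T.subCoact_spec, BimodHom.apply_smul, T.coact_smul]

/-- The left coaction of a stable submodule as a left linear map. -/
def Bicomod.subLcoactL : T.Sub K hE →ₗ[E] BTensor E F (T.Sub K hE) :=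
  liftInj (BTensor.mapL F (T.subι K hE).l : BTensor E F (T.Sub K hE) →ₗ[E] BTensor E F T)
    (hF _ _ (T.subι K hE).l (T.subι_injective K hE)) (T.lcoact.l ∘ₗ (T.subι K hE).l) h'

theorem Bicomod.subLcoactL_spec (z : T.Sub K hE) :
    BTensor.map LinearMap.id (T.subι K hE).l (T.subLcoactL K hE hF h' z) =
      T.lcoact (T.subι K hE z) :=
  liftInj_spec (BTensor.mapL F (T.subι K hE).l : BTensor E F (T.Sub K hE) →ₗ[E] BTensor E F T)
    (hF _ _ (T.subι K hE).l (T.subι_injective K hE)) (T.lcoact.l ∘ₗ (T.subι K hE).l) h' z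

/-- The left coaction of a stable submodule. -/
def Bicomod.subLcoact : BimodHom E B (T.Sub K hE) (BTensor E F (T.Sub K hE)) where
  toAddMonoidHom := (T.subLcoactL K hE hF h').toAddMonoidHom
  map_smul := (T.subLcoactL K hE hF h').map_smul
  map_op_smul b z := by
    apply hF _ _ (T.subι K hE).l (T.subι_injective K hE)
    refine (T.subLcoactL_spec K hE hF h' (b • z)).trans ?_
    rw [BTensor.map_smul_right LinearMap.id (T.subι K hE).l (T.subι K hE).map_op_smul,
      BimodHom.apply_op_smul, BimodHom.apply_op_smul]
    exact congrArg (b • ·) (T.subLcoactL_spec K hE hF h' z).symm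

theorem Bicomod.subLcoact_spec (z : T.Sub K hE) :
    BTensor.map LinearMap.id (T.subι K hE).l (T.subLcoact K hE hF h' z) =
      T.lcoact (T.subι K hE z) :=
  T.subLcoactL_spec K hE hF h' z

/-- A submodule of a bicomodule that is stable under the left action and both coactions. -/
def Bicomod.sub : Bicomod F D where
  toRComod := T.toRComod.sub hD K h
  leftModule := inferInstanceAs (Module E (T.Sub K hE))
  smulComm := inferInstanceAs (SMulCommClass E Bᵐᵒᵖ (T.Sub K hE))
  central r z := T.subι_injective K hE (T.central r (T.subι K hE z))
  coact_smul := T.subCoact_smul K hE hD h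
  lcoact := T.subLcoact K hE hF h'
  lcoassoc := by
    change ∀ z : T.Sub K hE, BTensor.assoc (BTensor.map F.comul.r LinearMap.id
      (T.subLcoact K hE hF h' z)) = BTensor.map LinearMap.id (T.subLcoact K hE hF h').l
        (T.subLcoact K hE hF h' z)
    intro z
    have hs := T.subLcoact_spec K hE hF h'
    generalize T.subLcoact K hE hF h' = δ at hs
    apply hF _ _ (BTensor.mapL F (T.subι K hE).l)
      (hF _ _ (T.subι K hE).l (T.subι_injective K hE))
    have hc : BTensor.mapL F (T.subι K hE).l ∘ₗ δ.l = T.lcoact.l ∘ₗ (T.subι K hE).l :=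
      LinearMap.ext hs
    rw [← BTensor.assoc_map_right, BTensor.map_map, BTensor.map_map, hc]
    have h1 := T.lcoassoc (T.subι K hE z)
    rw [← hs, BTensor.map_map, BTensor.map_map] at h1
    exact h1
  counit_lcoact := by
    change ∀ z : T.Sub K hE, BTensor.lid (BTensor.map F.counit.r LinearMap.id
      (T.subLcoact K hE hF h' z)) = z
    intro z
    have hs := T.subLcoact_spec K hE hF h'
    generalize T.subLcoact K hE hF h' = δ at hs
    apply T.subι_injective K hE
    have h1 := T.counit_lcoact (T.subι K hE z)
    rw [← hs] at h1
    refine Eq.trans ?_ h1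
    generalize δ z = w
    induction w using BTensor.induction_on with
    | zero => simp only [map_zero]
    | tmul m n => rfl
    | add x y hx hy => simp only [map_add, hx, hy]
  compat := by
    change ∀ z : T.Sub K hE, BTensor.assoc (BTensor.map (T.subLcoact K hE hF h').r LinearMap.id
      (T.subCoact K hE hD h z)) = BTensor.map LinearMap.id
        (mkLin (T.subCoact K hE hD h).toAddMonoidHom (T.subCoact_smul K hE hD h))
        (T.subLcoact K hE hF h' z)
    intro z
    have hs := T.subLcoact_spec K hE hF h'
    generalize T.subLcoact K hE hF h' = δ at hs
    have ht := T.subCoact_spec K hE hD h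
    have hsm := T.subCoact_smul K hE hD h
    apply hF _ _ (mkLin (BTensor.map (T.subι K hE).r (LinearMap.id : D →ₗ[B] D))
        (BTensor.map_smul_left _ _ (T.subι K hE).map_smul))
      (hD _ _ (T.subι K hE).r (T.subι_injective K hE))
    rw [← BTensor.assoc_map_mid, BTensor.map_map, BTensor.map_map]
    have h1 := T.compat (T.subι K hE z)
    rw [← hs, ← ht, BTensor.map_map, BTensor.map_map] at h1
    have hc : (mkLin (BTensor.map (LinearMap.id : F →ₗ[Eᵐᵒᵖ] F) (T.subι K hE).l)
        (BTensor.map_smul_right _ _ (T.subι K hE).map_op_smul) :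
          BTensor E F (T.Sub K hE) →ₗ[Bᵐᵒᵖ] BTensor E F T) ∘ₗ δ.r =
        T.lcoact.r ∘ₗ (T.subι K hE).r := LinearMap.ext hs
    have hc' : (mkLin (BTensor.map (T.subι K hE).r (LinearMap.id : D →ₗ[B] D))
        (BTensor.map_smul_left _ _ (T.subι K hE).map_smul) :
          BTensor B (T.Sub K hE) D →ₗ[E] BTensor B T D) ∘ₗ mkLin (T.subCoact K hE hD h).toAddMonoidHom hsm =
        mkLin T.coact.toAddMonoidHom T.coact_smul ∘ₗ (T.subι K hE).l := LinearMap.ext ht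
    rw [hc, hc']
    exact h1

end sub

section tensor

variable {F : Coring k E} {C : Coring k A} {D : Coring k B} (X : Bicomod F C) (Y : Bicomod C D)

/-- The left coaction of `X ⊗[A] Y`. -/
def Bicomod.tensorLcoact : BimodHom E B (BTensor A X Y) (BTensor E F (BTensor A X Y)) where
  toAddMonoidHom := (BTensor.coactL Y X.lcoact).toAddMonoidHom
  map_smul := (BTensor.coactL Y X.lcoact).map_smul
  map_op_smul b z := (congrArg BTensor.assoc (BTensor.map_smul_right X.lcoact.r LinearMap.id
    (fun _ _ => rfl) b z)).trans (BTensor.assoc_smul_right b _)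

theorem Bicomod.tensorLcoact_tmul (x : X) (y : Y) :
    X.tensorLcoact Y (BTensor.tmul A x y) = BTensor.assoc (BTensor.tmul A (X.lcoact x) y) := rfl

/-- The bicomodule `X ⊗[A] Y`. -/
def Bicomod.tensor : Bicomod F D where
  toRComod := RComod.tensor X Y
  leftModule := inferInstanceAs (Module E (BTensor A X Y))
  smulComm := inferInstanceAs (SMulCommClass E Bᵐᵒᵖ (BTensor A X Y))
  central := by
    change ∀ (r : k) (z : BTensor A X Y), algebraMap k E r • z = op (algebraMap k B r) • z
    intro r z
    induction z using BTensor.induction_on with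
    | zero => rw [smul_zero, smul_zero]
    | tmul x y =>
      rw [BTensor.smul_tmul, BTensor.smul_tmul_right, X.central, BTensor.op_smul_tmul, Y.central]
    | add x y hx hy => rw [smul_add, smul_add, hx, hy]
  coact_smul e z := (congrArg BTensor.assoc.symm (BTensor.map_smul_left LinearMap.id Y.coactB.l
      (fun _ _ => rfl) e z)).trans (BTensor.assoc_symm_smul_left e _)
  lcoact := X.tensorLcoact Y
  lcoassoc := by
    change ∀ z : BTensor A X Y, BTensor.assoc (BTensor.map F.comul.r LinearMap.id
      (X.tensorLcoact Y z)) = BTensor.map LinearMap.id (X.tensorLcoact Y).l (X.tensorLcoact Y z)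
    intro z
    induction z using BTensor.induction_on with
    | zero => simp only [map_zero]
    | tmul x y =>
      rw [X.tensorLcoact_tmul]
      have h1 : ∀ w : BTensor E F X,
          BTensor.map LinearMap.id (X.tensorLcoact Y).l (BTensor.assoc (BTensor.tmul A w y)) =
          BTensor.map LinearMap.id (mkLin (AddMonoidHom.mk'
            (fun v : BTensor E F X => BTensor.assoc (BTensor.tmul A v y))
            (fun v v' => by rw [BTensor.add_tmul, map_add]))
            (fun e v => BTensor.assoc_smul_left e (BTensor.tmul A v y)))
          (BTensor.map LinearMap.id X.lcoact.l w) := by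
        intro w
        induction w using BTensor.induction_on with
        | zero => simp only [map_zero, BTensor.zero_tmul]
        | tmul f x => rfl
        | add x y hx hy => simp only [map_add, BTensor.add_tmul, hx, hy]
      rw [h1, ← X.lcoassoc]
      generalize X.lcoact x = w
      induction w using BTensor.induction_on with
      | zero => simp only [map_zero, BTensor.zero_tmul]
      | tmul f x =>
        rw [BTensor.assoc_tmul, BTensor.map_tmul, BTensor.map_tmul]
        generalize F.comul.r f = v
        induction v using BTensor.induction_on with
        | zero => simp only [map_zero, BTensor.zero_tmul]
        | tmul f x => rfl
        | add x y hx hy => simp only [map_add, BTensor.add_tmul, hx, hy]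
      | add x y hx hy => simp only [map_add, BTensor.add_tmul, hx, hy]
    | add x y hx hy => simp only [map_add, hx, hy]
  counit_lcoact := by
    change ∀ z : BTensor A X Y, BTensor.lid (BTensor.map F.counit.r LinearMap.id
      (X.tensorLcoact Y z)) = z
    intro z
    induction z using BTensor.induction_on with
    | zero => simp only [map_zero]
    | tmul x y =>
      refine Eq.trans ?_ (congrArg (fun x => BTensor.tmul A x y) (X.counit_lcoact x))
      rw [X.tensorLcoact_tmul]
      generalize X.lcoact x = w
      induction w using BTensor.induction_on with
      | zero => simp only [map_zero, BTensor.zero_tmul]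
      | tmul f x => rfl
      | add x y hx hy => simp only [map_add, BTensor.add_tmul, hx, hy]
    | add x y hx hy => simp only [map_add, hx, hy]
  compat := by
    change ∀ z : BTensor A X Y, BTensor.assoc (BTensor.map (X.tensorLcoact Y).r LinearMap.id
      (BTensor.coactR X Y.coactB z)) = BTensor.map LinearMap.id
        (mkLin (BTensor.coactR X Y.coactB).toAddMonoidHom _) (X.tensorLcoact Y z)
    intro z
    induction z using BTensor.induction_on with
    | zero => simp only [map_zero]
    | tmul x y =>
      rw [X.tensorLcoact_tmul, BTensor.coactR_tmul, Bicomod.coactB_apply]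
      have h1 : ∀ w : BTensor B Y D,
          BTensor.assoc (BTensor.map (X.tensorLcoact Y).r LinearMap.id
            (BTensor.assoc.symm (BTensor.tmul A x w))) =
          BTensor.map LinearMap.id (mkLin BTensor.assoc.symm.toAddMonoidHom
            BTensor.assoc_symm_smul_left) (BTensor.assoc (BTensor.tmul A (X.lcoact x) w)) := by
        intro w
        induction w using BTensor.induction_on with
        | zero => simp only [map_zero, BTensor.tmul_zero]
        | tmul y d =>
          rw [BTensor.assoc_symm_tmul, BTensor.map_tmul, BimodHom.r_apply, X.tensorLcoact_tmul]
          generalize X.lcoact x = v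
          induction v using BTensor.induction_on with
          | zero => simp only [map_zero, BTensor.zero_tmul]
          | tmul f x => rfl
          | add x y hx hy => simp only [map_add, BTensor.add_tmul, hx, hy]
        | add x y hx hy => simp only [map_add, BTensor.tmul_add, hx, hy]
      rw [h1]
      generalize X.lcoact x = v
      induction v using BTensor.induction_on with
      | zero => simp only [map_zero, BTensor.zero_tmul]
      | tmul f x => rfl
      | add x y hx hy => simp only [map_add, BTensor.add_tmul, hx, hy]
    | add x y hx hy => simp only [map_add, hx, hy]

/-- The map `ω` is left linear. -/
theorem Bicomod.omega_smul (e : E) (z : BTensor A X Y) :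
    X.toRComod.omega Y (e • z) = e • X.toRComod.omega Y z := by
  rw [RComod.omega_apply, RComod.omega_apply, BTensor.map_smul_left _ _ X.coact_smul,
    BTensor.map_smul_left _ _ (fun _ _ => rfl), BTensor.assoc_smul_left, smul_sub]

/-- The map `ω` as a left linear map. -/
def Bicomod.omegaL : BTensor A X Y →ₗ[E] BTensor A X (BTensor A C Y) :=
  mkLin (X.toRComod.omega Y).toAddMonoidHom (X.omega_smul Y)

theorem Bicomod.omegaL_apply (z : BTensor A X Y) : X.omegaL Y z = X.toRComod.omega Y z := rfl

/-- The map `ω` is left colinear. -/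
theorem Bicomod.map_omegaL_lcoact (z : BTensor A X Y) :
    BTensor.map LinearMap.id (X.omegaL Y) (X.tensorLcoact Y z) =
      BTensor.coactL (BTensor A C Y) X.lcoact (X.toRComod.omega Y z) := by
  induction z using BTensor.induction_on with
  | zero => simp only [map_zero]
  | tmul x y =>
    rw [X.tensorLcoact_tmul, RComod.omega_tmul, map_sub, BTensor.coactL_tmul]
    let Θ : BTensor E F (BTensor A X C) →+ BTensor E F (BTensor A X (BTensor A C Y)) :=
      BTensor.map LinearMap.id (mkLin (AddMonoidHom.mk'
        (fun v : BTensor A X C => BTensor.assoc (BTensor.tmul A v y))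
        (fun v v' => by rw [BTensor.add_tmul, map_add]))
        (fun e v => BTensor.assoc_smul_left e (BTensor.tmul A v y)))
    have h1 : ∀ u : BTensor E F X,
        BTensor.map LinearMap.id (X.omegaL Y) (BTensor.assoc (BTensor.tmul A u y)) =
        Θ (BTensor.map LinearMap.id (mkLin X.coact.toAddMonoidHom X.coact_smul) u) -
          BTensor.assoc (BTensor.tmul A u (Y.lcoact y)) := by
      intro u
      induction u using BTensor.induction_on with
      | zero => simp only [map_zero, BTensor.zero_tmul, sub_zero]
      | tmul f x =>
        rw [BTensor.assoc_tmul, BTensor.map_tmul, X.omegaL_apply, RComod.omega_tmul,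
          BTensor.assoc_tmul, eq_sub_iff_add_eq, LinearMap.id_apply, ← BTensor.tmul_add,
          sub_add_cancel]
        rfl
      | add x y hx hy =>
        simp only [map_add, BTensor.add_tmul, hx, hy]
        abel
    rw [h1, ← X.compat]
    congr 1
    generalize X.coact x = w
    induction w using BTensor.induction_on with
    | zero => simp only [map_zero, BTensor.zero_tmul]
    | tmul x c =>
      rw [BTensor.map_tmul, BTensor.assoc_tmul, BTensor.coactL_tmul, BimodHom.r_apply]
      generalize X.lcoact x = v
      induction v using BTensor.induction_on with
      | zero => simp only [map_zero, BTensor.zero_tmul]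
      | tmul f x => rfl
      | add x y hx hy => simp only [map_add, BTensor.add_tmul, hx, hy]
    | add x y hx hy => simp only [map_add, BTensor.add_tmul, hx, hy]
  | add x y hx hy => simp only [map_add, hx, hy]

theorem Bicomod.ker_omega_smul (e : E) (z : X.tensor Y)
    (hz : z ∈ (LinearMap.ker (X.toRComod.omega Y) : Submodule Bᵐᵒᵖ (X.tensor Y))) :
    e • z ∈ (LinearMap.ker (X.toRComod.omega Y) : Submodule Bᵐᵒᵖ (X.tensor Y)) :=
  LinearMap.mem_ker.2 ((X.omega_smul Y e z).trans
    ((congrArg (e • ·) (LinearMap.mem_ker.1 hz)).trans (smul_zero e)))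

theorem Bicomod.exists_lcoact (hF : IsFlatRight E F)
    (z : (X.tensor Y).Sub (LinearMap.ker (X.toRComod.omega Y)) (X.ker_omega_smul Y)) :
    ∃ y : BTensor E F ((X.tensor Y).Sub (LinearMap.ker (X.toRComod.omega Y))
        (X.ker_omega_smul Y)),
      BTensor.map LinearMap.id ((X.tensor Y).subι (LinearMap.ker (X.toRComod.omega Y))
        (X.ker_omega_smul Y)).l y = (X.tensor Y).lcoact ((X.tensor Y).subι
        (LinearMap.ker (X.toRComod.omega Y)) (X.ker_omega_smul Y) z) := by
  obtain ⟨y, hy⟩ := BTensor.exists_of_map_eq_zero_right hF (X.omegaL Y)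
    (X.tensorLcoact Y z.1) ((X.map_omegaL_lcoact Y z.1).trans
      ((congrArg _ (LinearMap.mem_ker.1 z.2)).trans (map_zero _)))
  let j : LinearMap.ker (X.omegaL Y) →ₗ[E] (X.tensor Y).Sub (LinearMap.ker (X.toRComod.omega Y))
      (X.ker_omega_smul Y) :=
    { toFun := fun z => ⟨z.1, z.2⟩
      map_add' := fun _ _ => rfl
      map_smul' := fun _ _ => rfl }
  refine ⟨BTensor.map LinearMap.id j y, ?_⟩
  rw [BTensor.map_map]
  exact hy

/-- The cotensor product `X □_C Y` of two bicomodules. -/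
def Bicomod.cotensor [F.IsFlat] [D.IsFlat] : Bicomod F D :=
  (X.tensor Y).sub (LinearMap.ker (X.toRComod.omega Y)) (X.ker_omega_smul Y)
    Coring.IsFlat.left Coring.IsFlat.right
    (RComod.exists_coact X.toRComod Y Coring.IsFlat.left)
    (X.exists_lcoact Y Coring.IsFlat.right)

end tensor

/-! ### The right Picard group -/

/-- `C` and `D` are Morita-Takeuchi right equivalent: there is a right
invertible `(C, D)`-bicomodule. -/
def Coring.MTEquiv (C : Coring k A) (D : Coring k B) [D.IsFlat] : Prop :=
  ∃ X : Bicomod C D, X.IsRightInvertible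

/-- Isomorphism of right invertible bicomodules over `C`. -/
def Coring.rPicSetoid (C : Coring k A) [C.IsFlat] :
    Setoid {X : Bicomod C C // X.IsRightInvertible} where
  r X Y := Nonempty (X.1 ≅ Y.1)
  iseqv := ⟨fun _ => ⟨Iso.refl _⟩, fun ⟨e⟩ => ⟨e.symm⟩, fun ⟨e⟩ ⟨e'⟩ => ⟨e ≪≫ e'⟩⟩

/-- The set `Pic_r(C)` of isomorphism classes of right invertible `C`-bicomodules. -/
def Coring.RPic (C : Coring k A) [C.IsFlat] : Type (u + 1) := Quotient C.rPicSetoid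

/-- The isomorphism class of a right invertible bicomodule. -/
def Coring.RPic.mk {C : Coring k A} [C.IsFlat] (X : Bicomod C C) (hX : X.IsRightInvertible) :
    C.RPic :=
  Quotient.mk C.rPicSetoid ⟨X, hX⟩

/-- The group structure `G` on `Pic_r(C)` is the one induced by the cotensor product: the product of
the classes of `X` and `Y` is the class of `X □_C Y`, and the unit is the class of `C`. -/
def Coring.IsCotensorGroup (C : Coring k A) [C.IsFlat] (G : Group C.RPic) : Prop :=
  (∀ (X Y : Bicomod C C) (hX : X.IsRightInvertible) (hY : Y.IsRightInvertible),
    ∃ hXY : (X.cotensor Y).IsRightInvertible,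
      G.mul (RPic.mk X hX) (RPic.mk Y hY) = RPic.mk (X.cotensor Y) hXY) ∧
  ∃ hC : C.regular.IsRightInvertible, G.one = RPic.mk C.regular hC

end bicotensor

end

noncomputable section

/-! ### Right exactness of the tensor product, and flatness of free modules -/

namespace BTensor

variable {A : Type u} [Ring A] {M N M' N' : Type u} [AddCommGroup M] [Module Aᵐᵒᵖ M]
  [AddCommGroup N] [Module A N] [AddCommGroup M'] [Module Aᵐᵒᵖ M'] [AddCommGroup N'] [Module A N']

/-! Bicomodules are replaced by their cotensor functors. Write `F_X` for `- □_C X`. Three facts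
reduce the theorem to formal manipulation of equivalences of categories.

Composition. If `Y` is right invertible, then `F_{X □ Y}` is `F_X` followed by `F_Y`
(`Bicomod.IsRightInvertible.cotensorFunctor_cotensor`). The cotensor product is not associative in
general; here it is, because an equivalence between comodule categories is exact, as one sees from
kernels, cokernels and zero morphisms alone. Exactness of `F_X`, applied along a surjection from a
free module onto an arbitrary right module `N`, gives `N ⊗ (T □ X) = (N ⊗ T) □ X` without any
flatness of `N` (`exists_map_cotensorιL`, `map_cotensorιL_injective`). This exchange property and
the left exactness of `F_Y` identify `M □ (X □ Y)` and `(M □ X) □ Y` inside `(M ⊗ X) ⊗ Y`.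

Recovery. `X ≅ C □ X` as right comodules, and both left multiplications and `Δ : C → C ⊗ C` are
morphisms of right comodules. Hence a natural isomorphism `F_X ≅ F_Y`, evaluated at `C`, is
automatically left linear and left colinear (`Bicomod.nonempty_iso_of_natIso`). With
`cotensorFunctor_congr`, the class of `X` is the same datum as the isomorphism class of `F_X`.

Inversion. Let `X` be a right invertible `(C, D)`-bicomodule. There is a right `C`-comodule `Y` with
`Y □ X ≅ D`. By full faithfulness, left multiplication by elements of `B` on `D` transports to a
left action on `Y`, and `Δ_D`, read as a map `D → (D ⊗ Y) □ X`, transports to a left coaction `Y → D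
⊗ Y`. The axioms hold because they hold after the faithful functor `F_X`. Thus `Y □ X ≅ D` as
bicomodules (`exists_nonempty_regular_iso`), and `F_Y` is a quasi-inverse of `F_X`
(`exists_inverse`).

The group axioms are now those of composition of equivalences, and a right invertible `X` with
inverse `Y` induces the isomorphism `Z ↦ Y □ Z □ X` between Picard groups.

For `Ω`, the functor of `_fC` is restriction along `f`, with action `m ρ(a)` and coaction `m₀ ⊗
φ⁻¹(m₁)` (`nonempty_twistFunctor_iso`), and restriction is visibly multiplicative in `f`. For the
kernel, an isomorphism `_fC ≅ C` is in particular a right colinear automorphism of `C`, hence the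
action `c ↦ p(c₁) c₂` of an invertible `p ∈ C*`; given right colinearity, left linearity and left
colinearity together amount to `φ(c₁) p(c₂) = p(c₁) c₂` (`Coring.mem_rInn_iff`). -/

theorem map_zero_left (g : N →ₗ[A] N') (z : BTensor A M N) :
    map (0 : M →ₗ[Aᵐᵒᵖ] M') g z = 0 := by
  induction z using induction_on with
  | zero => rw [map_zero]
  | tmul m n => simp
  | add x y hx hy => rw [map_add, hx, hy, add_zero]

theorem map_add_left (f f' : M →ₗ[Aᵐᵒᵖ] M') (g : N →ₗ[A] N') (z : BTensor A M N) :
    map (f + f') g z = map f g z + map f' g z := by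
  induction z using induction_on with
  | zero => simp only [map_zero, add_zero]
  | tmul m n => simp [add_tmul]
  | add x y hx hy => simp only [map_add, hx, hy]; abel

theorem map_surjective {f : M →ₗ[Aᵐᵒᵖ] M'} {g : N →ₗ[A] N'} (hf : Function.Surjective f)
    (hg : Function.Surjective g) : Function.Surjective (map f g) := by
  intro z
  induction z using induction_on with
  | zero => exact ⟨0, map_zero _⟩
  | tmul m n =>
    obtain ⟨m, rfl⟩ := hf m
    obtain ⟨n, rfl⟩ := hg n
    exact ⟨tmul A m n, rfl⟩
  | add x y hx hy =>
    obtain ⟨x, rfl⟩ := hx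
    obtain ⟨y, rfl⟩ := hy
    exact ⟨x + y, map_add _ _ _⟩

theorem map_congr {f f' : M →ₗ[Aᵐᵒᵖ] M'} {g g' : N →ₗ[A] N'} (hf : ∀ m, f m = f' m)
    (hg : ∀ n, g n = g' n) (z : BTensor A M N) : map f g z = map f' g' z := by
  rw [LinearMap.ext hf, LinearMap.ext hg]

/-- Right exactness along an arbitrary surjective map. -/
theorem exists_of_map_eq_zero_of_surjective (f : M →ₗ[Aᵐᵒᵖ] M') (hf : Function.Surjective f)
    (z : BTensor A M N) (hz : map f LinearMap.id z = 0) :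
    ∃ y : BTensor A (LinearMap.ker f) N, map (LinearMap.ker f).subtype LinearMap.id y = z := by
  apply exists_of_map_mkQ_left
  have h := congrArg (map (f.quotKerEquivOfSurjective hf).symm.toLinearMap
    (LinearMap.id : N →ₗ[A] N)) hz
  rw [map_map, map_zero] at h
  refine (map_congr (fun m => ?_) (fun _ => rfl) z).trans h
  exact ((f.quotKerEquivOfSurjective hf).symm_apply_eq.2 rfl).symm

end BTensor

/-- A free right module is flat. -/
theorem isFlatRight_finsupp (A : Type u) [Ring A] (J : Type u) : IsFlatRight A (J →₀ Aᵐᵒᵖ) := by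
  classical
  intro N N' _ _ _ _ g hg
  -- `ψ` and `χ` identify `A^(J) ⊗ N` with `J →₀ N`. Only `χ ∘ ψ = id` and naturality of `ψ` are
  -- needed, since injectivity can then be read off coordinatewise.
  let ψ (N : Type u) [AddCommGroup N] [Module A N] : BTensor A (J →₀ Aᵐᵒᵖ) N →+ (J →₀ N) :=
    BTensor.lift (BTensor.mkBi (fun p n => p.mapRange (fun s => unop s • n) (zero_smul _ _))
      (fun p p' n => by ext j; simp [add_smul]) (fun p n n' => by ext j; simp))
      (fun p a n => by ext j; simp [mul_smul])
  let χ (N : Type u) [AddCommGroup N] [Module A N] : (J →₀ N) →+ BTensor A (J →₀ Aᵐᵒᵖ) N :=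
    Finsupp.liftAddHom (fun j => AddMonoidHom.mk' (fun n => BTensor.tmul A (Finsupp.single j 1) n)
      (fun _ _ => BTensor.tmul_add _ _ _))
  have hχ : ∀ z : BTensor A (J →₀ Aᵐᵒᵖ) N, χ N (ψ N z) = z := by
    intro z
    induction z using BTensor.induction_on with
    | zero => simp only [map_zero]
    | tmul p n =>
      change χ N (p.mapRange (fun s => unop s • n) (zero_smul _ _)) = _
      induction p using Finsupp.induction_linear with
      | zero => simp
      | add p q hp hq =>
        rw [BTensor.add_tmul, ← hp, ← hq, ← map_add]
        congr 1
        ext j; simp [add_smul]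
      | single j s =>
        rw [Finsupp.mapRange_single]
        refine (Finsupp.liftAddHom_apply_single _ _ _).trans ?_
        change BTensor.tmul A _ (unop s • n) = _
        rw [← BTensor.op_smul_tmul, Finsupp.smul_single, smul_eq_mul, op_unop, mul_one]
    | add x y hx hy => rw [map_add, map_add, hx, hy]
  have hψ : ∀ z : BTensor A (J →₀ Aᵐᵒᵖ) N, ψ N' (BTensor.map LinearMap.id g z) =
      Finsupp.mapRange g (map_zero g) (ψ N z) := by
    intro z
    induction z using BTensor.induction_on with
    | zero => simp
    | tmul p n =>
      ext j
      change unop (p j) • g n = g (unop (p j) • n)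
      rw [g.map_smul]
    | add x y hx hy =>
      rw [map_add, map_add, map_add, hx, hy]
      ext j; simp
  intro x y hxy
  have h := congrArg (ψ N') hxy
  rw [hψ, hψ] at h
  rw [← hχ x, ← hχ y, Finsupp.mapRange_injective g (map_zero g) hg h]

/-! ### Kernels, cokernels and factorizations for right comodules -/

section comod

variable {k : Type v} [CommRing k] {A B : Type u} [Ring A] [Algebra k A] [Ring B] [Algebra k B]
  {C : Coring k A} {D : Coring k B}

namespace RComod

@[simp] theorem comp_lin {M N P : RComod C} (f : M ⟶ N) (g : N ⟶ P) :
    (f ≫ g).lin = g.lin ∘ₗ f.lin := rfl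

theorem hom_ext {M N : RComod C} {f g : M ⟶ N} (h : ∀ m, f.lin m = g.lin m) : f = g :=
  RComod.Hom.ext (LinearMap.ext h)

theorem congr_lin {M N : RComod C} {f g : M ⟶ N} (h : f = g) (m : M) : f.lin m = g.lin m := by
  rw [h]

/-- The zero morphism. -/
def zeroHom (M N : RComod C) : M ⟶ N :=
  ⟨0, fun m => by rw [BTensor.map_zero_left, LinearMap.zero_apply, map_zero]⟩

/-- The sum of two morphisms. -/
def addHom {M N : RComod C} (f g : M ⟶ N) : M ⟶ N :=
  ⟨f.lin + g.lin, fun m => by rw [BTensor.map_add_left, f.comm, g.comm, LinearMap.add_apply,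
    map_add]⟩

/-- A bijective morphism is an isomorphism. -/
def isoOfBijective {M N : RComod C} (f : M ⟶ N) (hf : Function.Bijective f.lin) : M ≅ N where
  hom := f
  inv := ⟨(LinearEquiv.ofBijective f.lin hf).symm.toLinearMap, fun n => by
    obtain ⟨m, rfl⟩ := hf.2 n
    have h1 : ∀ m, (LinearEquiv.ofBijective f.lin hf).symm.toLinearMap (f.lin m) = m :=
      (LinearEquiv.ofBijective f.lin hf).symm_apply_apply
    rw [h1, ← f.comm, BTensor.map_map]
    exact (BTensor.map_congr h1 (fun _ => rfl) _).trans (BTensor.map_id_id _)⟩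
  hom_inv_id := hom_ext (LinearEquiv.ofBijective f.lin hf).symm_apply_apply
  inv_hom_id := hom_ext (LinearEquiv.ofBijective f.lin hf).apply_symm_apply

theorem hom_inv_lin {M N : RComod C} (e : M ≅ N) (m : M) : e.inv.lin (e.hom.lin m) = m :=
  congr_lin e.hom_inv_id m

theorem inv_hom_lin {M N : RComod C} (e : M ≅ N) (n : N) : e.hom.lin (e.inv.lin n) = n :=
  congr_lin e.inv_hom_id n

theorem iso_bijective {M N : RComod C} (e : M ≅ N) : Function.Bijective e.hom.lin :=
  ⟨fun x y h => by rw [← hom_inv_lin e x, h, hom_inv_lin],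
    fun n => ⟨e.inv.lin n, inv_hom_lin e n⟩⟩

section quotient

variable {M N : RComod C} (f : M ⟶ N)

/-- The coaction of a cokernel. -/
def cokerCoact : (N ⧸ LinearMap.range f.lin) →ₗ[Aᵐᵒᵖ]
    BTensor A (N ⧸ LinearMap.range f.lin) C :=
  (LinearMap.range f.lin).liftQ
    ((BTensor.mapR (LinearMap.range f.lin).mkQ C : BTensor A N C →ₗ[Aᵐᵒᵖ] _) ∘ₗ N.coact) (by
      rintro _ ⟨m, rfl⟩
      rw [LinearMap.mem_ker, LinearMap.comp_apply, BTensor.mapR_apply, ← f.comm, BTensor.map_map]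
      refine (BTensor.map_congr (fun m => ?_) (fun _ => rfl) _).trans
        (BTensor.map_zero_left LinearMap.id _)
      exact (Submodule.Quotient.mk_eq_zero _).2 ⟨m, rfl⟩)

theorem cokerCoact_mkQ (n : N) : cokerCoact f ((LinearMap.range f.lin).mkQ n) =
    BTensor.map (LinearMap.range f.lin).mkQ LinearMap.id (N.coact n) := rfl

/-- The cokernel of a morphism of comodules. -/
def coker : RComod C where
  carrier := N ⧸ LinearMap.range f.lin
  coact := cokerCoact f
  coassoc q := by
    obtain ⟨n, rfl⟩ := (LinearMap.range f.lin).mkQ_surjective q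
    have hc : cokerCoact f ∘ₗ (LinearMap.range f.lin).mkQ =
      (BTensor.mapR (LinearMap.range f.lin).mkQ C : BTensor A N C →ₗ[Aᵐᵒᵖ] _) ∘ₗ N.coact := rfl
    have h := congrArg (BTensor.map (LinearMap.range f.lin).mkQ LinearMap.id) (N.coassoc n)
    rw [← BTensor.assoc_map_left, BTensor.map_map] at h
    rw [cokerCoact_mkQ, BTensor.map_map, hc]
    refine h.trans ?_
    rw [BTensor.map_map, BTensor.map_map]
    rfl
  coact_counit q := by
    obtain ⟨n, rfl⟩ := (LinearMap.range f.lin).mkQ_surjective q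
    have h := congrArg (LinearMap.range f.lin).mkQ (N.coact_counit n)
    rw [cokerCoact_mkQ, BTensor.map_map]
    refine Eq.trans ?_ h
    generalize N.coact n = w
    induction w using BTensor.induction_on with
    | zero => simp only [map_zero]
    | tmul m n => rfl
    | add x y hx hy => simp only [map_add, hx, hy]

/-- The projection to the cokernel. -/
def cokerπ : N ⟶ coker f := ⟨(LinearMap.range f.lin).mkQ, fun _ => rfl⟩

theorem cokerπ_eq_zero_iff (n : N) : (cokerπ f).lin n = 0 ↔ ∃ m, f.lin m = n :=
  Submodule.Quotient.mk_eq_zero _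

theorem comp_cokerπ : f ≫ cokerπ f = zeroHom M (coker f) :=
  hom_ext fun m => (cokerπ_eq_zero_iff f _).2 ⟨m, rfl⟩

end quotient

section kernel

variable {M N : RComod C} (hC : IsFlatLeft A C) (f : M ⟶ N)

/-- The kernel of a morphism of comodules. -/
def kernel : RComod C :=
  RComod.sub hC M (LinearMap.ker f.lin) (fun z => by
    apply BTensor.exists_of_map_eq_zero_left hC
    rw [f.comm, z.2, map_zero])

/-- The inclusion of the kernel. -/
def kernelι : kernel hC f ⟶ M :=
  ⟨(LinearMap.ker f.lin).subtype, BTensor.subCoact_spec hC _ _ _⟩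

theorem exists_kernelι {m : M} (hm : f.lin m = 0) : ∃ z, (kernelι hC f).lin z = m := ⟨⟨m, hm⟩, rfl⟩

theorem kernelι_comp : kernelι hC f ≫ f = zeroHom _ N :=
  hom_ext fun m => Subtype.property (p := fun z => z ∈ LinearMap.ker f.lin) m

end kernel

section factor

variable {M N P : RComod C}

/-- A morphism that kills the kernel of a surjective morphism factors through it. -/
theorem exists_factor_of_surjective (g : M ⟶ N) (hg : Function.Surjective g.lin) (q : M ⟶ P)
    (hq : ∀ m, g.lin m = 0 → q.lin m = 0) : ∃ s : N ⟶ P, g ≫ s = q := by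
  let e := g.lin.quotKerEquivOfSurjective hg
  let s : N →ₗ[Aᵐᵒᵖ] P := (LinearMap.ker g.lin).liftQ q.lin hq ∘ₗ e.symm.toLinearMap
  have hs : ∀ m, s (g.lin m) = q.lin m := fun m => by
    have : e.symm (g.lin m) = (LinearMap.ker g.lin).mkQ m := e.symm_apply_eq.2 rfl
    change (LinearMap.ker g.lin).liftQ q.lin hq (e.symm (g.lin m)) = _
    rw [this]; rfl
  refine ⟨⟨s, fun n => ?_⟩, hom_ext hs⟩
  obtain ⟨m, rfl⟩ := hg n
  rw [hs, ← g.comm, ← q.comm, BTensor.map_map]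
  exact BTensor.map_congr hs (fun _ => rfl) _

/-- A morphism with values in the image of an injective morphism factors through it. -/
theorem exists_lift_of_injective (hC : IsFlatLeft A C) (f : M ⟶ N)
    (hf : Function.Injective f.lin) (q : P ⟶ N) (hq : ∀ p, ∃ m, f.lin m = q.lin p) :
    ∃ s : P ⟶ M, s ≫ f = q := by
  have hs := liftInj_spec f.lin hf q.lin hq
  refine ⟨⟨liftInj f.lin hf q.lin hq, fun p => ?_⟩, hom_ext hs⟩
  -- Colinearity of the lift is tested after the injection `f ⊗ C`; this is where flatness of `C`
  -- enters.
  apply hC _ _ f.lin hf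
  rw [f.comm, hs, ← q.comm, BTensor.map_map]
  exact BTensor.map_congr hs (fun _ => rfl) _

end factor

end RComod

/-! ### Exactness of the cotensor functor of a right invertible bicomodule -/

section exactness

variable [D.IsFlat] (X : Bicomod C D)

theorem cotensorFunctor_map_zero (M N : RComod C) :
    (cotensorFunctor X).map (RComod.zeroHom M N) = RComod.zeroHom _ _ :=
  RComod.hom_ext fun z => N.cotensorι_injective X
    ((BTensor.map_zero_left LinearMap.id (M.cotensorι X z)).trans (map_zero _).symm)

theorem cotensorFunctor_map_add {M N : RComod C} (f g : M ⟶ N) :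
    (cotensorFunctor X).map (RComod.addHom f g) =
      RComod.addHom ((cotensorFunctor X).map f) ((cotensorFunctor X).map g) :=
  RComod.hom_ext fun z => N.cotensorι_injective X
    (BTensor.map_add_left f.lin g.lin LinearMap.id (M.cotensorι X z))

namespace Bicomod.IsRightInvertible

variable {X} (hX : X.IsRightInvertible) {M N P : RComod C}

include hX

theorem map_injective {f g : M ⟶ N}
    (h : (cotensorFunctor X).map f = (cotensorFunctor X).map g) : f = g :=
  haveI : (cotensorFunctor X).IsEquivalence := hX
  (cotensorFunctor X).map_injective h

theorem exists_map_eq (q : (cotensorFunctor X).obj M ⟶ (cotensorFunctor X).obj N) :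
    ∃ f : M ⟶ N, (cotensorFunctor X).map f = q :=
  haveI : (cotensorFunctor X).IsEquivalence := hX
  (cotensorFunctor X).map_surjective q

theorem exists_iso (Q : RComod D) : ∃ Q' : RComod C, Nonempty ((cotensorFunctor X).obj Q' ≅ Q) :=
  haveI : (cotensorFunctor X).IsEquivalence := hX
  ⟨_, ⟨(cotensorFunctor X).objObjPreimageIso Q⟩⟩

/-- Every comodule is isomorphic to one in the image of the equivalence, so the projection onto the
cokernel of `g □ X` comes from a morphism `q` with `g ≫ q = 0`. As `g` is surjective, `q` vanishes,
and with it the projection. Cokernels of comodules exist without flatness. -/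
theorem cotensorMap_surjective (g : M ⟶ N) (hg : Function.Surjective g.lin) :
    Function.Surjective (RComod.cotensorMap g X) := by
  intro t
  obtain ⟨Q, ⟨e⟩⟩ := hX.exists_iso (RComod.coker ((cotensorFunctor X).map g))
  obtain ⟨q, hq⟩ := hX.exists_map_eq (RComod.cokerπ ((cotensorFunctor X).map g) ≫ e.inv)
  have h1 : g ≫ q = RComod.zeroHom M Q := hX.map_injective (by
    rw [Functor.map_comp, hq, ← Category.assoc, RComod.comp_cokerπ, cotensorFunctor_map_zero]
    exact RComod.hom_ext fun m => map_zero e.inv.lin)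
  have h2 : q = RComod.zeroHom N Q := RComod.hom_ext fun n => by
    obtain ⟨m, rfl⟩ := hg n
    exact RComod.congr_lin h1 m
  rw [h2, cotensorFunctor_map_zero] at hq
  have h3 : e.inv.lin ((RComod.cokerπ ((cotensorFunctor X).map g)).lin t) = 0 :=
    (RComod.congr_lin hq t).symm
  have h4 : (RComod.cokerπ ((cotensorFunctor X).map g)).lin t = 0 :=
    (RComod.iso_bijective e.symm).1 (h3.trans (map_zero _).symm)
  exact (RComod.cokerπ_eq_zero_iff _ t).1 h4

/-- The projection onto the cokernel of `f □ X` comes from some `q` with `f ≫ q = 0`. By exactness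
`q` factors through `g`, so the projection factors through `g □ X` and kills whatever `g □ X` kills.
-/
theorem cotensorMap_exact_of_surjective (f : M ⟶ N) (g : N ⟶ P)
    (hg : Function.Surjective g.lin) (hfg : ∀ n, g.lin n = 0 → ∃ m, f.lin m = n)
    (t : N.cotensor X) (ht : RComod.cotensorMap g X t = 0) :
    ∃ s, RComod.cotensorMap f X s = t := by
  obtain ⟨Q, ⟨e⟩⟩ := hX.exists_iso (RComod.coker ((cotensorFunctor X).map f))
  obtain ⟨q, hq⟩ := hX.exists_map_eq (RComod.cokerπ ((cotensorFunctor X).map f) ≫ e.inv)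
  have h1 : f ≫ q = RComod.zeroHom M Q := hX.map_injective (by
    rw [Functor.map_comp, hq, ← Category.assoc, RComod.comp_cokerπ, cotensorFunctor_map_zero]
    exact RComod.hom_ext fun m => map_zero e.inv.lin)
  obtain ⟨s, rfl⟩ := RComod.exists_factor_of_surjective g hg q (fun n hn => by
    obtain ⟨m, rfl⟩ := hfg n hn
    exact RComod.congr_lin h1 m)
  rw [Functor.map_comp] at hq
  have h3 : e.inv.lin ((RComod.cokerπ ((cotensorFunctor X).map f)).lin t) = 0 :=
    (RComod.congr_lin hq t).symm.trans
      ((congrArg ((cotensorFunctor X).map s).lin ht).trans (map_zero _))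
  have h4 : (RComod.cokerπ ((cotensorFunctor X).map f)).lin t = 0 :=
    (RComod.iso_bijective e.symm).1 (h3.trans (map_zero _).symm)
  exact (RComod.cokerπ_eq_zero_iff _ t).1 h4

/-- Dual to surjectivity: the kernel of `f □ X` is a comodule because `D` is flat, and its inclusion
comes from a morphism `i` with `i ≫ f = 0`, which is zero. -/
theorem cotensorMap_injective (f : M ⟶ N) (hf : Function.Injective f.lin) :
    Function.Injective (RComod.cotensorMap f X) := by
  rw [injective_iff_map_eq_zero]
  intro t ht
  have hD : IsFlatLeft B D := Coring.IsFlat.left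
  obtain ⟨K, ⟨e⟩⟩ := hX.exists_iso (RComod.kernel hD ((cotensorFunctor X).map f))
  obtain ⟨i, hi⟩ := hX.exists_map_eq (e.hom ≫ RComod.kernelι hD ((cotensorFunctor X).map f))
  have h1 : i ≫ f = RComod.zeroHom K N := hX.map_injective (by
    rw [Functor.map_comp, hi, Category.assoc, RComod.kernelι_comp, cotensorFunctor_map_zero]
    rfl)
  have h2 : i = RComod.zeroHom K M := RComod.hom_ext fun m => hf
    ((RComod.congr_lin h1 m).trans (map_zero f.lin).symm)
  obtain ⟨z, rfl⟩ := RComod.exists_kernelι hD ((cotensorFunctor X).map f) ht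
  obtain ⟨w, rfl⟩ := (RComod.iso_bijective e).2 z
  rw [h2, cotensorFunctor_map_zero] at hi
  exact (RComod.congr_lin hi w).symm

/-- The inclusion of the kernel of `g □ X` comes from a morphism `i` with `i ≫ g = 0`. By exactness
`i` takes values in the image of `f`, and flatness of `C` makes its lift through the injective `f`
colinear. -/
theorem cotensorMap_exact_of_injective [C.IsFlat] (f : M ⟶ N) (g : N ⟶ P)
    (hf : Function.Injective f.lin) (hfg : ∀ n, g.lin n = 0 → ∃ m, f.lin m = n)
    (t : N.cotensor X) (ht : RComod.cotensorMap g X t = 0) :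
    ∃ s, RComod.cotensorMap f X s = t := by
  have hD : IsFlatLeft B D := Coring.IsFlat.left
  obtain ⟨K, ⟨e⟩⟩ := hX.exists_iso (RComod.kernel hD ((cotensorFunctor X).map g))
  obtain ⟨i, hi⟩ := hX.exists_map_eq (e.hom ≫ RComod.kernelι hD ((cotensorFunctor X).map g))
  have h1 : i ≫ g = RComod.zeroHom K P := hX.map_injective (by
    rw [Functor.map_comp, hi, Category.assoc, RComod.kernelι_comp, cotensorFunctor_map_zero]
    rfl)
  obtain ⟨s, rfl⟩ := RComod.exists_lift_of_injective Coring.IsFlat.left f hf i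
    (fun n => hfg _ (RComod.congr_lin h1 n))
  obtain ⟨z, rfl⟩ := RComod.exists_kernelι hD ((cotensorFunctor X).map g) ht
  obtain ⟨w, rfl⟩ := (RComod.iso_bijective e).2 z
  rw [Functor.map_comp] at hi
  exact ⟨_, RComod.congr_lin hi w⟩

end Bicomod.IsRightInvertible

end exactness

end comod

theorem BTensor.tmul_sub {A : Type u} [Ring A] {M N : Type u} [AddCommGroup M] [Module Aᵐᵒᵖ M]
    [AddCommGroup N] [Module A N] (m : M) (n n' : N) :
    BTensor.tmul A m (n - n') = BTensor.tmul A m n - BTensor.tmul A m n' := by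
  rw [eq_sub_iff_add_eq, ← BTensor.tmul_add, sub_add_cancel]

theorem BTensor.hom_ext_assoc {A B : Type u} [Ring A] [Ring B] {M N P R : Type u} [AddCommGroup M]
    [Module Aᵐᵒᵖ M] [AddCommGroup N] [Module A N] [Module Bᵐᵒᵖ N] [SMulCommClass A Bᵐᵒᵖ N]
    [AddCommGroup P] [Module B P] [AddCommGroup R] {f g : BTensor B (BTensor A M N) P →+ R}
    (h : ∀ m n p, f (BTensor.tmul B (BTensor.tmul A m n) p) =
      g (BTensor.tmul B (BTensor.tmul A m n) p)) : f = g := by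
  refine BTensor.hom_ext fun z p => ?_
  induction z using BTensor.induction_on with
  | zero => simp only [BTensor.zero_tmul, map_zero]
  | tmul m n => exact h m n p
  | add x y hx hy => simp only [BTensor.add_tmul, map_add, hx, hy]

/-- Every right module is a quotient of a flat one. -/
theorem exists_surjective_of_isFlatRight (S : Type u) [Ring S] (N : Type u) [AddCommGroup N]
    [Module Sᵐᵒᵖ N] : ∃ (P : Type u) (_ : AddCommGroup P) (_ : Module Sᵐᵒᵖ P)
      (g : P →ₗ[Sᵐᵒᵖ] N), IsFlatRight S P ∧ Function.Surjective g :=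
  ⟨N →₀ Sᵐᵒᵖ, inferInstance, inferInstance, Finsupp.linearCombination Sᵐᵒᵖ id,
    isFlatRight_finsupp S N, Finsupp.linearCombination_id_surjective _ _⟩

/-! ### Exchange of tensor and cotensor products: `N ⊗ (T □ X) = (N ⊗ T) □ X` -/

section watts

variable {k : Type v} [CommRing k] {S A B : Type u} [Ring S] [Algebra k S] [Ring A] [Algebra k A]
  [Ring B] [Algebra k B] {Q : Coring k S} {C : Coring k A} {D : Coring k B}
  {N N' : Type u} [AddCommGroup N] [Module Sᵐᵒᵖ N] [AddCommGroup N'] [Module Sᵐᵒᵖ N']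

/-- The morphism `f ⊗ T` of right comodules. -/
def RComod.tensorMap (f : N →ₗ[Sᵐᵒᵖ] N') (T : Bicomod Q C) :
    RComod.tensor N T ⟶ RComod.tensor N' T :=
  ⟨BTensor.mapR f T, fun z => (BTensor.coactR_map f T z).symm⟩

/-- The coaction of `N ⊗ T` only touches `T`, so `N` passes through `ω`. Hence `(N ⊗ T) □ X` is the
kernel of `N ⊗ ω`, and it is this kernel that has to be compared with `N ⊗ (T □ X)`. -/
theorem RComod.omega_tensor (N : Type u) [AddCommGroup N] [Module Sᵐᵒᵖ N] (T : Bicomod Q C)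
    (X : Bicomod C D) (t : BTensor A (BTensor S N T) X) :
    (RComod.tensor N T).omega X t =
      BTensor.assoc.symm (BTensor.map LinearMap.id (T.omegaL X) (BTensor.assoc t)) := by
  refine DFunLike.congr_fun (BTensor.hom_ext_assoc
    (f := ((RComod.tensor N T).omega X).toAddMonoidHom)
    (g := BTensor.assoc.symm.toAddMonoidHom.comp
      ((BTensor.map LinearMap.id (T.omegaL X)).comp BTensor.assoc.toAddMonoidHom))
    fun n t x => ?_) t
  have h : ∀ w : BTensor A T C,
      BTensor.assoc (BTensor.tmul A (BTensor.assoc.symm (BTensor.tmul S n w)) x) =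
      BTensor.assoc.symm (BTensor.tmul S n (BTensor.assoc (BTensor.tmul A w x))) := by
    intro w
    induction w using BTensor.induction_on with
    | zero => simp only [map_zero, BTensor.zero_tmul, BTensor.tmul_zero]
    | tmul t c => simp only [BTensor.assoc_tmul, BTensor.assoc_symm_tmul]
    | add x y hx hy => simp only [map_add, BTensor.add_tmul, BTensor.tmul_add, hx, hy]
  have h' : ∀ w : BTensor A C X,
      BTensor.assoc.symm (BTensor.tmul S n (BTensor.tmul A t w)) =
      BTensor.tmul A (BTensor.tmul S n t) w := fun w => BTensor.assoc_symm_tmul _ _ _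
  change _ = BTensor.assoc.symm (BTensor.tmul S n (T.omegaL X (BTensor.tmul A t x)))
  rw [Bicomod.omegaL_apply, RComod.omega_tmul, BTensor.tmul_sub, map_sub, ← h]
  rw [h']
  rfl

namespace Bicomod

variable (T : Bicomod Q C) (X : Bicomod C D)

/-- The cotensor product as a submodule of the tensor product that is stable under the left
action. -/
abbrev CotensorSub : Type u :=
  (T.tensor X).Sub (LinearMap.ker (T.toRComod.omega X)) (T.ker_omega_smul X)

/-- The inclusion of the cotensor product into the tensor product as a left linear map. -/
def cotensorιL : T.CotensorSub X →ₗ[S] BTensor A T X where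
  toFun z := z.1
  map_add' _ _ := rfl
  map_smul' _ _ := rfl

theorem cotensorιL_injective : Function.Injective (T.cotensorιL X) := Subtype.val_injective

theorem omegaL_cotensorιL (z : T.CotensorSub X) : T.omegaL X (T.cotensorιL X z) = 0 :=
  LinearMap.mem_ker.1 z.2

theorem map_omegaL_map_cotensorιL (u : BTensor S N (T.CotensorSub X)) :
    BTensor.map LinearMap.id (T.omegaL X) (BTensor.map LinearMap.id (T.cotensorιL X) u) =
      (0 : BTensor S N _) := by
  induction u using BTensor.induction_on with
  | zero => simp only [map_zero]
  | tmul n z => rw [BTensor.map_tmul, BTensor.map_tmul, omegaL_cotensorιL, BTensor.tmul_zero]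
  | add x y hx hy => rw [map_add, map_add, hx, hy, add_zero]

/-- Tensoring with a flat `N` preserves the kernel of `ω`. The map `j` only passes from the kernel
of `ω` as a left linear map to the same subset as the kernel of a right linear one. -/
theorem exists_map_cotensorιL_of_isFlatRight (hN : IsFlatRight S N) (t : BTensor S N (BTensor A T X))
    (ht : BTensor.map LinearMap.id (T.omegaL X) t = 0) :
    ∃ u : BTensor S N (T.CotensorSub X), BTensor.map LinearMap.id (T.cotensorιL X) u = t := by
  obtain ⟨y, hy⟩ := BTensor.exists_of_map_eq_zero_right hN (T.omegaL X) t ht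
  let j : LinearMap.ker (T.omegaL X) →ₗ[S] T.CotensorSub X :=
    { toFun := fun z => ⟨z.1, z.2⟩
      map_add' := fun _ _ => rfl
      map_smul' := fun _ _ => rfl }
  refine ⟨BTensor.map LinearMap.id j y, ?_⟩
  rw [BTensor.map_map]
  exact hy

variable {T X} [D.IsFlat]

variable (N T X) in
/-- The inclusion of the cotensor product `(N ⊗ T) □ X` into `N ⊗ (T ⊗ X)`. -/
def tensorCotensorι : (RComod.tensor N T).cotensor X →+ BTensor S N (BTensor A T X) :=
  (BTensor.assoc (A := S) (M := N) (N := T) (P := X)).toAddMonoidHom.comp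
    ((RComod.tensor N T).cotensorι X).toAddMonoidHom

theorem tensorCotensorι_injective : Function.Injective (tensorCotensorι N T X) :=
  (BTensor.assoc (A := S) (M := N) (N := T) (P := X)).injective.comp
    (RComod.cotensorι_injective _ X)

theorem exists_tensorCotensorι_eq (t : BTensor S N (BTensor A T X))
    (ht : BTensor.map LinearMap.id (T.omegaL X) t = 0) :
    ∃ z, tensorCotensorι N T X z = t := by
  refine ⟨⟨BTensor.assoc.symm t, ?_⟩, BTensor.assoc.apply_symm_apply t⟩
  change (RComod.tensor N T).omega X (BTensor.assoc.symm t) = 0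
  refine (RComod.omega_tensor N T X _).trans ?_
  rw [AddEquiv.apply_symm_apply, ht, map_zero]
  rfl

theorem map_omegaL_tensorCotensorι (z : (RComod.tensor N T).cotensor X) :
    BTensor.map LinearMap.id (T.omegaL X) (tensorCotensorι N T X z) = 0 := by
  apply BTensor.assoc.symm.injective
  refine (RComod.omega_tensor N T X _).symm.trans ?_
  rw [map_zero]
  exact RComod.omega_cotensorι _ _ z

theorem tensorCotensorι_map (f : N →ₗ[Sᵐᵒᵖ] N') (z : (RComod.tensor N T).cotensor X) :
    tensorCotensorι N' T X (RComod.cotensorMap (RComod.tensorMap f T) X z) =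
      BTensor.map f LinearMap.id (tensorCotensorι N T X z) :=
  BTensor.assoc_map_left f _

omit [D.IsFlat] in
theorem map_map_cotensorιL (f : N →ₗ[Sᵐᵒᵖ] N') (u : BTensor S N (T.CotensorSub X)) :
    BTensor.map LinearMap.id (T.cotensorιL X) (BTensor.map f LinearMap.id u) =
      BTensor.map f LinearMap.id (BTensor.map LinearMap.id (T.cotensorιL X) u) := by
  rw [BTensor.map_map, BTensor.map_map]
  rfl

namespace IsRightInvertible

variable (hX : X.IsRightInvertible) (T)

include hX

/-- An element killed by `N' ⊗ ω` is an element of `(N' ⊗ T) □ X`, and it lifts to `(N ⊗ T) □ X`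
because `- □ X` preserves surjections. Over the flat `N` the lift comes from `N ⊗ (T □ X)`, and `g`
carries it back. -/
theorem exists_map_cotensorιL_of_surjective (hN : IsFlatRight S N) (g : N →ₗ[Sᵐᵒᵖ] N')
    (hg : Function.Surjective g) (t : BTensor S N' (BTensor A T X))
    (ht : BTensor.map LinearMap.id (T.omegaL X) t = 0) :
    ∃ u : BTensor S N' (T.CotensorSub X), BTensor.map LinearMap.id (T.cotensorιL X) u = t := by
  obtain ⟨z, rfl⟩ := exists_tensorCotensorι_eq t ht
  obtain ⟨w, rfl⟩ := hX.cotensorMap_surjective (RComod.tensorMap g T)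
    (BTensor.map_surjective hg Function.surjective_id) z
  obtain ⟨u, hu⟩ := T.exists_map_cotensorιL_of_isFlatRight X hN _
    (map_omegaL_tensorCotensorι w)
  refine ⟨BTensor.map g LinearMap.id u, ?_⟩
  rw [map_map_cotensorιL, hu, ← tensorCotensorι_map]

theorem exists_map_cotensorιL (t : BTensor S N (BTensor A T X))
    (ht : BTensor.map LinearMap.id (T.omegaL X) t = 0) :
    ∃ u : BTensor S N (T.CotensorSub X), BTensor.map LinearMap.id (T.cotensorιL X) u = t := by
  obtain ⟨P, _, _, g, hP, hg⟩ := exists_surjective_of_isFlatRight S N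
  exact hX.exists_map_cotensorιL_of_surjective T hP g hg t ht

/-- Purity of `T □ X` in `T ⊗ X`. It is a chase along `ker g → P → N` with `P` flat: right exactness
of `- ⊗ T`, followed by exactness of `- □ X`, moves a lift of an element that dies into `(ker g ⊗ T)
□ X`. -/
theorem map_cotensorιL_injective : Function.Injective
    (BTensor.map (LinearMap.id : N →ₗ[Sᵐᵒᵖ] N) (T.cotensorιL X)) := by
  obtain ⟨P, _, _, g, hP, hg⟩ := exists_surjective_of_isFlatRight S N
  rw [injective_iff_map_eq_zero]
  intro u hu
  obtain ⟨w, rfl⟩ := BTensor.map_surjective hg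
    (g := (LinearMap.id : T.CotensorSub X →ₗ[S] _)) Function.surjective_id u
  rw [map_map_cotensorιL] at hu
  obtain ⟨z, hz⟩ := exists_tensorCotensorι_eq _ (T.map_omegaL_map_cotensorιL X w)
  have h0 : RComod.cotensorMap (RComod.tensorMap g T) X z = 0 := by
    apply tensorCotensorι_injective
    rw [map_zero, tensorCotensorι_map, hz, hu]
  obtain ⟨y, hy⟩ := hX.cotensorMap_exact_of_surjective
    (RComod.tensorMap (LinearMap.ker g).subtype T) (RComod.tensorMap g T)
    (BTensor.map_surjective hg Function.surjective_id)
    (BTensor.exists_of_map_eq_zero_of_surjective g hg) z h0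
  -- `ker g` need not be flat, which is why the preceding lemma was proved for arbitrary modules.
  -- Flatness of `P` then shows that `w` is the image of `v`, and `g` kills that image.
  obtain ⟨v, hv⟩ := hX.exists_map_cotensorιL T _ (map_omegaL_tensorCotensorι y)
  have h1 : w = BTensor.map (LinearMap.ker g).subtype LinearMap.id v := by
    apply hP _ _ (T.cotensorιL X) (T.cotensorιL_injective X)
    rw [map_map_cotensorιL, hv, ← tensorCotensorι_map, hy, hz]
  rw [h1, BTensor.map_map]
  exact (BTensor.map_congr (fun m => m.2) (fun _ => rfl) v).trans
    (BTensor.map_zero_left LinearMap.id v)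

end IsRightInvertible

end Bicomod

end watts

theorem BTensor.hom_ext_assoc' {A B : Type u} [Ring A] [Ring B] {M N P R : Type u} [AddCommGroup M]
    [Module Aᵐᵒᵖ M] [AddCommGroup N] [Module A N] [Module Bᵐᵒᵖ N] [SMulCommClass A Bᵐᵒᵖ N]
    [AddCommGroup P] [Module B P] [AddCommGroup R] {f g : BTensor A M (BTensor B N P) →+ R}
    (h : ∀ m n p, f (BTensor.tmul A m (BTensor.tmul B n p)) =
      g (BTensor.tmul A m (BTensor.tmul B n p))) : f = g := by
  refine BTensor.hom_ext fun m z => ?_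
  induction z using BTensor.induction_on with
  | zero => simp only [BTensor.tmul_zero, map_zero]
  | tmul n p => exact h m n p
  | add x y hx hy => simp only [BTensor.tmul_add, map_add, hx, hy]

/-! ### Functoriality in the bicomodule, and iterated tensor products -/

section functoriality

variable {k : Type v} [CommRing k] {A B E : Type u} [Ring A] [Algebra k A]
  [Ring B] [Algebra k B] [Ring E] [Algebra k E] {C : Coring k A} {D : Coring k B} {F : Coring k E}

/-- A morphism of bicomodules as a left linear map. -/
def Bicomod.homL {X Y : Bicomod C D} (f : X ⟶ Y) : X →ₗ[A] Y :=
  mkLin f.lin.toAddMonoidHom f.map_smul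

theorem Bicomod.homL_op_smul {X Y : Bicomod C D} (f : X ⟶ Y) (b : Bᵐᵒᵖ) (x : X) :
    Bicomod.homL f (b • x) = b • Bicomod.homL f x := f.lin.map_smul b x

theorem Bicomod.hom_ext {X Y : Bicomod C D} {f g : X ⟶ Y} (h : ∀ x, f.lin x = g.lin x) : f = g :=
  Bicomod.Hom.ext (LinearMap.ext h)

/-- A bijective morphism of bicomodules is an isomorphism. -/
def Bicomod.isoOfBijective {X Y : Bicomod C D} (f : X ⟶ Y) (hf : Function.Bijective f.lin) :
    X ≅ Y where
  hom := f
  inv :=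
    { (RComod.isoOfBijective (M := X.toRComod) (N := Y.toRComod) f.toHom hf).inv with
      map_smul := fun a y => by
        obtain ⟨x, rfl⟩ := hf.2 y
        have h1 : ∀ x, (RComod.isoOfBijective (M := X.toRComod) (N := Y.toRComod)
            f.toHom hf).inv.lin (f.lin x) = x :=
          (LinearEquiv.ofBijective f.lin hf).symm_apply_apply
        rw [h1, ← f.map_smul, h1]
      lcomm := fun y => by
        obtain ⟨x, rfl⟩ := hf.2 y
        have h1 : ∀ x, (RComod.isoOfBijective (M := X.toRComod) (N := Y.toRComod)
            f.toHom hf).inv.lin (f.lin x) = x :=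
          (LinearEquiv.ofBijective f.lin hf).symm_apply_apply
        rw [h1, ← f.lcomm, BTensor.map_map]
        exact (BTensor.map_congr (fun _ => rfl) h1 _).trans (BTensor.map_id_id _) }
  hom_inv_id := Bicomod.hom_ext (LinearEquiv.ofBijective f.lin hf).symm_apply_apply
  inv_hom_id := Bicomod.hom_ext (LinearEquiv.ofBijective f.lin hf).apply_symm_apply

theorem Bicomod.hom_inv_lin {X Y : Bicomod C D} (e : X ≅ Y) (x : X) :
    e.inv.lin (e.hom.lin x) = x := by
  change (e.hom ≫ e.inv).lin x = x
  rw [e.hom_inv_id]; rfl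

theorem Bicomod.inv_hom_lin {X Y : Bicomod C D} (e : X ≅ Y) (y : Y) :
    e.hom.lin (e.inv.lin y) = y := by
  change (e.inv ≫ e.hom).lin y = y
  rw [e.inv_hom_id]; rfl

/-- The morphism `M ⊗ f` of right comodules. -/
def RComod.tensorMapRight (M : Type u) [AddCommGroup M] [Module Aᵐᵒᵖ M] {X Y : Bicomod C D}
    (f : X ⟶ Y) : RComod.tensor M X ⟶ RComod.tensor M Y where
  lin := mkLin (BTensor.map LinearMap.id (Bicomod.homL f))
    (BTensor.map_smul_right _ _ (Bicomod.homL_op_smul f))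
  comm z := by
    refine DFunLike.congr_fun (BTensor.hom_ext
      (f := (BTensor.map (mkLin (BTensor.map (LinearMap.id : M →ₗ[Aᵐᵒᵖ] M) (Bicomod.homL f))
        (BTensor.map_smul_right _ _ (Bicomod.homL_op_smul f)))
        (LinearMap.id : D →ₗ[B] D)).comp (BTensor.coactR M X.coactB).toAddMonoidHom)
      (g := (BTensor.coactR M Y.coactB).toAddMonoidHom.comp
        (BTensor.map LinearMap.id (Bicomod.homL f))) fun m x => ?_) z
    have h : ∀ w : BTensor B X D, BTensor.map (mkLin
        (BTensor.map (LinearMap.id : M →ₗ[Aᵐᵒᵖ] M) (Bicomod.homL f))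
        (BTensor.map_smul_right _ _ (Bicomod.homL_op_smul f)))
        LinearMap.id (BTensor.assoc.symm (BTensor.tmul A m w)) =
        BTensor.assoc.symm (BTensor.tmul A m (BTensor.map f.lin LinearMap.id w)) := by
      intro w
      induction w using BTensor.induction_on with
      | zero => simp only [map_zero, BTensor.tmul_zero]
      | tmul x d => simp only [BTensor.assoc_symm_tmul, BTensor.map_tmul]; rfl
      | add x y hx hy => simp only [map_add, BTensor.tmul_add, hx, hy]
    exact (h (X.coact x)).trans (congrArg (fun w => BTensor.assoc.symm (BTensor.tmul A m w))
      (f.comm x))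

/-- The inclusion of the cotensor product, as a morphism of comodules. -/
def RComod.cotensorIncl [D.IsFlat] (M : RComod C) (X : Bicomod C D) :
    M.cotensor X ⟶ RComod.tensor M X :=
  ⟨M.cotensorι X, M.cotensor_coact X⟩

/-- The map `ω` as a morphism of comodules. -/
def RComod.omegaHom (M : RComod C) (X : Bicomod C D) :
    RComod.tensor M X ⟶ RComod.tensor M (C.regular.tensor X) :=
  ⟨M.omega X, M.map_omega_coact X⟩

/-- The map `ω` is natural in the bicomodule. -/
theorem RComod.omega_map_right (M : RComod C) {X Y : Bicomod C D} (f : X ⟶ Y)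
    (z : BTensor A M X) :
    M.omega Y (BTensor.map LinearMap.id (Bicomod.homL f) z) =
      BTensor.map LinearMap.id (BTensor.mapL C (Bicomod.homL f)) (M.omega X z) := by
  rw [RComod.omega_apply, RComod.omega_apply, map_sub, BTensor.map_map, BTensor.map_map,
    BTensor.map_map, ← BTensor.assoc_map_right, BTensor.map_map]
  congr 1
  exact BTensor.map_congr (fun _ => rfl) (fun x => (f.lcomm x).symm) z

/-- Associativity of the tensor product as a left linear equivalence. -/
def BTensor.assocL {S M N P : Type u} [Ring S] [AddCommGroup M] [Module S M] [Module Aᵐᵒᵖ M]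
    [SMulCommClass S Aᵐᵒᵖ M] [AddCommGroup N] [Module A N] [Module Bᵐᵒᵖ N] [SMulCommClass A Bᵐᵒᵖ N]
    [AddCommGroup P] [Module B P] :
    BTensor B (BTensor A M N) P ≃ₗ[S] BTensor A M (BTensor B N P) :=
  { BTensor.assoc with map_smul' := BTensor.assoc_smul_left }

theorem BTensor.map_equiv_injective {M N N' : Type u} [AddCommGroup M] [Module Aᵐᵒᵖ M]
    [AddCommGroup N] [Module A N] [AddCommGroup N'] [Module A N'] (e : N ≃ₗ[A] N') :
    Function.Injective (BTensor.map (LinearMap.id : M →ₗ[Aᵐᵒᵖ] M) e.toLinearMap) := by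
  intro x y h
  have h1 := congrArg (BTensor.map (LinearMap.id : M →ₗ[Aᵐᵒᵖ] M) e.symm.toLinearMap) h
  rw [BTensor.map_map, BTensor.map_map] at h1
  have h2 : ∀ z, BTensor.map ((LinearMap.id : M →ₗ[Aᵐᵒᵖ] M) ∘ₗ LinearMap.id)
      (e.symm.toLinearMap ∘ₗ e.toLinearMap) z = z := fun z =>
    (BTensor.map_congr (fun _ => rfl) (fun n => e.symm_apply_apply n) z).trans
      (BTensor.map_id_id z)
  rwa [h2, h2] at h1

/-- The left coaction of `X ⊗ Y` only touches `X`, so `Y` passes through `ω`. -/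
theorem RComod.omega_tensor_right (M : RComod C) (X : Bicomod C D) (Y : Bicomod D F)
    (t : BTensor B (BTensor A M X) Y) :
    M.omega (X.tensor Y) (BTensor.assoc t) =
      BTensor.map LinearMap.id (BTensor.assocL (M := C) (N := X) (P := Y) :
          BTensor B (BTensor A C X) Y ≃ₗ[A] _).toLinearMap
        (BTensor.assoc (BTensor.map (M.omega X) LinearMap.id t)) := by
  refine DFunLike.congr_fun (BTensor.hom_ext_assoc
    (f := (M.omega (X.tensor Y)).toAddMonoidHom.comp BTensor.assoc.toAddMonoidHom)
    (g := (BTensor.map LinearMap.id (BTensor.assocL (M := C) (N := X) (P := Y) :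
          BTensor B (BTensor A C X) Y ≃ₗ[A] _).toLinearMap).comp
      (BTensor.assoc.toAddMonoidHom.comp (BTensor.map (M.omega X) LinearMap.id)))
    fun m x y => ?_) t
  let Θ : BTensor A M (BTensor A C X) →+ BTensor A M (BTensor A C (BTensor B X Y)) :=
    (BTensor.map LinearMap.id (BTensor.assocL (M := C) (N := X) (P := Y) :
          BTensor B (BTensor A C X) Y ≃ₗ[A] _).toLinearMap).comp
      (BTensor.assoc.toAddMonoidHom.comp
        (AddMonoidHom.mk' (fun w => BTensor.tmul B w y) (fun _ _ => BTensor.add_tmul _ _ _)))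
  change M.omega (X.tensor Y) (BTensor.tmul A m (BTensor.tmul B x y)) =
    Θ (M.omega X (BTensor.tmul A m x))
  rw [RComod.omega_tmul, map_sub]
  have h : ∀ w : BTensor A M C,
      BTensor.assoc (BTensor.tmul A w (BTensor.tmul B x y)) = Θ (BTensor.assoc (BTensor.tmul A w x)) := by
    intro w
    induction w using BTensor.induction_on with
    | zero => simp only [map_zero, BTensor.zero_tmul]
    | tmul m c => rfl
    | add x y hx hy => simp only [map_add, BTensor.add_tmul, hx, hy]
  rw [← h]
  exact RComod.omega_tmul M (X.tensor Y) m (BTensor.tmul B x y)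

theorem RComod.map_omega_eq_zero_iff (M : RComod C) (X : Bicomod C D) (Y : Bicomod D F)
    (t : BTensor B (BTensor A M X) Y) :
    BTensor.map (M.omega X) LinearMap.id t = 0 ↔
      M.omega (X.tensor Y) (BTensor.assoc t) = (0 : BTensor A M (BTensor A C (BTensor B X Y))) := by
  refine ⟨fun h => (M.omega_tensor_right X Y t).trans ?_, fun h => BTensor.assoc.injective
    ((BTensor.map_equiv_injective _ (((M.omega_tensor_right X Y t).symm.trans h).trans
      (map_zero _).symm)).trans (map_zero _).symm)⟩
  exact (congrArg _ ((congrArg BTensor.assoc h).trans (map_zero _))).trans (map_zero _)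

omit [Algebra k A] [Algebra k B] in
-- The coaction of `N ⊗ P` enters as a map `σ` prescribed on pure tensors, which keeps the statement
-- at the level of modules. For the bicomodule `X ⊗ Y` the hypothesis `hσ` holds by definition.
theorem BTensor.map_assoc_symm_coactR {M N P : Type u} [AddCommGroup M] [Module Aᵐᵒᵖ M]
    [AddCommGroup N] [Module A N] [Module Bᵐᵒᵖ N] [SMulCommClass A Bᵐᵒᵖ N]
    [AddCommGroup P] [Module B P] [Module Eᵐᵒᵖ P] [SMulCommClass B Eᵐᵒᵖ P]
    (ρ : BimodHom B E P (BTensor E P F))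
    (σ : BimodHom A E (BTensor B N P) (BTensor E (BTensor B N P) F))
    (hσ : ∀ n p, σ (BTensor.tmul B n p) = BTensor.assoc.symm (BTensor.tmul B n (ρ p)))
    (z : BTensor A M (BTensor B N P)) :
    BTensor.map (mkLin (BTensor.assoc (A := A) (B := B) (M := M) (N := N) (P := P)).symm.toAddMonoidHom
        (BTensor.assoc_symm_smul_right (T := E))) LinearMap.id (BTensor.coactR M σ z) =
      BTensor.coactR (BTensor A M N) ρ (BTensor.assoc.symm z) := by
  refine DFunLike.congr_fun (BTensor.hom_ext_assoc'
      (f := (BTensor.map (mkLin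
        (BTensor.assoc (A := A) (B := B) (M := M) (N := N) (P := P)).symm.toAddMonoidHom
        (BTensor.assoc_symm_smul_right (T := E))) (LinearMap.id : F →ₗ[E] F)).comp
        (BTensor.coactR M σ).toAddMonoidHom)
      (g := (BTensor.coactR (BTensor A M N) ρ).toAddMonoidHom.comp
        (BTensor.assoc (A := A) (B := B) (M := M) (N := N) (P := P)).symm.toAddMonoidHom)
      fun m x y => ?_) z
  have h : ∀ w : BTensor E P F, BTensor.map (mkLin
      (BTensor.assoc (A := A) (B := B) (M := M) (N := N) (P := P)).symm.toAddMonoidHom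
      (BTensor.assoc_symm_smul_right (T := E))) LinearMap.id
      (BTensor.assoc.symm (BTensor.tmul A m (BTensor.assoc.symm (BTensor.tmul B x w)))) =
      BTensor.assoc.symm (BTensor.tmul B (BTensor.tmul A m x) w) := by
    intro w
    induction w using BTensor.induction_on with
    | zero => simp only [map_zero, BTensor.tmul_zero]
    | tmul y d =>
      rw [BTensor.assoc_symm_tmul, BTensor.assoc_symm_tmul, BTensor.assoc_symm_tmul,
        BTensor.map_tmul]
      change BTensor.tmul E (BTensor.assoc.symm (BTensor.tmul A m (BTensor.tmul B x y))) d = _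
      rw [BTensor.assoc_symm_tmul]
    | add x y hx hy => simp only [map_add, BTensor.tmul_add, hx, hy]
  change BTensor.map _ _ (BTensor.coactR M σ (BTensor.tmul A m (BTensor.tmul B x y))) =
    BTensor.coactR (BTensor A M N) ρ
    (BTensor.assoc.symm (BTensor.tmul A m (BTensor.tmul B x y)))
  rw [BTensor.assoc_symm_tmul, BTensor.coactR_tmul, BTensor.coactR_tmul, hσ]
  exact h (ρ y)

/-- The right coaction of `X ⊗ Y` as a bimodule homomorphism. -/
def Bicomod.tensorCoactB (X : Bicomod C D) (Y : Bicomod D F) :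
    BimodHom A E (BTensor B X Y) (BTensor E (BTensor B X Y) F) where
  toAddMonoidHom := (BTensor.coactR X Y.coactB).toAddMonoidHom
  map_smul := (X.tensor Y).coact_smul
  map_op_smul := (BTensor.coactR X Y.coactB).map_smul

end functoriality

/-! ### A criterion for isomorphism of functors into comodules -/

section natiso

variable {k : Type v} [CommRing k] {B : Type u} [Ring B] [Algebra k B] {D : Coring k B}

/-- Two functors that embed into the same family of comodules with the same images are
isomorphic. -/
theorem RComod.nonempty_natIso {𝒞 : Type*} [Category* 𝒞] {P Q : 𝒞 ⥤ RComod D}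
    (hD : IsFlatLeft B D) (T : 𝒞 → RComod D) (t : ∀ {M N : 𝒞}, (M ⟶ N) → T M → T N)
    (i : ∀ M, P.obj M ⟶ T M) (j : ∀ M, Q.obj M ⟶ T M)
    (hi : ∀ M, Function.Injective (i M).lin) (hj : ∀ M, Function.Injective (j M).lin)
    (hij : ∀ M x, ∃ y, (j M).lin y = (i M).lin x) (hji : ∀ M y, ∃ x, (i M).lin x = (j M).lin y)
    (hti : ∀ {M N} (f : M ⟶ N) x, (i N).lin ((P.map f).lin x) = t f ((i M).lin x))
    (htj : ∀ {M N} (f : M ⟶ N) x, (j N).lin ((Q.map f).lin x) = t f ((j M).lin x)) :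
    Nonempty (P ≅ Q) := by
  -- `P M` and `Q M` have the same image in `T M`, and flatness of `D` makes the comparison map
  -- colinear. Naturality is tested elementwise in `T N`, so `t` need not come from a functor.
  choose s hs using fun M => RComod.exists_lift_of_injective hD (j M) (hj M) (i M) (hij M)
  have hs' : ∀ M x, (j M).lin ((s M).lin x) = (i M).lin x := fun M x =>
    RComod.congr_lin (hs M) x
  refine ⟨NatIso.ofComponents (fun M => RComod.isoOfBijective (s M)
    ⟨fun x y h => hi M ?_, fun y => ?_⟩) (fun {M N} f => RComod.hom_ext fun x => hj N ?_)⟩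
  · rw [← hs', h, hs']
  · obtain ⟨x, hx⟩ := hji M y
    exact ⟨x, hj M ((hs' M x).trans hx)⟩
  · change (j N).lin ((s N).lin ((P.map f).lin x)) = (j N).lin ((Q.map f).lin ((s M).lin x))
    rw [hs', htj, hs', hti]

end natiso

/-! ### Associativity of the cotensor product, and stability of right invertibility -/

section assoc

/-- By associativity this is purity of `T □ X` with respect to the right module `M ⊗ N`. It is
needed because `ω` for the bicomodule `X □ Y` takes values in `M ⊗ (C ⊗ (X □ Y))`. -/
theorem Bicomod.IsRightInvertible.map_mapL_cotensorιL_injective {k : Type v} [CommRing k]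
    {S A B : Type u} [Ring S] [Algebra k S] [Ring A] [Algebra k A] [Ring B] [Algebra k B]
    {Q : Coring k S} {C : Coring k A} {D : Coring k B} [D.IsFlat] {X : Bicomod C D}
    (hX : X.IsRightInvertible) (T : Bicomod Q C) {R M N : Type u} [Ring R] [AddCommGroup M]
    [Module Rᵐᵒᵖ M] [AddCommGroup N] [Module R N] [Module Sᵐᵒᵖ N] [SMulCommClass R Sᵐᵒᵖ N] :
    Function.Injective (BTensor.map (LinearMap.id : M →ₗ[Rᵐᵒᵖ] M)
      (BTensor.mapL N (T.cotensorιL X) : _ →ₗ[R] _)) := by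
  intro x y h
  have h1 := congrArg BTensor.assoc.symm h
  rw [BTensor.assoc_symm_map_right, BTensor.assoc_symm_map_right] at h1
  exact BTensor.assoc.symm.injective (hX.map_cotensorιL_injective T h1)

variable {k : Type v} [CommRing k] {A B E : Type u} [Ring A] [Algebra k A]
  [Ring B] [Algebra k B] [Ring E] [Algebra k E] {C : Coring k A} {D : Coring k B} {F : Coring k E}

/-- The cotensor product is functorial in the bicomodule. -/
theorem cotensorFunctor_congr [D.IsFlat] {X Y : Bicomod C D} (e : X ≅ Y) :
    Nonempty (cotensorFunctor X ≅ cotensorFunctor Y) := by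
  have hinj : ∀ (M : RComod C) (z : BTensor A M X),
      BTensor.map LinearMap.id (Bicomod.homL e.inv)
        (BTensor.map LinearMap.id (Bicomod.homL e.hom) z) = z := fun M z => by
    rw [BTensor.map_map]
    exact (BTensor.map_congr (fun _ => rfl) (Bicomod.hom_inv_lin e) z).trans (BTensor.map_id_id z)
  have hinv : ∀ (M : RComod C) (z : BTensor A M Y),
      BTensor.map LinearMap.id (Bicomod.homL e.hom)
        (BTensor.map LinearMap.id (Bicomod.homL e.inv) z) = z := fun M z => by
    rw [BTensor.map_map]
    exact (BTensor.map_congr (fun _ => rfl) (Bicomod.inv_hom_lin e) z).trans (BTensor.map_id_id z)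
  refine RComod.nonempty_natIso Coring.IsFlat.left (fun M => RComod.tensor M Y)
    (fun f => (RComod.tensorMap f.lin Y).lin)
    (fun M => RComod.cotensorIncl M X ≫ RComod.tensorMapRight M e.hom)
    (fun M => RComod.cotensorIncl M Y) (fun M => ?_) (fun M => M.cotensorι_injective Y)
    (fun M (x : M.cotensor X) => ?_) (fun M (y : M.cotensor Y) => ?_)
    (fun {M N} f (x : M.cotensor X) => ?_) (fun {M N} f x => rfl)
  · exact (Function.LeftInverse.injective (hinj M)).comp (M.cotensorι_injective X)
  · refine ⟨⟨BTensor.map LinearMap.id (Bicomod.homL e.hom) (M.cotensorι X x), ?_⟩, rfl⟩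
    refine (RComod.omega_map_right M e.hom _).trans ?_
    rw [RComod.omega_cotensorι, map_zero]
  · refine ⟨⟨BTensor.map LinearMap.id (Bicomod.homL e.inv) (M.cotensorι Y y), ?_⟩, hinv M _⟩
    refine (RComod.omega_map_right M e.inv _).trans ?_
    rw [RComod.omega_cotensorι, map_zero]
  · change BTensor.map LinearMap.id (Bicomod.homL e.hom)
      (BTensor.map f.lin LinearMap.id (M.cotensorι X x)) = BTensor.map f.lin LinearMap.id
      (BTensor.map LinearMap.id (Bicomod.homL e.hom) (M.cotensorι X x))
    rw [BTensor.map_map, BTensor.map_map]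
    rfl

variable [C.IsFlat] [F.IsFlat]

/-- The inclusion of `X □ Y` into `X ⊗ Y`, as a morphism of bicomodules. -/
def Bicomod.cotensorIncl (X : Bicomod C D) (Y : Bicomod D F) : X.cotensor Y ⟶ X.tensor Y where
  lin := (X.tensor Y).subι (LinearMap.ker (X.toRComod.omega Y)) (X.ker_omega_smul Y) |>.r
  comm := X.toRComod.cotensor_coact Y
  map_smul _ _ := rfl
  lcomm := (X.tensor Y).subLcoact_spec _ _ _ _

/-- The morphism of comodules given by associativity. -/
def RComod.assocSymmHom (M : Type u) [AddCommGroup M] [Module Aᵐᵒᵖ M] (X : Bicomod C D)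
    (Y : Bicomod D F) : RComod.tensor M (X.tensor Y) ⟶ RComod.tensor (BTensor A M X) Y where
  lin := mkLin (BTensor.assoc (A := A) (B := B) (M := M) (N := X) (P := Y)).symm.toAddMonoidHom
    (BTensor.assoc_symm_smul_right (T := E))
  comm := BTensor.map_assoc_symm_coactR Y.coactB (X.tensorCoactB Y) (fun _ _ => rfl)

variable [D.IsFlat]

/-- The cotensor product with a right invertible bicomodule is associative. -/
theorem Bicomod.IsRightInvertible.cotensorFunctor_cotensor (X : Bicomod C D) {Y : Bicomod D F}
    (hY : Y.IsRightInvertible) :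
    Nonempty (cotensorFunctor (X.cotensor Y) ≅ cotensorFunctor X ⋙ cotensorFunctor Y) := by
  have hι : ∀ (M : RComod C) (z : M.cotensor (X.cotensor Y)),
      M.omega (X.tensor Y) (BTensor.map LinearMap.id (Bicomod.homL (X.cotensorIncl Y))
        (M.cotensorι (X.cotensor Y) z)) = 0 := fun M z => by
    refine (RComod.omega_map_right M (X.cotensorIncl Y) _).trans ?_
    rw [RComod.omega_cotensorι, map_zero]
  have hω : ∀ (M : RComod C) (z : (M.cotensor X).cotensor Y),
      BTensor.map (M.omega X) LinearMap.id (BTensor.map (M.cotensorι X) LinearMap.id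
        ((M.cotensor X).cotensorι Y z)) = 0 := fun M z => by
    rw [BTensor.map_map]
    exact (BTensor.map_congr (fun z => M.omega_cotensorι X z) (fun _ => rfl) _).trans
      (BTensor.map_zero_left LinearMap.id _)
  -- `M □ (X □ Y)` and `(M □ X) □ Y` are compared inside `(M ⊗ X) ⊗ Y`. The first embeds by purity
  -- of `X □ Y` in `X ⊗ Y`, the second because `- □ Y` preserves injections.
  refine RComod.nonempty_natIso Coring.IsFlat.left (fun M => RComod.tensor (BTensor A M X) Y)
    (fun f => (RComod.tensorMap (RComod.tensorMap f.lin X).lin Y).lin)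
    (fun M => RComod.cotensorIncl M (X.cotensor Y) ≫
      RComod.tensorMapRight M (X.cotensorIncl Y) ≫ RComod.assocSymmHom M X Y)
    (fun M => RComod.cotensorIncl (M.cotensor X) Y ≫
      RComod.tensorMap (M.cotensorι X) Y) (fun M => ?_) (fun M => ?_)
    (fun M (z : M.cotensor (X.cotensor Y)) => ?_) (fun M (z : (M.cotensor X).cotensor Y) => ?_)
    (fun {M N} f (x : M.cotensor (X.cotensor Y)) => ?_)
    (fun {M N} f (x : (M.cotensor X).cotensor Y) => ?_)
  · exact BTensor.assoc.symm.injective.comp ((hY.map_cotensorιL_injective X).comp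
      (M.cotensorι_injective (X.cotensor Y)))
  · exact ((RComod.tensor M X).cotensorι_injective Y).comp
      (hY.cotensorMap_injective (RComod.cotensorIncl M X) (M.cotensorι_injective X))
  -- The element lies in `(M ⊗ X) □ Y` and is killed by `ω □ Y`, where `ω` is that of `M` and `X`.
  -- Left exactness of `- □ Y` places it in `(M □ X) □ Y`.
  · obtain ⟨w, hw⟩ := exists_tensorCotensorι_eq (X := Y) (T := X)
      (BTensor.map LinearMap.id (X.cotensorιL Y) (M.cotensorι (X.cotensor Y) z))
      (X.map_omegaL_map_cotensorιL Y _)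
    have h1 : RComod.cotensorMap (RComod.omegaHom M X) Y w = 0 := by
      apply RComod.cotensorι_injective
      rw [map_zero]
      exact (M.map_omega_eq_zero_iff X Y _).2 ((congrArg (M.omega (X.tensor Y)) hw).trans (hι M z))
    obtain ⟨s, hs⟩ := hY.cotensorMap_exact_of_injective (RComod.cotensorIncl M X)
      (RComod.omegaHom M X) (M.cotensorι_injective X)
      (fun n hn => ⟨⟨n, hn⟩, rfl⟩) w h1
    refine ⟨s, ?_⟩
    refine (congrArg ((RComod.tensor M X).cotensorι Y) hs).trans ?_
    exact (BTensor.assoc.symm_apply_eq.2 hw.symm).symm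
  -- Conversely, the exchange property brings the element into `M ⊗ (X □ Y)`. Its `ω` vanishes
  -- because it vanishes after the injection into `M ⊗ (C ⊗ (X ⊗ Y))`.
  · obtain ⟨u, hu⟩ := hY.exists_map_cotensorιL X _ (map_omegaL_tensorCotensorι
      (RComod.cotensorMap (RComod.cotensorIncl M X) Y z))
    have hu' : BTensor.map LinearMap.id (Bicomod.homL (X.cotensorIncl Y)) u =
      BTensor.assoc (BTensor.map (M.cotensorι X) LinearMap.id
        ((M.cotensor X).cotensorι Y z)) := hu
    refine ⟨⟨u, ?_⟩, BTensor.assoc.symm_apply_eq.2 hu⟩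
    change M.omega (X.cotensor Y) u = 0
    refine (map_eq_zero_iff _ (hY.map_mapL_cotensorιL_injective X)).1
      ((RComod.omega_map_right M (X.cotensorIncl Y) u).symm.trans ?_)
    rw [hu']
    exact (M.map_omega_eq_zero_iff X Y _).1 (hω M z)
  · change BTensor.assoc.symm (BTensor.map LinearMap.id (Bicomod.homL (X.cotensorIncl Y))
      (BTensor.map f.lin LinearMap.id (M.cotensorι (X.cotensor Y) x))) =
      BTensor.map (BTensor.mapR f.lin X) LinearMap.id (BTensor.assoc.symm
        (BTensor.map LinearMap.id (Bicomod.homL (X.cotensorIncl Y))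
          (M.cotensorι (X.cotensor Y) x)))
    exact (congrArg BTensor.assoc.symm (map_map_cotensorιL f.lin _)).trans
      (BTensor.assoc_symm_map_left f.lin _)
  · change BTensor.map (N.cotensorι X) LinearMap.id (BTensor.map (RComod.cotensorMap f X)
      LinearMap.id ((M.cotensor X).cotensorι Y x)) = BTensor.map (BTensor.mapR f.lin X)
      LinearMap.id (BTensor.map (M.cotensorι X) LinearMap.id ((M.cotensor X).cotensorι Y x))
    rw [BTensor.map_map, BTensor.map_map]
    rfl

/-- The cotensor product of right invertible bicomodules is right invertible. -/
theorem Bicomod.IsRightInvertible.cotensor {X : Bicomod C D} {Y : Bicomod D F}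
    (hX : X.IsRightInvertible) (hY : Y.IsRightInvertible) : (X.cotensor Y).IsRightInvertible := by
  obtain ⟨e⟩ := hY.cotensorFunctor_cotensor X
  have : (cotensorFunctor X).IsEquivalence := hX
  have : (cotensorFunctor Y).IsEquivalence := hY
  exact Functor.isEquivalence_of_iso e.symm

end assoc

/-- The map `c ↦ n ⊗ c` as a right linear map. -/
def BTensor.tmulLin {A B : Type u} [Ring A] [Ring B] {N C : Type u} [AddCommGroup N]
    [Module Aᵐᵒᵖ N] [AddCommGroup C] [Module A C] [Module Bᵐᵒᵖ C] [SMulCommClass A Bᵐᵒᵖ C] (n : N) :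
    C →ₗ[Bᵐᵒᵖ] BTensor A N C :=
  mkLin (AddMonoidHom.mk' (fun c => BTensor.tmul A n c) (BTensor.tmul_add n)) (fun _ _ => rfl)

theorem BTensor.map_tmulLin {A B : Type u} [Ring A] [Ring B] {N C X : Type u} [AddCommGroup N]
    [Module Aᵐᵒᵖ N] [AddCommGroup C] [Module A C] [Module Bᵐᵒᵖ C] [SMulCommClass A Bᵐᵒᵖ C]
    [AddCommGroup X] [Module B X] (n : N) (w : BTensor B C X) :
    BTensor.map (BTensor.tmulLin n : C →ₗ[Bᵐᵒᵖ] BTensor A N C) LinearMap.id w =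
      BTensor.assoc.symm (BTensor.tmul A n w) := by
  induction w using BTensor.induction_on with
  | zero => simp only [map_zero, BTensor.tmul_zero]
  | tmul c c' => exact (BTensor.assoc_symm_tmul _ _ _).symm
  | add x y hx hy => simp only [map_add, BTensor.tmul_add, hx, hy]

/-! ### Recovering a bicomodule from its cotensor functor -/

section recover

variable {k : Type v} [CommRing k] {A B : Type u} [Ring A] [Algebra k A] [Ring B] [Algebra k B]
  {C : Coring k A} {D : Coring k B}

/-- The map `C ⊗ X → X` induced by the counit. -/
def Bicomod.counitL (X : Bicomod C D) : BTensor A C X →ₗ[A] X :=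
  mkLin (BTensor.lid.comp (BTensor.map C.counit.r LinearMap.id)) (fun a z => by
    induction z using BTensor.induction_on with
    | zero => simp only [smul_zero, map_zero]
    | tmul c x =>
      change C.counit (a • c) • x = a • C.counit c • x
      rw [C.counit.apply_smul, smul_eq_mul, mul_smul]
    | add x y hx hy => simp only [smul_add, map_add, hx, hy])

theorem Bicomod.counitL_lcoact (X : Bicomod C D) (x : X) : X.counitL (X.lcoact x) = x :=
  X.counit_lcoact x

theorem Bicomod.lcoact_injective (X : Bicomod C D) : Function.Injective X.lcoact :=
  Function.LeftInverse.injective X.counitL_lcoact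

/-- The left coaction is split by the counit, and a split injection stays injective after any tensor
product. -/
theorem Bicomod.map_lcoact_injective (X : Bicomod C D) {N : Type u} [AddCommGroup N]
    [Module Aᵐᵒᵖ N] :
    Function.Injective (BTensor.map (LinearMap.id : N →ₗ[Aᵐᵒᵖ] N) X.lcoact.l) := by
  refine Function.LeftInverse.injective (g := BTensor.map LinearMap.id X.counitL) fun z => ?_
  rw [BTensor.map_map]
  exact (BTensor.map_congr (fun _ => rfl) X.counitL_lcoact z).trans (BTensor.map_id_id z)

/-- Left multiplication by `a`, as an endomorphism of the right comodule underlying `X`. -/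
def Bicomod.smulHom (X : Bicomod C D) (a : A) : X.toRComod ⟶ X.toRComod where
  lin := mkLin (AddMonoidHom.mk' (fun x => a • x) (smul_add a)) (fun b x => smul_comm a b x)
  comm x := (X.coact_smul a x).symm

theorem Bicomod.map_smulHom (X : Bicomod C D) (a : A) {N : Type u} [AddCommGroup N] [Module B N]
    (z : BTensor B X N) : BTensor.map (X.smulHom a).lin LinearMap.id z = a • z := rfl

/-- The morphism `c ↦ n ⊗ c` of comodules. -/
def Coring.tmulHom (C : Coring k A) {N : Type u} [AddCommGroup N] [Module Aᵐᵒᵖ N] (n : N) :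
    C.regular.toRComod ⟶ RComod.tensor N C.regular where
  lin := (BTensor.tmulLin n : C →ₗ[Aᵐᵒᵖ] BTensor A N C)
  comm c := BTensor.map_tmulLin n (C.comul c)

theorem Coring.map_tmulHom (C : Coring k A) {N X : Type u} [AddCommGroup N] [Module Aᵐᵒᵖ N]
    [AddCommGroup X] [Module A X] (n : N) (w : BTensor A C X) :
    BTensor.map (C.tmulHom n).lin LinearMap.id w =
      BTensor.assoc.symm (BTensor.tmul A n w) :=
  (BTensor.map_tmulLin n w : BTensor.map (BTensor.tmulLin n : C →ₗ[Aᵐᵒᵖ] BTensor A N C) _ w = _)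

/-- The comultiplication as a morphism of comodules. -/
def Coring.comulHom (C : Coring k A) : C.regular.toRComod ⟶ RComod.tensor C C.regular where
  lin := C.comul.r
  comm c := (BTensor.assoc.symm_apply_eq.2 (C.coassoc c).symm).symm

variable [D.IsFlat]

/-- The left coaction of `X` as an isomorphism from `X` to `C □ X`. -/
theorem Bicomod.exists_lcoactIso (X : Bicomod C D) :
    ∃ e : X.toRComod ≅ C.regular.toRComod.cotensor X,
      ∀ x, C.regular.toRComod.cotensorι X (e.hom.lin x) = X.lcoact x := by
  let f : X →ₗ[Bᵐᵒᵖ] C.regular.toRComod.cotensor X :=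
    X.lcoact.r.codRestrict (LinearMap.ker (C.regular.toRComod.omega X)) (fun x =>
      sub_eq_zero.2 (X.lcoassoc x))
  have hf : ∀ x, C.regular.toRComod.cotensorι X (f x) = X.lcoact x := fun x => rfl
  let g : X.toRComod ⟶ C.regular.toRComod.cotensor X := ⟨f, fun x => by
    apply Coring.IsFlat.left (C := D) _ _ (C.regular.toRComod.cotensorι X)
      (C.regular.toRComod.cotensorι_injective X)
    rw [RComod.cotensor_coact, BTensor.map_map, hf]
    exact (BTensor.assoc.symm_apply_eq.2 (X.compat x).symm).symm⟩
  refine ⟨RComod.isoOfBijective g ⟨fun x y h => X.lcoact_injective ?_, fun z => ?_⟩, hf⟩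
  · rw [← hf, ← hf]
    exact congrArg _ h
  · refine ⟨X.counitL (C.regular.toRComod.cotensorι X z),
      C.regular.toRComod.cotensorι_injective X ?_⟩
    refine (hf _).trans ?_
    -- On `C □ X` the maps `Δ ⊗ X` and `C ⊗ λ` agree, where `λ` is the left coaction. Applying the
    -- counit to the first factor shows that each element is the coaction of its image under
    -- `counitL`.
    have h0 : BTensor.assoc (BTensor.map C.comul.r LinearMap.id
        (C.regular.toRComod.cotensorι X z : BTensor A C X)) = BTensor.map LinearMap.id X.lcoact.l
        (C.regular.toRComod.cotensorι X z : BTensor A C X) :=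
      sub_eq_zero.1 (C.regular.toRComod.omega_cotensorι X z)
    have h1 : ∀ w : BTensor A C X, X.lcoact (X.counitL w) =
        BTensor.lid (BTensor.map C.counit.r LinearMap.id (BTensor.map LinearMap.id X.lcoact.l w)) := by
      intro w
      induction w using BTensor.induction_on with
      | zero => simp only [map_zero]
      | tmul c x => exact X.lcoact.apply_smul _ _
      | add x y hx hy => simp only [map_add, hx, hy]
    have h2 : ∀ w : BTensor A C X, BTensor.lid (BTensor.map C.counit.r LinearMap.id
        (BTensor.assoc (BTensor.map C.comul.r LinearMap.id w))) = w := by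
      intro w
      induction w using BTensor.induction_on with
      | zero => simp only [map_zero]
      | tmul c x =>
        refine Eq.trans ?_ (congrArg (fun c => BTensor.tmul A c x) (C.counit_comul c))
        change BTensor.lid (BTensor.map C.counit.r LinearMap.id
          (BTensor.assoc (BTensor.tmul A (C.comul c) x))) = _
        generalize C.comul c = w
        induction w using BTensor.induction_on with
        | zero => simp only [map_zero, BTensor.zero_tmul]
        | tmul c c' => rfl
        | add x y hx hy => simp only [map_add, BTensor.add_tmul, hx, hy]
      | add x y hx hy => simp only [map_add, hx, hy]
    exact (h1 _).trans ((congrArg _ (congrArg _ h0.symm)).trans (h2 _))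

/-- A bicomodule is determined up to isomorphism by its cotensor functor. -/
theorem Bicomod.nonempty_iso_of_natIso {X Y : Bicomod C D}
    (η : cotensorFunctor X ≅ cotensorFunctor Y) : Nonempty (X ≅ Y) := by
  obtain ⟨p, hp⟩ := X.exists_lcoactIso
  obtain ⟨q, hq⟩ := Y.exists_lcoactIso
  let R := C.regular.toRComod
  have hnat : ∀ {M N : RComod C} (f : M ⟶ N) (z : M.cotensor X),
      N.cotensorι Y ((η.hom.app N).lin (RComod.cotensorMap f X z)) =
        BTensor.map f.lin LinearMap.id (M.cotensorι Y ((η.hom.app M).lin z)) := fun {M N} f z =>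
    congrArg (N.cotensorι Y) (RComod.congr_lin (η.hom.naturality f) z)
  -- This is `η` at `C`, transported along `X ≅ C □ X` and `C □ Y ≅ Y`.
  let e : X.toRComod ≅ Y.toRComod := p ≪≫ η.app R ≪≫ q.symm
  have he : ∀ x, R.cotensorι Y ((η.hom.app R).lin (p.hom.lin x)) = Y.lcoact (e.hom.lin x) := by
    intro x
    rw [← hq]
    exact congrArg (R.cotensorι Y) (RComod.inv_hom_lin q _).symm
  -- Left multiplication by `a` is an endomorphism of the right comodule `C`; naturality of `η`
  -- there is left linearity of `e`.
  have hsmul : ∀ (a : A) (x : X), e.hom.lin (a • x) = a • e.hom.lin x := by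
    intro a x
    apply Y.lcoact_injective
    rw [Y.lcoact.apply_smul, ← he, ← he]
    refine Eq.trans ?_ (hnat (C.regular.smulHom a) (p.hom.lin x))
    have : p.hom.lin (a • x) = RComod.cotensorMap (C.regular.smulHom a) X (p.hom.lin x) := by
      apply R.cotensorι_injective X
      refine (hp _).trans ((X.lcoact.apply_smul a x).trans ?_)
      rw [← hp]
      rfl
    rw [this]
  let l : X →ₗ[A] Y := mkLin e.hom.lin.toAddMonoidHom hsmul
  -- Naturality at the morphisms `c ⊗ - : C → C ⊗ C` computes `η` at `C ⊗ C` on elements coming from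
  -- `C ⊗ X`.
  have hw : ∀ w : BTensor A C X, ∃ z : (RComod.tensor C C.regular).cotensor X,
      (RComod.tensor C C.regular).cotensorι X z =
        BTensor.assoc.symm (BTensor.map LinearMap.id X.lcoact.l w) ∧
      (RComod.tensor C C.regular).cotensorι Y ((η.hom.app _).lin z) =
        BTensor.assoc.symm (BTensor.map LinearMap.id Y.lcoact.l (BTensor.map LinearMap.id l w)) := by
    intro w
    induction w using BTensor.induction_on with
    | zero =>
      refine ⟨0, by simp only [map_zero]; rfl, ?_⟩
      refine (congrArg _ (map_zero (η.hom.app _).lin)).trans ?_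
      simp only [map_zero]
      rfl
    | tmul c x =>
      refine ⟨RComod.cotensorMap (C.tmulHom c) X (p.hom.lin x), ?_, ?_⟩
      · refine (C.map_tmulHom c (R.cotensorι X (p.hom.lin x))).trans ?_
        rw [hp]
        rfl
      · refine (hnat _ _).trans ((C.map_tmulHom c _).trans ?_)
        rw [he]
        rfl
    | add x y hx hy =>
      obtain ⟨z, hz, hz'⟩ := hx
      obtain ⟨w, hw, hw'⟩ := hy
      refine ⟨z + w, ?_, ?_⟩
      · rw [map_add, hz, hw]
        simp only [map_add]
        rfl
      · refine (congrArg _ (map_add (η.hom.app _).lin z w)).trans ?_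
        refine (map_add _ _ _).trans ((congrArg₂ (· + ·) hz' hw').trans ?_)
        simp only [map_add]
        rfl
  refine ⟨Bicomod.isoOfBijective { e.hom with map_smul := hsmul, lcomm := fun x => ?_ }
    (RComod.iso_bijective e)⟩
  -- Naturality of `η` at `Δ : C → C ⊗ C` is left colinearity of `e`, once `C ⊗ Y` is embedded in `C
  -- ⊗ (C ⊗ Y)`.
  apply Y.map_lcoact_injective
  apply BTensor.assoc.symm.injective
  obtain ⟨z, hz, hz'⟩ := hw (X.lcoact x)
  refine hz'.symm.trans ?_
  rw [← Y.lcoassoc, AddEquiv.symm_apply_apply, ← he]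
  refine Eq.trans ?_ (hnat C.comulHom (p.hom.lin x))
  have : z = RComod.cotensorMap C.comulHom X (p.hom.lin x) := by
    apply RComod.cotensorι_injective
    refine hz.trans ?_
    rw [← X.lcoassoc, AddEquiv.symm_apply_apply, ← hp]
    rfl
  rw [this]

end recover

/-! ### Left actions without a coaction, and their transport along an equivalence -/

section restrict

variable {k : Type v} [CommRing k] {A B S : Type u} [Ring A] [Algebra k A] [Ring B] [Algebra k B]
  [Ring S] [Algebra k S]

/-- The algebra `S` as a coring over itself. -/
def Coring.trivial (k : Type v) [CommRing k] (S : Type u) [Ring S] [Algebra k S] : Coring k S where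
  carrier := S
  central r s := Algebra.commutes r s
  comul :=
    { toFun := fun s => BTensor.tmul S s (1 : S)
      map_zero' := BTensor.zero_tmul _
      map_add' := fun _ _ => BTensor.add_tmul _ _ _
      map_smul := fun _ _ => rfl
      map_op_smul := fun b x => by
        change BTensor.tmul S (op (unop b) • x) (1 : S) = BTensor.tmul S x (b • (1 : S))
        rw [BTensor.op_smul_tmul, smul_eq_mul, mul_one, ← op_unop b, op_smul_eq_mul, one_mul]
        rfl }
  counit :=
    { AddMonoidHom.id S with
      map_smul := fun _ _ => rfl
      map_op_smul := fun _ _ => rfl }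
  coassoc _ := rfl
  counit_comul s := mul_one s
  comul_counit s := mul_one s

theorem BTensor.lid_injective {N : Type u} [AddCommGroup N] [Module A N] :
    Function.Injective (BTensor.lid : BTensor A A N →+ N) := by
  refine Function.LeftInverse.injective (g := fun n => BTensor.tmul A (1 : A) n) fun z => ?_
  induction z using BTensor.induction_on with
  | zero => exact (congrArg _ (map_zero _)).trans (BTensor.tmul_zero _)
  | tmul a n =>
    change BTensor.tmul A (1 : A) (a • n) = _
    rw [← BTensor.op_smul_tmul, op_smul_eq_mul, one_mul]
  | add x y hx hy =>
    refine (congrArg _ (map_add _ x y)).trans ((BTensor.tmul_add _ _ _).trans ?_)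
    exact congrArg₂ (· + ·) hx hy

variable {C : Coring k A} {D : Coring k B}

/-- A right comodule with a commuting left action of `S`. -/
@[reducible] def RComod.withAction (M : RComod D) [Module S M] [SMulCommClass S Bᵐᵒᵖ M]
    (hc : ∀ (r : k) (x : M), algebraMap k S r • x = op (algebraMap k B r) • x)
    (hs : ∀ (s : S) (x : M), M.coact (s • x) = s • M.coact x) :
    Bicomod (Coring.trivial k S) D where
  toRComod := M
  central := hc
  coact_smul := hs
  lcoact :=
    { toFun := fun x => BTensor.tmul S (1 : S) x
      map_zero' := BTensor.tmul_zero _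
      map_add' := BTensor.tmul_add _
      map_smul := fun s x => by
        refine (BTensor.op_smul_tmul s (1 : S) x).symm.trans (congrArg (BTensor.tmul S · x) ?_)
        rw [op_smul_eq_mul, one_mul]
        exact (mul_one s).symm
      map_op_smul := fun _ _ => rfl }
  lcoassoc _ := rfl
  counit_lcoact x := one_smul S x
  compat x := (congrArg BTensor.assoc (BTensor.map_tmulLin (1 : S) (M.coact x))).trans
    (BTensor.assoc.apply_symm_apply _)

/-- The bicomodule obtained by forgetting the left coaction. -/
def Bicomod.restrict (X : Bicomod C D) : Bicomod (Coring.trivial k A) D :=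
  X.toRComod.withAction X.central X.coact_smul

/-- The counit axiom leaves no choice, so a bicomodule over the trivial coring is a right comodule
with a compatible left action. Results on bicomodules thereby apply before a left coaction has been
built. -/
theorem Bicomod.lcoact_trivial (X : Bicomod (Coring.trivial k A) D) (x : X) :
    X.lcoact x = BTensor.tmul A (1 : A) x := by
  apply BTensor.lid_injective
  refine Eq.trans ?_ ((X.counit_lcoact x).trans (one_smul A x).symm)
  exact congrArg BTensor.lid (BTensor.map_id_id _).symm

/-- A left linear morphism of right comodules as a morphism of bicomodules over the trivial
coring. -/
def Bicomod.homOfTrivial {X Y : Bicomod (Coring.trivial k A) D} (f : X.toRComod ⟶ Y.toRComod)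
    (hf : ∀ (a : A) (x : X), f.lin (a • x) = a • f.lin x) : X ⟶ Y :=
  { f with
    map_smul := hf
    lcomm := fun x => by
      rw [Bicomod.lcoact_trivial, Bicomod.lcoact_trivial]
      rfl }

/-- Right multiplication by an element of `k`, as an endomorphism of a comodule. -/
def RComod.scalarHom (M : RComod C) (r : k) : M ⟶ M where
  lin := mkLin (AddMonoidHom.mk' (fun m => op (algebraMap k A r) • m) (smul_add _)) (fun a m => by
    change op (algebraMap k A r) • a • m = a • op (algebraMap k A r) • m
    rw [smul_smul, smul_smul, ← op_unop a, ← op_mul, ← op_mul, Algebra.commutes])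
  comm m := by
    change _ = M.coact (op (algebraMap k A r) • m)
    rw [map_smul]
    generalize M.coact m = w
    induction w using BTensor.induction_on with
    | zero => simp only [map_zero, smul_zero]
    | tmul m c =>
      change BTensor.tmul A (op (algebraMap k A r) • m) c = _
      rw [BTensor.op_smul_tmul, C.central, BTensor.smul_tmul_right]
    | add x y hx hy => simp only [map_add, smul_add, hx, hy]

/-- Centrality of `X` lets the functor respect scalars from `k`. This is what makes the transported
left action of `B` central. -/
theorem cotensorFunctor_map_scalarHom [D.IsFlat] (X : Bicomod C D) (M : RComod C) (r : k) :
    (cotensorFunctor X).map (M.scalarHom r) = (M.cotensor X).scalarHom r := by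
  refine RComod.hom_ext fun z => M.cotensorι_injective X ?_
  have h : ∀ w : BTensor A M X, BTensor.map (M.scalarHom r).lin LinearMap.id w =
      op (algebraMap k B r) • w := by
    intro w
    induction w using BTensor.induction_on with
    | zero => simp only [map_zero, smul_zero]
    | tmul m x =>
      change BTensor.tmul A (op (algebraMap k A r) • m) x = _
      rw [BTensor.op_smul_tmul, X.central, BTensor.smul_tmul_right]
    | add x y hx hy => simp only [map_add, smul_add, hx, hy]
  exact h _

/-- Transport of the left action of `B` along an equivalence. -/
theorem Bicomod.IsRightInvertible.exists_withAction [D.IsFlat] {X : Bicomod C D}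
    (hX : X.IsRightInvertible) : ∃ (Y : Bicomod (Coring.trivial k B) C)
      (e : D.regular.toRComod ≅ Y.toRComod.cotensor X), ∀ (b : B) (d : D),
        Y.cotensorιL X (e.hom.lin (b • d)) = b • Y.cotensorιL X (e.hom.lin d) := by
  obtain ⟨M, ⟨e⟩⟩ := hX.exists_iso D.regular.toRComod
  -- `l b` is the endomorphism of `M` that corresponds to left multiplication by `b` on `D`. The
  -- module axioms then follow from faithfulness.
  choose l hl using fun b : B => hX.exists_map_eq (e.hom ≫ D.regular.smulHom b ≫ e.inv)
  have hl' : ∀ b z, ((cotensorFunctor X).map (l b)).lin z =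
      e.inv.lin (b • (e.hom.lin z : D.regular)) := fun b z => RComod.congr_lin (hl b) z
  have h1 : l 1 = 𝟙 M := hX.map_injective (RComod.hom_ext fun z => by
    rw [hl', one_smul, RComod.hom_inv_lin, CategoryTheory.Functor.map_id]; rfl)
  -- Composition is written in diagrammatic order, hence the reversal.
  have hmul : ∀ b b', l (b * b') = l b' ≫ l b := fun b b' =>
    hX.map_injective (RComod.hom_ext fun z => by
      rw [Functor.map_comp, RComod.comp_lin, LinearMap.comp_apply, hl', hl', hl', mul_smul,
        RComod.inv_hom_lin])
  have hadd : ∀ b b', l (b + b') = RComod.addHom (l b) (l b') := fun b b' =>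
    hX.map_injective (RComod.hom_ext fun z => by
      rw [hl', add_smul, map_add, cotensorFunctor_map_add]
      exact congrArg₂ (· + ·) (hl' b z).symm (hl' b' z).symm)
  have hc : ∀ r : k, l (algebraMap k B r) = M.scalarHom r := fun r =>
    hX.map_injective (RComod.hom_ext fun z => by
      rw [hl', D.regular.central, map_smul, RComod.hom_inv_lin, cotensorFunctor_map_scalarHom]
      rfl)
  let _ : Module B M :=
    { smul := fun b m => (l b).lin m
      one_smul := fun m => RComod.congr_lin h1 m
      mul_smul := fun b b' m => RComod.congr_lin (hmul b b') m
      smul_zero := fun b => map_zero (l b).lin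
      smul_add := fun b => map_add (l b).lin
      add_smul := fun b b' m => RComod.congr_lin (hadd b b') m
      zero_smul := fun m => by
        have h := RComod.congr_lin (hadd 0 0) m
        rw [add_zero] at h
        exact left_eq_add.1 h }
  have : SMulCommClass B Aᵐᵒᵖ M := ⟨fun b a m => (l b).lin.map_smul a m⟩
  let Y : Bicomod (Coring.trivial k B) C := M.withAction
    (fun r m => RComod.congr_lin (hc r) m) (fun b m => ((l b).comm m).symm)
  refine ⟨Y, e.symm, fun b d => ?_⟩
  have h := (hl' b (e.inv.lin d)).trans
    (congrArg (fun y : D.regular => e.inv.lin (b • y)) (RComod.inv_hom_lin e d))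
  exact (congrArg (M.cotensorι X) h).symm

end restrict

/-! ### Identities for a coaction, tested on the image of `D` in `Y ⊗ X` -/

section raw

variable {A B : Type u} [Ring A] [Ring B] {D Y X : Type u} [AddCommGroup D] [Module B D]
  [Module Bᵐᵒᵖ D] [SMulCommClass B Bᵐᵒᵖ D] [AddCommGroup Y] [Module B Y] [Module Aᵐᵒᵖ Y]
  [SMulCommClass B Aᵐᵒᵖ Y] [AddCommGroup X] [Module A X]
  (comul : BimodHom B B D (BTensor B D D)) (lam : Y →ₗ[Aᵐᵒᵖ] BTensor B D Y)
  (ψ : D →ₗ[B] BTensor A Y X)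

namespace BTensor

/-- In the application `ψ` is the inclusion of `D ≅ Y □ X` into `Y ⊗ X`, and `G` is `D ⊗ lam` up to
associativity. By `hψ` the two sides become `D ⊗ D ⊗ ψ` applied to the two iterated
comultiplications of `w`, which agree. -/
theorem map_comp_eq_of_coassoc (hψ : ∀ w, assoc (map lam LinearMap.id (ψ w)) =
      map LinearMap.id ψ (comul w))
    (hc : ∀ w, assoc (map comul.r LinearMap.id (comul w)) = map LinearMap.id comul.l (comul w))
    (G : BTensor B D Y →ₗ[Aᵐᵒᵖ] BTensor B (BTensor B D D) Y)
    (hG : ∀ d y, G (tmul B d y) = assoc.symm (tmul B d (lam y))) (w : D) :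
    map (mapR comul.r Y ∘ₗ lam) LinearMap.id (ψ w) = map (G ∘ₗ lam) LinearMap.id (ψ w) := by
  have hψ' : ∀ w, map lam LinearMap.id (ψ w) = assoc.symm (map LinearMap.id ψ (comul w)) :=
    fun w => by rw [← hψ, AddEquiv.symm_apply_apply]
  have h1 : ∀ (d : D) (u : BTensor A Y X), map G LinearMap.id (assoc.symm (tmul B d u)) =
      assoc.symm (assoc.symm (tmul B d (assoc (map lam LinearMap.id u)))) := by
    intro d u
    induction u using induction_on with
    | zero => simp only [map_zero, tmul_zero]
    | tmul y x =>
      rw [assoc_symm_tmul, map_tmul, map_tmul, hG, LinearMap.id_apply]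
      generalize lam y = v
      induction v using induction_on with
      | zero => simp only [map_zero, tmul_zero, zero_tmul]
      | tmul a b => simp only [assoc_tmul, assoc_symm_tmul]
      | add x y hx hy => simp only [map_add, tmul_add, add_tmul, hx, hy]
    | add x y hx hy => simp only [map_add, tmul_add, hx, hy]
  have h2 : ∀ v : BTensor B D D, map G LinearMap.id (assoc.symm (map LinearMap.id ψ v)) =
      assoc.symm (map LinearMap.id ψ (assoc.symm (map LinearMap.id comul.l v))) := by
    intro v
    induction v using induction_on with
    | zero => simp only [map_zero]
    | tmul d d' =>
      rw [map_tmul, map_tmul, h1, hψ, BimodHom.l_apply, LinearMap.id_apply]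
      congr 1
      generalize comul d' = v
      induction v using induction_on with
      | zero => simp only [map_zero, tmul_zero]
      | tmul a b => simp only [assoc_symm_tmul, map_tmul, LinearMap.id_apply]
      | add x y hx hy => simp only [map_add, tmul_add, hx, hy]
    | add x y hx hy => simp only [map_add, hx, hy]
  have h3 : ∀ z : BTensor A Y X, map (mapR comul.r Y ∘ₗ lam) LinearMap.id z =
      map (mapR comul.r Y) LinearMap.id (map lam LinearMap.id z) := fun z => by
    rw [map_map]; rfl
  have h4 : ∀ z : BTensor A Y X, map (G ∘ₗ lam) LinearMap.id z =
      map G LinearMap.id (map lam LinearMap.id z) := fun z => by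
    rw [map_map]; rfl
  rw [h3, h4, hψ', h2, ← hc, AddEquiv.symm_apply_apply, ← assoc_symm_map_left, map_map, map_map]
  rfl

/-- By `hψ` and left linearity of `ψ`, the left side is `ψ` applied to `ε(w₁) w₂ = w`. -/
theorem map_comp_eq_of_counit (hψ : ∀ w, assoc (map lam LinearMap.id (ψ w)) =
      map LinearMap.id ψ (comul w)) (counit : BimodHom B B D B)
    (hc : ∀ w, lid (map counit.r LinearMap.id (comul w)) = w)
    (H : BTensor B D Y →ₗ[Aᵐᵒᵖ] Y) (hH : ∀ d y, H (tmul B d y) = counit d • y) (w : D) :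
    map (H ∘ₗ lam) LinearMap.id (ψ w) = ψ w := by
  have hψ' : ∀ w, map lam LinearMap.id (ψ w) = assoc.symm (map LinearMap.id ψ (comul w)) :=
    fun w => by rw [← hψ, AddEquiv.symm_apply_apply]
  have h1 : ∀ (d : D) (u : BTensor A Y X), map H LinearMap.id (assoc.symm (tmul B d u)) =
      counit d • u := by
    intro d u
    induction u using induction_on with
    | zero => simp only [map_zero, tmul_zero, smul_zero]
    | tmul y x => rw [assoc_symm_tmul, map_tmul, hH, LinearMap.id_apply, smul_tmul]
    | add x y hx hy => simp only [map_add, tmul_add, smul_add, hx, hy]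
  have h2 : ∀ v : BTensor B D D, map H LinearMap.id (assoc.symm (map LinearMap.id ψ v)) =
      ψ (lid (map counit.r LinearMap.id v)) := by
    intro v
    induction v using induction_on with
    | zero => simp only [map_zero]
    | tmul d d' =>
      rw [map_tmul, map_tmul, h1, LinearMap.id_apply, lid_tmul, map_smul]
      rfl
    | add x y hx hy => simp only [map_add, hx, hy]
  have h4 : ∀ z : BTensor A Y X, map (H ∘ₗ lam) LinearMap.id z =
      map H LinearMap.id (map lam LinearMap.id z) := fun z => by
    rw [map_map]; rfl
  rw [h4, hψ', h2, hc]

/-- `lam` is only known to be right linear; left linearity becomes visible after tensoring with `X`,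
on the image of `ψ`, because `ψ` and the comultiplication are left linear. -/
theorem map_lam_smul (hψ : ∀ w, assoc (map lam LinearMap.id (ψ w)) =
      map LinearMap.id ψ (comul w)) (b : B) (w : D) :
    map lam LinearMap.id (b • ψ w) = b • map lam LinearMap.id (ψ w) := by
  apply assoc.injective
  rw [assoc_smul_left, hψ, ← map_smul, hψ, comul.apply_smul, map_smul_left _ _ (fun _ _ => rfl)]

end BTensor

end raw

section counit

variable {A B : Type u} [Ring A] [Ring B] {D Y C : Type u} [AddCommGroup D] [Module B D]
  [Module Bᵐᵒᵖ D] [AddCommGroup Y] [Module B Y] [Module Aᵐᵒᵖ Y]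
  [SMulCommClass B Aᵐᵒᵖ Y] [AddCommGroup C] [Module A C] [Module Aᵐᵒᵖ C] [SMulCommClass A Aᵐᵒᵖ C]

/-- The map `D ⊗ Y → Y` induced by a counit on `D`, as a right linear map. -/
def BTensor.counitR (ε : BimodHom B B D B) : BTensor B D Y →ₗ[Aᵐᵒᵖ] Y :=
  mkLin (BTensor.lid.comp (BTensor.map ε.r LinearMap.id)) (fun a z => by
    induction z using BTensor.induction_on with
    | zero => simp only [smul_zero, map_zero]
    | tmul d y => exact smul_comm (ε d) a y
    | add x y hx hy => simp only [smul_add, map_add, hx, hy])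

theorem BTensor.counitR_tmul (ε : BimodHom B B D B) (d : D) (y : Y) :
    (BTensor.counitR ε : BTensor B D Y →ₗ[Aᵐᵒᵖ] Y) (BTensor.tmul B d y) = ε d • y := rfl

theorem BTensor.map_counitR_coactR (ε : BimodHom B B D B) (ρ : BimodHom B A Y (BTensor A Y C))
    (z : BTensor B D Y) :
    BTensor.map (BTensor.counitR ε : BTensor B D Y →ₗ[Aᵐᵒᵖ] Y) LinearMap.id
      (BTensor.coactR D ρ z) = ρ ((BTensor.counitR ε : BTensor B D Y →ₗ[Aᵐᵒᵖ] Y) z) := by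
  induction z using BTensor.induction_on with
  | zero => simp only [map_zero]
  | tmul d y =>
    rw [BTensor.coactR_tmul, BTensor.counitR_tmul, ρ.apply_smul]
    generalize ρ y = w
    induction w using BTensor.induction_on with
    | zero => simp only [map_zero, BTensor.tmul_zero, smul_zero]
    | tmul y c => rw [BTensor.assoc_symm_tmul]; rfl
    | add x y hx hy => simp only [map_add, BTensor.tmul_add, smul_add, hx, hy]
  | add x y hx hy => simp only [map_add, hx, hy]

end counit

/-! ### The left coaction on a preimage of `D` -/

section inverse

variable {k : Type v} [CommRing k] {A B : Type u} [Ring A] [Algebra k A] [Ring B] [Algebra k B]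
  {C : Coring k A} {D : Coring k B}

/-- The morphism `D ⊗ Y → Y` of comodules induced by the counit. -/
def Bicomod.counitHom {Q : Coring k B} (D : Coring k B) (Y : Bicomod Q C) :
    RComod.tensor D Y ⟶ Y.toRComod :=
  ⟨BTensor.counitR D.counit, BTensor.map_counitR_coactR D.counit Y.coactB⟩

variable [D.IsFlat] {X : Bicomod C D}

/-- `Y` has a left action but as yet no left `D`-coaction. So the left coaction of `D` is forgotten
for `ψ` to be a morphism of bicomodules, which makes `D ⊗ ψ` a morphism of comodules. -/
theorem Bicomod.exists_regular_restrict_hom (Y : Bicomod (Coring.trivial k B) C)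
    (e : D.regular.toRComod ≅ Y.toRComod.cotensor X)
    (ψ : D →ₗ[B] BTensor A Y X) (hψ : ∀ d, ψ d = Y.toRComod.cotensorι X (e.hom.lin d)) :
    ∃ f : D.regular.restrict ⟶ Y.tensor X, ∀ d : D, f.lin d = ψ d :=
  ⟨Bicomod.homOfTrivial (X := D.regular.restrict) (Y := Y.tensor X)
      (e.hom ≫ RComod.cotensorIncl Y.toRComod X) (fun b d =>
        (hψ _).symm.trans ((map_smul ψ b d).trans (congrArg (b • ·) (hψ d)))),
    fun d => (hψ d).symm⟩

/-- The comultiplication as a morphism of comodules, forgetting the left coaction of `D`. -/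
def Coring.comulRestrictHom (D : Coring k B) :
    D.regular.toRComod ⟶ RComod.tensor D D.regular.restrict where
  lin := D.comul.r
  comm := D.comulHom.comm

omit [D.IsFlat] in
theorem Coring.tensorMapRight_comulRestrictHom {Y : Bicomod (Coring.trivial k B) C}
    {X : Bicomod C D} (ψ : D →ₗ[B] BTensor A Y X) (f : D.regular.restrict ⟶ Y.tensor X)
    (hf : ∀ d : D, f.lin d = ψ d) (w : D) :
    (RComod.tensorMapRight D f).lin (D.comulRestrictHom.lin w) =
      (BTensor.map LinearMap.id ψ (D.comul w) : BTensor B D (BTensor A Y X)) :=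
  BTensor.map_congr (f := LinearMap.id) (f' := LinearMap.id)
      (g := (Bicomod.homL f : D →ₗ[B] BTensor A Y X)) (g' := ψ)
      (fun _ => rfl) hf (D.comul w)

omit [D.IsFlat] in
-- Up to the identification `D ≅ Y □ X`, this is what the sought left coaction of `Y` must become
-- under `- □ X`.
theorem Bicomod.exists_comul_hom {Y : Bicomod (Coring.trivial k B) C} {X : Bicomod C D}
    (ψ : D →ₗ[B] BTensor A Y X) (f : D.regular.restrict ⟶ Y.tensor X) (hf : ∀ d : D, f.lin d = ψ d) :
    ∃ Φ : D.regular.toRComod ⟶ RComod.tensor (BTensor B D Y) X, ∀ w : D, Φ.lin w =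
      (BTensor.assoc.symm (BTensor.map LinearMap.id ψ (D.comul w)) :
        BTensor A (BTensor B D Y) X) :=
  ⟨D.comulRestrictHom ≫ RComod.tensorMapRight D f ≫ RComod.assocSymmHom D Y X, fun w =>
    congrArg BTensor.assoc.symm (Coring.tensorMapRight_comulRestrictHom ψ f hf w)⟩

omit [D.IsFlat] in
theorem Bicomod.map_omegaL_map_eq_zero (Y : Bicomod (Coring.trivial k B) C)
    (ψ : D →ₗ[B] BTensor A Y X) (hψ : ∀ d, Y.omegaL X (ψ d) = 0) (z : BTensor B D D) :
    BTensor.map LinearMap.id (Y.omegaL X) (BTensor.map LinearMap.id ψ z) =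
      (0 : BTensor B D (BTensor A Y (BTensor A C X))) := by
  induction z using BTensor.induction_on with
  | zero => simp only [map_zero]
  | tmul d d' => rw [BTensor.map_tmul, BTensor.map_tmul, hψ, BTensor.tmul_zero]
  | add x y hx hy => rw [map_add, map_add, hx, hy, add_zero]

/-- The left coaction on a preimage of `D` under the cotensor functor. -/
theorem Bicomod.IsRightInvertible.exists_lcoact (hX : X.IsRightInvertible)
    (Y : Bicomod (Coring.trivial k B) C) (e : D.regular.toRComod ≅ Y.toRComod.cotensor X)
    (ψ : D →ₗ[B] BTensor A Y X) (hψ : ∀ d, ψ d = Y.toRComod.cotensorι X (e.hom.lin d)) :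
    ∃ lam : Y.toRComod ⟶ RComod.tensor D Y, ∀ w : D,
      BTensor.assoc (BTensor.map (lam.lin : Y →ₗ[Aᵐᵒᵖ] BTensor B D Y) LinearMap.id (ψ w)) =
        BTensor.map LinearMap.id ψ (D.comul w) := by
  obtain ⟨f, hf⟩ := Bicomod.exists_regular_restrict_hom Y e ψ hψ
  obtain ⟨Φ, hΦ⟩ := Bicomod.exists_comul_hom ψ f hf
  have hω : ∀ d, Y.omegaL X (ψ d) = 0 := fun d =>
    (congrArg (Y.omegaL X) (hψ d)).trans (Y.toRComod.omega_cotensorι X (e.hom.lin d))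
  -- Since `ψ` takes values in the kernel of `ω`, those of `Φ` lie in `(D ⊗ Y) □ X`. Fullness then
  -- turns the factorization `s : D → (D ⊗ Y) □ X` into a morphism `Y → D ⊗ Y`.
  obtain ⟨s, hs⟩ := RComod.exists_lift_of_injective Coring.IsFlat.left
    (RComod.cotensorIncl (RComod.tensor D Y) X) (RComod.cotensorι_injective _ X) Φ (fun w => by
      obtain ⟨m, hm⟩ := Bicomod.exists_tensorCotensorι_eq (T := Y) (X := X)
        (BTensor.map LinearMap.id ψ (D.comul w)) (Bicomod.map_omegaL_map_eq_zero Y ψ hω (D.comul w))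
      exact ⟨m, (BTensor.assoc.symm_apply_eq.2 hm.symm).symm.trans (hΦ w).symm⟩)
  obtain ⟨lam, hlam⟩ := hX.exists_map_eq (M := Y.toRComod) (N := RComod.tensor D Y) (e.inv ≫ s)
  refine ⟨lam, fun w => ?_⟩
  have h1 : RComod.cotensorMap lam X (e.hom.lin w) = s.lin w :=
    (RComod.congr_lin hlam (e.hom.lin w)).trans (congrArg s.lin (RComod.hom_inv_lin e w))
  have h2 : (RComod.tensor D Y).cotensorι X (s.lin w) = Φ.lin w := RComod.congr_lin hs w
  have h3 := (congrArg ((RComod.tensor D Y).cotensorι X) h1).trans (h2.trans (hΦ w))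
  refine BTensor.assoc.symm_apply_eq.1 (h3.symm.trans ?_) |>.symm
  exact congrArg (BTensor.map (lam.lin : Y →ₗ[Aᵐᵒᵖ] BTensor B D Y) LinearMap.id) (hψ w).symm

/-- Morphisms out of a preimage of `D` under the cotensor functor are determined by their
effect on the image of `D`. -/
theorem Bicomod.IsRightInvertible.hom_ext_of_cotensor (hX : X.IsRightInvertible)
    {M N : RComod C} (e : D.regular.toRComod ≅ M.cotensor X) {f g : M ⟶ N}
    (h : ∀ d : D, BTensor.map f.lin LinearMap.id (M.cotensorι X (e.hom.lin d)) =
      BTensor.map g.lin LinearMap.id (M.cotensorι X (e.hom.lin d))) : f = g := by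
  refine hX.map_injective (RComod.hom_ext fun (z : M.cotensor X) => N.cotensorι_injective X ?_)
  obtain ⟨d, rfl⟩ := (RComod.iso_bijective e).2 z
  exact h d

end inverse

section raw

variable {A B : Type u} [Ring A] [Ring B] {D Y C : Type u} [AddCommGroup D] [Module B D]
  [Module Bᵐᵒᵖ D] [SMulCommClass B Bᵐᵒᵖ D] [AddCommGroup Y] [Module B Y] [Module Aᵐᵒᵖ Y]
  [SMulCommClass B Aᵐᵒᵖ Y] [AddCommGroup C] [Module A C] [Module Aᵐᵒᵖ C] [SMulCommClass A Aᵐᵒᵖ C]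

namespace BTensor

/-- The map `v ↦ (d ⊗ -) v` from `D ⊗ Y` to `(D ⊗ D) ⊗ Y`. -/
def insertLeft (d : D) : BTensor B D Y →ₗ[Aᵐᵒᵖ] BTensor B (BTensor B D D) Y :=
  mkLin (AddMonoidHom.mk' (fun v => assoc.symm (tmul B d v))
    (fun v w => by rw [tmul_add, map_add]))
    (fun a v => assoc_symm_smul_right (T := A) a (tmul B d v))

theorem insertLeft_apply (d : D) (v : BTensor B D Y) :
    (insertLeft d : _ →ₗ[Aᵐᵒᵖ] _) v = assoc.symm (tmul B d v) := rfl

theorem coactR_insertLeft (ρ : BimodHom B A Y (BTensor A Y C)) (d : D) (v : BTensor B D Y) :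
    coactR (BTensor B D D) ρ ((insertLeft d : _ →ₗ[Aᵐᵒᵖ] _) v) =
      map (insertLeft d) LinearMap.id (coactR D ρ v) := by
  induction v using induction_on with
  | zero => simp only [map_zero]
  | tmul d' y =>
    rw [insertLeft_apply, assoc_symm_tmul, coactR_tmul, coactR_tmul]
    generalize ρ y = w
    induction w using induction_on with
    | zero => simp only [map_zero, tmul_zero]
    | tmul y c =>
      rw [assoc_symm_tmul, assoc_symm_tmul, map_tmul, insertLeft_apply, assoc_symm_tmul]
      rfl
    | add x y hx hy => simp only [map_add, tmul_add, hx, hy]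
  | add x y hx hy => simp only [map_add, hx, hy]

/-- The map `d ⊗ y ↦ (d ⊗ -) (lam y)`. -/
def mapAssocSymm (lam : BimodHom B A Y (BTensor B D Y)) :
    BTensor B D Y →ₗ[Aᵐᵒᵖ] BTensor B (BTensor B D D) Y :=
  mkLin (assoc.symm.toAddMonoidHom.comp (map LinearMap.id lam.l)) (fun a z =>
    (congrArg assoc.symm (map_smul_right LinearMap.id lam.l lam.map_op_smul a z)).trans
      (assoc_symm_smul_right a _))

theorem mapAssocSymm_apply (lam : BimodHom B A Y (BTensor B D Y)) (z : BTensor B D Y) :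
    mapAssocSymm lam z = assoc.symm (map LinearMap.id lam.l z) := rfl

/-- `D ⊗ lam` inherits right colinearity from `lam`, and so becomes a morphism to which faithfulness
of `- □ X` applies. -/
theorem map_mapAssocSymm_coactR (ρ : BimodHom B A Y (BTensor A Y C))
    (lam : BimodHom B A Y (BTensor B D Y))
    (h : ∀ y, map lam.r LinearMap.id (ρ y) = coactR D ρ (lam y)) (z : BTensor B D Y) :
    map (mapAssocSymm lam) LinearMap.id (coactR D ρ z) =
      coactR (BTensor B D D) ρ (mapAssocSymm lam z) := by
  induction z using induction_on with
  | zero => simp only [map_zero]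
  | tmul d y =>
    rw [mapAssocSymm_apply, map_tmul, BimodHom.l_apply, LinearMap.id_apply]
    refine Eq.trans ?_ (coactR_insertLeft ρ d (lam y)).symm
    rw [← h, coactR_tmul]
    generalize ρ y = w
    induction w using induction_on with
    | zero => simp only [map_zero, tmul_zero]
    | tmul y c => rw [assoc_symm_tmul]; rfl
    | add x y hx hy => simp only [map_add, tmul_add, hx, hy]
  | add x y hx hy => simp only [map_add, hx, hy]

/-- Left multiplication as a right linear map. -/
def lsmul (b : B) : D →ₗ[Bᵐᵒᵖ] D :=
  mkLin (AddMonoidHom.mk' (fun d => b • d) (smul_add b)) (fun a d => smul_comm b a d)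

end BTensor

end raw

section inverse

variable {k : Type v} [CommRing k] {A B : Type u} [Ring A] [Algebra k A] [Ring B] [Algebra k B]
  {C : Coring k A} {D : Coring k B} [D.IsFlat] {X : Bicomod C D}

/-- A right comodule isomorphism between `D` and `Y □ X` that is compatible with the left
structures. -/
theorem Bicomod.nonempty_regular_iso (Y : Bicomod D C)
    (e : D.regular.toRComod ≅ Y.toRComod.cotensor X) (ψ : D →ₗ[B] BTensor A Y X)
    (hψ : ∀ d, ψ d = Y.toRComod.cotensorι X (e.hom.lin d))
    (h : ∀ d, BTensor.assoc (BTensor.map Y.lcoact.r LinearMap.id (ψ d)) =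
      BTensor.map LinearMap.id ψ (D.comul d)) : Nonempty (D.regular ≅ Y.cotensor X) := by
  let g : D →ₗ[B] Y.CotensorSub X :=
    mkLin (e.hom.lin.toAddMonoidHom : D →+ Y.CotensorSub X) (fun b d =>
      Y.cotensorιL_injective X ((hψ (b • d)).symm.trans
        ((map_smul ψ b d).trans (congrArg (b • ·) (hψ d)))))
  have hg : ∀ d, Y.cotensorιL X (g d) = ψ d := fun d => (hψ d).symm
  refine ⟨Bicomod.isoOfBijective (X := D.regular) (Y := Y.cotensor X)
    { lin := e.hom.lin
      comm := e.hom.comm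
      map_smul := g.map_smul
      lcomm := fun d => ?_ } (RComod.iso_bijective e)⟩
  -- Right flatness of `D` embeds `D ⊗ (Y □ X)` in `D ⊗ (Y ⊗ X)`, where left colinearity of `e` is
  -- the hypothesis `h`.
  apply Coring.IsFlat.right (C := D) _ _ (Y.cotensorιL X) (Y.cotensorιL_injective X)
  have h1 : BTensor.map LinearMap.id (Y.cotensorιL X) (BTensor.map LinearMap.id g (D.comul d)) =
      BTensor.map LinearMap.id ψ (D.comul d) := by
    rw [BTensor.map_map]
    exact BTensor.map_congr (fun _ => rfl) hg _
  refine h1.trans ((h d).symm.trans ?_)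
  refine Eq.trans ?_ ((Y.tensor X).subLcoact_spec _ _ _ _ (g d)).symm
  exact congrArg (fun z => BTensor.assoc (BTensor.map Y.lcoact.r LinearMap.id z)) (hg d).symm

end inverse

/-! ### The bicomodule axioms for `Y`, and the left inverse -/

section inverse

variable {k : Type v} [CommRing k] {A B : Type u} [Ring A] [Algebra k A] [Ring B] [Algebra k B]
  {C : Coring k A} {D : Coring k B} [D.IsFlat] {X : Bicomod C D}

namespace Bicomod.IsRightInvertible

section

variable (hX : X.IsRightInvertible) {Y : Bicomod (Coring.trivial k B) C}
  (e : D.regular.toRComod ≅ Y.toRComod.cotensor X) (ψ : D →ₗ[B] BTensor A Y X)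
  (hψ : ∀ d, ψ d = Y.toRComod.cotensorι X (e.hom.lin d))
  (lam : Y →ₗ[Aᵐᵒᵖ] BTensor B D Y)
  (hc : ∀ y, BTensor.map lam LinearMap.id (Y.coact y) = BTensor.coactR D Y.coactB (lam y))
  (hlam : ∀ d : D, BTensor.assoc (BTensor.map lam LinearMap.id (ψ d)) =
    BTensor.map LinearMap.id ψ (D.comul d))

include hX e hψ

/-- Faithfulness of `- □ X`: as `D ≅ Y □ X` through `e`, a morphism out of `Y` is determined by its
effect on the elements `ψ d`. The axioms for the left coaction are checked in this way. -/
theorem eq_of_map_eq {N : RComod C} {f g : Y.toRComod ⟶ N}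
    (h : ∀ d, BTensor.map f.lin LinearMap.id (ψ d) = BTensor.map g.lin LinearMap.id (ψ d))
    (y : Y) : f.lin y = g.lin y :=
  RComod.congr_lin (hX.hom_ext_of_cotensor e (fun d => by rw [← hψ]; exact h d)) y

include hc hlam

theorem lcoact_smul (b : B) (y : Y) : lam (b • y) = b • lam y := by
  let lamH : Y.toRComod ⟶ RComod.tensor D Y := ⟨lam, hc⟩
  refine hX.eq_of_map_eq e ψ hψ (f := Y.smulHom b ≫ lamH)
    (g := lamH ≫ RComod.tensorMap (BTensor.lsmul b : D →ₗ[Bᵐᵒᵖ] D) Y) (fun d => ?_) y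
  have h1 : BTensor.map (lam ∘ₗ (Y.smulHom b).lin) LinearMap.id (ψ d) =
      BTensor.map lam LinearMap.id (b • ψ d) := by
    rw [← Y.map_smulHom, BTensor.map_map]; rfl
  have h2 : BTensor.map (BTensor.mapR (BTensor.lsmul b : D →ₗ[Bᵐᵒᵖ] D) Y ∘ₗ lam)
      LinearMap.id (ψ d) = b • BTensor.map lam LinearMap.id (ψ d) :=
    (BTensor.map_map lam LinearMap.id
      (BTensor.mapR (BTensor.lsmul b : D →ₗ[Bᵐᵒᵖ] D) Y) LinearMap.id (ψ d)).symm
  exact h1.trans ((BTensor.map_lam_smul D.comul lam ψ hlam b d).trans h2.symm)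

theorem lcoact_counit (y : Y) :
    BTensor.lid (BTensor.map D.counit.r LinearMap.id (lam y)) = y := by
  let lamH : Y.toRComod ⟶ RComod.tensor D Y := ⟨lam, hc⟩
  refine hX.eq_of_map_eq e ψ hψ (f := lamH ≫ Bicomod.counitHom D Y) (g := 𝟙 _) (fun d => ?_) y
  refine (BTensor.map_comp_eq_of_counit D.comul lam ψ hlam D.counit D.counit_comul
    (BTensor.counitR D.counit) (BTensor.counitR_tmul D.counit) d).trans ?_
  exact (BTensor.map_id_id (ψ d)).symm

end

/-- Both iterates of `lam` are right colinear maps `Y → (D ⊗ D) ⊗ Y` that agree on the elements `ψ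
d` by coassociativity of `D`. Here `lam` has to be left linear already, for `D ⊗ lam` to make sense.
-/
theorem lcoact_coassoc (hX : X.IsRightInvertible) {Y : Bicomod (Coring.trivial k B) C}
    (e : D.regular.toRComod ≅ Y.toRComod.cotensor X) (ψ : D →ₗ[B] BTensor A Y X)
    (hψ : ∀ d, ψ d = Y.toRComod.cotensorι X (e.hom.lin d))
    (lam : BimodHom B A Y (BTensor B D Y))
    (hc : ∀ y, BTensor.map lam.r LinearMap.id (Y.coact y) = BTensor.coactR D Y.coactB (lam y))
    (hlam : ∀ d : D, BTensor.assoc (BTensor.map lam.r LinearMap.id (ψ d)) =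
      BTensor.map LinearMap.id ψ (D.comul d)) (y : Y) :
    BTensor.assoc (BTensor.map D.comul.r LinearMap.id (lam y)) =
      BTensor.map LinearMap.id lam.l (lam y) := by
  let lamH : Y.toRComod ⟶ RComod.tensor D Y := ⟨lam.r, hc⟩
  let G : RComod.tensor D Y ⟶ RComod.tensor (BTensor B D D) Y :=
    ⟨BTensor.mapAssocSymm lam, BTensor.map_mapAssocSymm_coactR Y.coactB lam hc⟩
  refine BTensor.assoc.symm_apply_eq.1 (Eq.symm ?_) |>.symm
  refine hX.eq_of_map_eq e ψ hψ (f := lamH ≫ RComod.tensorMap D.comul.r Y) (g := lamH ≫ G)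
    (fun d => ?_) y
  exact BTensor.map_comp_eq_of_coassoc D.comul lam.r ψ hlam D.coassoc
    (BTensor.mapAssocSymm lam) (fun _ _ => rfl) d

/-- A right invertible bicomodule has a left inverse. -/
theorem exists_nonempty_regular_iso (hX : X.IsRightInvertible) :
    ∃ Y : Bicomod D C, Nonempty (D.regular ≅ Y.cotensor X) := by
  obtain ⟨Y, e, he⟩ := hX.exists_withAction
  let ψ : D →ₗ[B] BTensor A Y X :=
    mkLin ((Y.toRComod.cotensorι X).toAddMonoidHom.comp e.hom.lin.toAddMonoidHom) he
  have hψ : ∀ d, ψ d = Y.toRComod.cotensorι X (e.hom.lin d) := fun d => rfl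
  obtain ⟨lamH, hlam⟩ := hX.exists_lcoact Y e ψ hψ
  have hc : ∀ y, BTensor.map (lamH.lin : Y →ₗ[Aᵐᵒᵖ] BTensor B D Y) LinearMap.id (Y.coact y) =
    BTensor.coactR D Y.coactB (lamH.lin y) := lamH.comm
  let lam : BimodHom B A Y (BTensor B D Y) :=
    { toAddMonoidHom := (lamH.lin : Y →ₗ[Aᵐᵒᵖ] BTensor B D Y).toAddMonoidHom
      map_smul := hX.lcoact_smul e ψ hψ lamH.lin hc hlam
      map_op_smul := (lamH.lin : Y →ₗ[Aᵐᵒᵖ] BTensor B D Y).map_smul }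
  let Y' : Bicomod D C :=
    { toRComod := Y.toRComod
      leftModule := Y.leftModule
      smulComm := Y.smulComm
      central := Y.central
      coact_smul := Y.coact_smul
      lcoact := lam
      lcoassoc := hX.lcoact_coassoc e ψ hψ lam hc hlam
      counit_lcoact := hX.lcoact_counit e ψ hψ lamH.lin hc hlam
      -- Compatibility of the two coactions is right colinearity of `lam`.
      compat := fun y => BTensor.assoc.symm_apply_eq.1 (hc y).symm |>.symm }
  exact ⟨Y', Bicomod.nonempty_regular_iso Y' e ψ hψ hlam⟩

end Bicomod.IsRightInvertible

end inverse

/-! ### Restriction of comodules along an automorphism of the coring -/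

section twist

variable {k : Type v} [CommRing k] {A : Type u} [Ring A] [Algebra k A] {C : Coring k A}

/-- The restriction of the right module `M` along the automorphism of `A` underlying `f`. -/
def Coring.Auto.Twist (_ : C.Auto) (M : Type u) : Type u := M

namespace Coring.Auto.Twist

variable (f g : C.Auto) (M N : Type u) [AddCommGroup M] [Module Aᵐᵒᵖ M] [AddCommGroup N]
  [Module Aᵐᵒᵖ N]

instance : AddCommGroup (f.Twist M) := inferInstanceAs (AddCommGroup M)

/-- The action `m * a = m ρ(a)`. -/
instance : Module Aᵐᵒᵖ (f.Twist M) :=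
  (Module.compHom M (RingHom.op (f.ρ : A →+* A)) : Module Aᵐᵒᵖ M)

/-- The identity map. -/
def of : M ≃+ f.Twist M := AddEquiv.refl M

theorem op_smul_of (a : A) (m : M) : op a • of f M m = of f M (op (f.ρ a) • m) := rfl

theorem of_op_smul (a : A) (m : M) : of f M (op a • m) = op (f.ρ.symm a) • of f M m := by
  rw [op_smul_of, AlgEquiv.apply_symm_apply]

/-- The map `m ⊗ c ↦ m ⊗ φ⁻¹(c)`. -/
def τ : BTensor A M C →+ BTensor A (f.Twist M) C :=
  BTensor.smap f.ρ.symm (of f M).toAddMonoidHom f.φ.symm.toAddMonoidHom (of_op_smul f M)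
    f.φ_symm_smul

theorem τ_tmul (m : M) (c : C) :
    τ f M (BTensor.tmul A m c) = BTensor.tmul A (of f M m) (f.φ.symm c) := rfl

theorem τ_op_smul (a : A) (z : BTensor A M C) : τ f M (op (f.ρ a) • z) = op a • τ f M z := by
  induction z using BTensor.induction_on with
  | zero => simp only [smul_zero, map_zero]
  | tmul m c =>
    rw [BTensor.smul_tmul_right, τ_tmul, τ_tmul, f.φ_symm_op_smul, AlgEquiv.symm_apply_apply]
    rfl
  | add x y hx hy => simp only [smul_add, map_add, hx, hy]

variable {M N}

/-- A right linear map, between restrictions along `f`. -/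
def mapLin (q : M →ₗ[Aᵐᵒᵖ] N) : f.Twist M →ₗ[Aᵐᵒᵖ] f.Twist N :=
  mkLin ((of f N).toAddMonoidHom.comp (q.toAddMonoidHom.comp (of f M).symm.toAddMonoidHom))
    (fun a m => q.map_smul (op (f.ρ (unop a))) ((of f M).symm m))

theorem map_mapLin_τ (q : M →ₗ[Aᵐᵒᵖ] N) (z : BTensor A M C) :
    BTensor.map (mapLin f q) LinearMap.id (τ f M z) = τ f N (BTensor.map q LinearMap.id z) := by
  induction z using BTensor.induction_on with
  | zero => simp only [map_zero]
  | tmul m c => rfl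
  | add x y hx hy => simp only [map_add, hx, hy]

variable (M)

/-- Restriction along the identity. -/
def oneLin : M →ₗ[Aᵐᵒᵖ] (1 : C.Auto).Twist M :=
  mkLin (of (1 : C.Auto) M).toAddMonoidHom (fun _ _ => rfl)

theorem map_oneLin (z : BTensor A M C) :
    BTensor.map (oneLin (C := C) M) LinearMap.id z = τ 1 M z := by
  induction z using BTensor.induction_on with
  | zero => simp only [map_zero]
  | tmul m c => rfl
  | add x y hx hy => simp only [map_add, hx, hy]

/-- Restriction along a product. -/
def mulLin : (f * g).Twist M →ₗ[Aᵐᵒᵖ] g.Twist (f.Twist M) :=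
  mkLin (((of (f * g) M).symm.trans (of f M)).trans (of g (f.Twist M))).toAddMonoidHom
    (fun _ _ => rfl)

theorem mulLin_of (m : M) : mulLin f g M (of (f * g) M m) = of g (f.Twist M) (of f M m) := rfl

theorem mul_φ_symm (c : C) : (f * g).φ.symm c = g.φ.symm (f.φ.symm c) := rfl

theorem map_mulLin_τ (z : BTensor A M C) :
    BTensor.map (mulLin f g M) LinearMap.id (τ (f * g) M z) = τ g (f.Twist M) (τ f M z) := by
  induction z using BTensor.induction_on with
  | zero => simp only [map_zero]
  | tmul m c =>
    rw [τ_tmul, τ_tmul, τ_tmul, BTensor.map_tmul, mulLin_of, mul_φ_symm, LinearMap.id_apply]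
  | add x y hx hy => simp only [map_add, hx, hy]

variable {M}

/-- The coaction `m ↦ m₀ ⊗ φ⁻¹(m₁)`. -/
def coact (δ : M →ₗ[Aᵐᵒᵖ] BTensor A M C) : f.Twist M →ₗ[Aᵐᵒᵖ] BTensor A (f.Twist M) C :=
  mkLin ((τ f M).comp (δ.toAddMonoidHom.comp (of f M).symm.toAddMonoidHom)) (fun a m => by
    change τ f M (δ (op (f.ρ (unop a)) • (of f M).symm m)) = a • τ f M (δ _)
    rw [δ.map_smul, τ_op_smul]
    rfl)

theorem coact_of (δ : M →ₗ[Aᵐᵒᵖ] BTensor A M C) (m : M) :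
    coact f δ (of f M m) = τ f M (δ m) := rfl

end Coring.Auto.Twist

namespace RComod

open Coring.Auto.Twist

variable (f g : C.Auto) (M : RComod C)

/-- Since `φ⁻¹` is compatible with comultiplication, applying it to the coring factors carries
coassociativity of `M` over to the restriction. -/
theorem twist_coassoc (m : f.Twist M) :
    BTensor.assoc (BTensor.map (Coring.Auto.Twist.coact f M.coact) LinearMap.id
      (Coring.Auto.Twist.coact f M.coact m)) =
      BTensor.map LinearMap.id C.comul.l (Coring.Auto.Twist.coact f M.coact m) := by
  obtain ⟨m, rfl⟩ := (of f M).surjective m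
  let Ψ : BTensor A M (BTensor A C C) →+ BTensor A (f.Twist M) (BTensor A C C) :=
    BTensor.smap f.ρ.symm (of f M).toAddMonoidHom (f⁻¹).tensor (of_op_smul f M) (fun a z => by
      induction z using BTensor.induction_on with
      | zero => simp only [smul_zero, map_zero]
      | tmul c c' =>
        exact congrArg (fun x => BTensor.tmul A x (f.φ.symm c')) (f.φ_symm_smul a c)
      | add x y hx hy => simp only [smul_add, map_add, hx, hy])
  have h1 : ∀ z : BTensor A M C, BTensor.assoc (BTensor.map (Coring.Auto.Twist.coact f M.coact)
      LinearMap.id (τ f M z)) = Ψ (BTensor.assoc (BTensor.map M.coact LinearMap.id z)) := by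
    intro z
    induction z using BTensor.induction_on with
    | zero => simp only [map_zero]
    | tmul m c =>
      rw [τ_tmul, BTensor.map_tmul, BTensor.map_tmul, coact_of]
      generalize M.coact m = w
      induction w using BTensor.induction_on with
      | zero => simp only [map_zero, BTensor.zero_tmul]
      | tmul m c => rfl
      | add x y hx hy => simp only [map_add, BTensor.add_tmul, hx, hy]
    | add x y hx hy => simp only [map_add, hx, hy]
  have h2 : ∀ z : BTensor A M C, BTensor.map LinearMap.id C.comul.l (τ f M z) =
      Ψ (BTensor.map LinearMap.id C.comul.l z) := by
    intro z
    induction z using BTensor.induction_on with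
    | zero => simp only [map_zero]
    | tmul m c => exact congrArg (BTensor.tmul A (of f M m)) ((f⁻¹).comul_φ c)
    | add x y hx hy => simp only [map_add, hx, hy]
  rw [coact_of, h1, h2, M.coassoc]

theorem twist_coact_counit (m : f.Twist M) :
    BTensor.rid (BTensor.map LinearMap.id C.counit.l
      (Coring.Auto.Twist.coact f M.coact m)) = m := by
  obtain ⟨m, rfl⟩ := (of f M).surjective m
  have h : ∀ z : BTensor A M C, BTensor.rid (BTensor.map LinearMap.id C.counit.l (τ f M z)) =
      of f M (BTensor.rid (BTensor.map LinearMap.id C.counit.l z)) := by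
    intro z
    induction z using BTensor.induction_on with
    | zero => simp only [map_zero]
    | tmul m c =>
      change op (C.counit (f.φ.symm c)) • of f M m = of f M (op (C.counit c) • m)
      rw [of_op_smul]
      exact congrArg (fun a => op a • of f M m) ((f⁻¹).map_counit c)
    | add x y hx hy => simp only [map_add, hx, hy]
  rw [coact_of, h, M.coact_counit]

/-- The restriction of the comodule `M` along the automorphism `f`. -/
def twist : RComod C where
  carrier := f.Twist M
  coact := Coring.Auto.Twist.coact f M.coact
  coassoc := M.twist_coassoc f
  coact_counit := M.twist_coact_counit f

theorem map_mapLin_coact {M N : RComod C} (q : M ⟶ N) (m : f.Twist M) :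
    BTensor.map (mapLin f q.lin) LinearMap.id (Coring.Auto.Twist.coact f M.coact m) =
      Coring.Auto.Twist.coact f N.coact (mapLin f q.lin m) :=
  (map_mapLin_τ f q.lin _).trans (congrArg (τ f N) (q.comm _))

/-- A morphism of comodules, between restrictions along `f`. -/
def twistMap {M N : RComod C} (q : M ⟶ N) : M.twist f ⟶ N.twist f where
  lin := (mapLin f q.lin : f.Twist M →ₗ[Aᵐᵒᵖ] f.Twist N)
  comm := map_mapLin_coact f q

/-- Restriction along the identity. -/
def twistOneHom : M ⟶ M.twist 1 where
  lin := oneLin M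
  comm m := map_oneLin M (M.coact m)

/-- Restriction along a product. -/
def twistMulHom : M.twist (f * g) ⟶ (M.twist f).twist g where
  lin := mulLin f g M
  comm m := map_mulLin_τ f g M (M.coact m)

end RComod

/-- Restriction along an automorphism of the coring. -/
def twistFunctor (f : C.Auto) : RComod C ⥤ RComod C where
  obj M := M.twist f
  map q := RComod.twistMap f q
  map_id _ := RComod.hom_ext fun _ => rfl
  map_comp _ _ := RComod.hom_ext fun _ => rfl

theorem nonempty_twistFunctor_one : Nonempty (twistFunctor (1 : C.Auto) ≅ 𝟭 (RComod C)) :=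
  ⟨(NatIso.ofComponents (F := 𝟭 (RComod C)) (G := twistFunctor 1)
    (fun M => RComod.isoOfBijective (M := M) (N := M.twist 1) M.twistOneHom
      (Coring.Auto.Twist.of 1 M).bijective) (fun _ => RComod.hom_ext fun _ => rfl)).symm⟩

/-- Restriction along `f` and then along `g` lets `a` act through `f.ρ (g.ρ a)`, and changes the
coaction by `g.φ⁻¹ ∘ f.φ⁻¹`, the inverse of `(f * g).φ`. The order of the factors is kept, so `Ω` is
a homomorphism and not an antihomomorphism. -/
theorem nonempty_twistFunctor_mul (f g : C.Auto) :
    Nonempty (twistFunctor (f * g) ≅ twistFunctor f ⋙ twistFunctor g) :=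
  ⟨NatIso.ofComponents (fun M => RComod.isoOfBijective (M := M.twist (f * g))
      (N := (M.twist f).twist g) (RComod.twistMulHom f g M)
      (((Coring.Auto.Twist.of (f * g) M).symm.trans (Coring.Auto.Twist.of f M)).trans
        (Coring.Auto.Twist.of g (f.Twist M))).bijective)
    (fun _ => RComod.hom_ext fun _ => rfl)⟩

end twist

/-! ### The cotensor product with `_fC` is restriction along `f` -/

section twisted

variable {k : Type v} [CommRing k] {A : Type u} [Ring A] [Algebra k A] {C : Coring k A}

namespace Coring.Twisted

variable (f : C.Auto)

/-- The left linear isomorphism `c ↦ φ⁻¹(c)` from `C` to `_fC`. -/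
def θ : C ≃ₗ[A] C.Twisted f :=
  { f.φ.symm.trans (of f).toAddEquiv with
    map_smul' := fun a c => by
      change of f (f.φ.symm (a • c)) = a • of f (f.φ.symm c)
      rw [smul_of, f.φ_symm_smul] }

theorem θ_apply (c : C) : θ f c = of f (f.φ.symm c) := rfl

theorem θ_op_smul (a : A) (c : C) : θ f (op (f.ρ a) • c) = op a • θ f c := by
  rw [θ_apply, f.φ_symm_op_smul, AlgEquiv.symm_apply_apply, map_smul]
  rfl

/-- Through `θ`, `_fC` is `C` as a left comodule, and the twist moves to the right structure. This
is why `- □ _fC` is a restriction functor. -/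
theorem lcoact_θ (c : C) :
    lcoact f (θ f c) = BTensor.map LinearMap.id (θ f).toLinearMap (C.comul c) := by
  have h := (f⁻¹).comul_φ c
  change C.comul (f.φ.symm c) = _ at h
  rw [θ_apply, lcoact_of, h]
  generalize C.comul c = w
  induction w using BTensor.induction_on with
  | zero => simp only [map_zero]
  | tmul c c' =>
    change BTensor.tmul A (f.φ (f.φ.symm c)) _ = _
    rw [AddEquiv.apply_symm_apply]
    rfl
  | add x y hx hy => simp only [map_add, hx, hy]

/-- The left linear map `c ↦ ε(φ(c))`. -/
def counit : C.Twisted f →ₗ[A] A := C.counit.l ∘ₗ (θ f).symm.toLinearMap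

variable {M : Type u} [AddCommGroup M] [Module Aᵐᵒᵖ M]

/-- The map `m ⊗ c ↦ m ε(φ(c))`. -/
def γ (M : Type u) [AddCommGroup M] [Module Aᵐᵒᵖ M] : BTensor A M (C.Twisted f) →+ M :=
  BTensor.rid.comp (BTensor.map LinearMap.id (counit f))

theorem γ_tmul (m : M) (c : C.Twisted f) : γ f M (BTensor.tmul A m c) = op (counit f c) • m := rfl

theorem γ_map_θ (z : BTensor A M C) : γ f M (BTensor.map LinearMap.id (θ f).toLinearMap z) =
    BTensor.rid (BTensor.map LinearMap.id C.counit.l z) := by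
  induction z using BTensor.induction_on with
  | zero => simp only [map_zero]
  | tmul m c =>
    change op (C.counit ((θ f).symm (θ f c))) • m = op (C.counit c) • m
    rw [LinearEquiv.symm_apply_apply]
  | add x y hx hy => simp only [map_add, hx, hy]

/-- The map `C ⊗ _fC → C`, as a left linear map. -/
def γL : BTensor A C (C.Twisted f) →ₗ[A] C :=
  mkLin (γ f C) (fun a z => by
    induction z using BTensor.induction_on with
    | zero => simp only [smul_zero, map_zero]
    | tmul c c' => exact (smul_comm a (op (counit f c')) c).symm
    | add x y hx hy => simp only [smul_add, map_add, hx, hy])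

theorem γL_lcoact (c : C.Twisted f) : γL f (lcoact f c) = (θ f).symm c := by
  obtain ⟨c, rfl⟩ := (θ f).surjective c
  rw [lcoact_θ, LinearEquiv.symm_apply_apply]
  exact (γ_map_θ f (C.comul c)).trans (C.comul_counit c)

theorem coact_γ (M : RComod C) (z : BTensor A M (C.Twisted f)) :
    M.coact (γ f M z) = BTensor.map LinearMap.id (γL f)
      (BTensor.assoc (BTensor.map M.coact LinearMap.id z)) := by
  induction z using BTensor.induction_on with
  | zero => simp only [map_zero]
  | tmul m c =>
    rw [γ_tmul, BTensor.map_tmul, map_smul]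
    generalize M.coact m = w
    induction w using BTensor.induction_on with
    | zero => simp only [map_zero, smul_zero, BTensor.zero_tmul]
    | tmul m c => rfl
    | add x y hx hy => simp only [map_add, smul_add, BTensor.add_tmul, hx, hy]
  | add x y hx hy => simp only [map_add, hx, hy]

/-- Where `ω` vanishes, the coaction of `M` may be traded for the left coaction of `_fC`, which `γL`
turns into `θ⁻¹`. Hence `m ↦ m₀ ⊗ θ(m₁)` reaches every element of the cotensor product. -/
theorem map_θ_coact_γ (M : RComod C) (z : BTensor A M (C.Twisted f))
    (hz : M.omega (C.twisted f) z = 0) :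
    BTensor.map LinearMap.id (θ f).toLinearMap (M.coact (γ f M z)) = z := by
  have h : BTensor.assoc (BTensor.map M.coact LinearMap.id z) =
    BTensor.map LinearMap.id (lcoact f).l z := sub_eq_zero.1 hz
  rw [coact_γ, h, BTensor.map_map, BTensor.map_map]
  refine (BTensor.map_congr (fun _ => rfl) (fun c => ?_) z).trans (BTensor.map_id_id z)
  exact (congrArg (θ f) (γL_lcoact f c)).trans ((θ f).apply_symm_apply c)

/-- Coassociativity of `M` combined with left colinearity of `θ`. -/
theorem omega_map_θ_coact (M : RComod C) (m : M) :
    M.omega (C.twisted f) (BTensor.map LinearMap.id (θ f).toLinearMap (M.coact m)) = 0 := by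
  have h1 : BTensor.assoc (BTensor.map M.coact LinearMap.id
      (BTensor.map LinearMap.id (θ f).toLinearMap (M.coact m))) =
      BTensor.map LinearMap.id (BTensor.mapL C (θ f).toLinearMap : _ →ₗ[A] _)
        (BTensor.map LinearMap.id C.comul.l (M.coact m)) := by
    rw [← M.coassoc, ← BTensor.assoc_map_right, BTensor.map_map, BTensor.map_map]
    rfl
  have h2 : BTensor.map LinearMap.id (lcoact f).l
      (BTensor.map LinearMap.id (θ f).toLinearMap (M.coact m)) =
      BTensor.map LinearMap.id (BTensor.mapL C (θ f).toLinearMap : _ →ₗ[A] _)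
        (BTensor.map LinearMap.id C.comul.l (M.coact m)) := by
    rw [BTensor.map_map, BTensor.map_map]
    exact BTensor.map_congr (fun _ => rfl) (lcoact_θ f) _
  exact sub_eq_zero.2 (h1.trans h2.symm)

open Coring.Auto.Twist

/-- The map `m ↦ m₀ ⊗ φ⁻¹(m₁)` from the restriction of `M` along `f` to `M ⊗ _fC`. -/
def β (M : RComod C) : f.Twist M →ₗ[Aᵐᵒᵖ] BTensor A M (C.Twisted f) :=
  mkLin ((BTensor.map LinearMap.id (θ f).toLinearMap).comp (M.coact.toAddMonoidHom.comp
    (Auto.Twist.of f M).symm.toAddMonoidHom)) (fun a m => by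
    change BTensor.map LinearMap.id (θ f).toLinearMap
      (M.coact (op (f.ρ (unop a)) • (Auto.Twist.of f M).symm m)) =
      a • BTensor.map LinearMap.id (θ f).toLinearMap (M.coact ((Auto.Twist.of f M).symm m))
    rw [map_smul]
    generalize M.coact ((Auto.Twist.of f M).symm m) = w
    induction w using BTensor.induction_on with
    | zero => simp only [map_zero, smul_zero]
    | tmul m c => exact congrArg (BTensor.tmul A m) (θ_op_smul f (unop a) c)
    | add x y hx hy => simp only [map_add, smul_add, hx, hy])

theorem β_of (M : RComod C) (m : M) : β f M (Auto.Twist.of f M m) =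
    BTensor.map LinearMap.id (θ f).toLinearMap (M.coact m) := rfl

/-- Both sides are `Φ` applied to an iterated coaction of `m`, because `φ⁻¹` is compatible with
comultiplication; coassociativity of `M` identifies the two iterates. -/
theorem β_comm (M : RComod C) (m : f.Twist M) :
    BTensor.map (β f M) LinearMap.id (Auto.Twist.coact f M.coact m) =
      BTensor.coactR M (C.twisted f).coactB (β f M m) := by
  obtain ⟨m, rfl⟩ := (Auto.Twist.of f M).surjective m
  let Φ : BTensor A M (BTensor A C C) →+ BTensor A (BTensor A M (C.Twisted f)) C :=
    BTensor.assoc.symm.toAddMonoidHom.comp (BTensor.map LinearMap.id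
      (mkLin ((BTensor.map (of f).toLinearMap LinearMap.id).comp (f⁻¹).tensor) (fun a z => by
        induction z using BTensor.induction_on with
        | zero => simp only [map_zero, smul_zero]
        | tmul c c' =>
          exact congrArg (fun x => BTensor.tmul A x (f.φ.symm c')) ((θ f).map_smul a c)
        | add x y hx hy => simp only [map_add, smul_add, hx, hy]) :
          BTensor A C C →ₗ[A] BTensor A (C.Twisted f) C))
  have h1 : ∀ z : BTensor A M C, BTensor.map (β f M) LinearMap.id (τ f M z) =
      Φ (BTensor.assoc (BTensor.map M.coact LinearMap.id z)) := by
    intro z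
    induction z using BTensor.induction_on with
    | zero => simp only [map_zero]
    | tmul m c =>
      rw [τ_tmul, BTensor.map_tmul, BTensor.map_tmul, β_of]
      generalize M.coact m = w
      induction w using BTensor.induction_on with
      | zero => simp only [map_zero, BTensor.zero_tmul]
      | tmul m c => exact (BTensor.assoc_symm_tmul _ _ _).symm
      | add x y hx hy => simp only [map_add, BTensor.add_tmul, hx, hy]
    | add x y hx hy => simp only [map_add, hx, hy]
  let ρ : BimodHom A A (C.Twisted f) (BTensor A (C.Twisted f) C) := (C.twisted f).coactB
  have h2 : ∀ z : BTensor A M C, BTensor.coactR M ρ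
      (BTensor.map LinearMap.id (θ f).toLinearMap z) = Φ (BTensor.map LinearMap.id C.comul.l z) := by
    intro z
    induction z using BTensor.induction_on with
    | zero => simp only [map_zero]
    | tmul m c =>
      exact congrArg (fun w => BTensor.assoc.symm (BTensor.tmul A m
        (BTensor.map (of f).toLinearMap LinearMap.id w))) ((f⁻¹).comul_φ c)
    | add x y hx hy => simp only [map_add, hx, hy]
  rw [Auto.Twist.coact_of, h1, β_of, M.coassoc]
  exact (h2 _).symm

/-- The map `m ↦ m₀ ⊗ φ⁻¹(m₁)` as a morphism of comodules. -/
def βHom (M : RComod C) : M.twist f ⟶ RComod.tensor M (C.twisted f) where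
  lin := (β f M : f.Twist M →ₗ[Aᵐᵒᵖ] BTensor A M (C.Twisted f))
  comm := β_comm f M

end Coring.Twisted

open Coring.Twisted in
/-- The cotensor product with `_fC` is the restriction along `f`. -/
theorem nonempty_twistFunctor_iso [C.IsFlat] (f : C.Auto) :
    Nonempty (twistFunctor f ≅ cotensorFunctor (C.twisted f)) := by
  have hγ : ∀ (M : RComod C) (m : M), γ f M (β f M (Coring.Auto.Twist.of f M m)) = m := fun M m =>
    (γ_map_θ f (M.coact m)).trans (M.coact_counit m)
  refine RComod.nonempty_natIso Coring.IsFlat.left (fun M => RComod.tensor M (C.twisted f))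
    (fun q => (RComod.tensorMap q.lin (C.twisted f)).lin) (βHom f)
    (fun M => RComod.cotensorIncl M (C.twisted f)) (fun M => ?_)
    (fun M => M.cotensorι_injective (C.twisted f)) (fun M (m : f.Twist M) => ?_)
    (fun M (z : M.cotensor (C.twisted f)) => ?_)
    (fun {M N} q (m : f.Twist M) => ?_) (fun {M N} q x => rfl)
  · exact Function.LeftInverse.injective (hγ M)
  · exact ⟨⟨β f M m, omega_map_θ_coact f M m⟩, rfl⟩
  · exact ⟨Coring.Auto.Twist.of f M (γ f M (M.cotensorι (C.twisted f) z)),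
      map_θ_coact_γ f M _ (M.omega_cotensorι (C.twisted f) z)⟩
  · obtain ⟨m, rfl⟩ := (Coring.Auto.Twist.of f M).surjective m
    change BTensor.map LinearMap.id (θ f).toLinearMap (N.coact (q.lin m)) =
      BTensor.map q.lin LinearMap.id (BTensor.map LinearMap.id (θ f).toLinearMap (M.coact m))
    rw [← q.comm, BTensor.map_map, BTensor.map_map]
    rfl

/-- The bicomodule `_1C` is `C`. -/
theorem Coring.nonempty_twisted_one_iso (C : Coring k A) :
    Nonempty (C.twisted 1 ≅ C.regular) := by
  have hr : ∀ w : BTensor A (C.Twisted 1) C, BTensor.map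
      ((Coring.Twisted.of 1).symm.toLinearMap : C.Twisted 1 →ₗ[Aᵐᵒᵖ] C) LinearMap.id
      (BTensor.map (Coring.Twisted.of 1).toLinearMap LinearMap.id
      (BTensor.map ((Coring.Twisted.of 1).symm.toLinearMap : C.Twisted 1 →ₗ[Aᵐᵒᵖ] C)
        LinearMap.id w)) = BTensor.map
      ((Coring.Twisted.of 1).symm.toLinearMap : C.Twisted 1 →ₗ[Aᵐᵒᵖ] C) LinearMap.id w := fun w => by
    rw [BTensor.map_map, BTensor.map_map]; rfl
  refine ⟨Bicomod.isoOfBijective (X := C.twisted 1) (Y := C.regular)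
    { lin := ((Coring.Twisted.of 1).symm.toLinearMap : C.Twisted 1 →ₗ[Aᵐᵒᵖ] C)
      comm := fun (m : C.Twisted 1) => ?_
      map_smul := fun _ _ => rfl
      lcomm := fun (m : C.Twisted 1) => ?_ } (Coring.Twisted.of 1).symm.bijective⟩
  · obtain ⟨c, rfl⟩ := (Coring.Twisted.of (1 : C.Auto)).surjective m
    change BTensor.map ((Coring.Twisted.of 1).symm.toLinearMap : C.Twisted 1 →ₗ[Aᵐᵒᵖ] C)
      LinearMap.id (BTensor.map (Coring.Twisted.of 1).toLinearMap LinearMap.id (C.comul c)) =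
      C.comul c
    rw [BTensor.map_map]
    exact BTensor.map_id_id _
  · obtain ⟨c, rfl⟩ := (Coring.Twisted.of (1 : C.Auto)).surjective m
    change BTensor.map LinearMap.id (mkLin _ _ : C.Twisted 1 →ₗ[A] C)
      (Coring.Twisted.twist 1 (C.comul c)) = C.comul c
    generalize C.comul c = w
    induction w using BTensor.induction_on with
    | zero => simp only [map_zero]
    | tmul m n => rfl
    | add x y hx hy => simp only [map_add, hx, hy]

variable [C.IsFlat]

/-- The unit law is the case `f = 1` of the description of `- □ _fC`. -/
theorem nonempty_cotensorFunctor_regular : Nonempty (cotensorFunctor C.regular ≅ 𝟭 (RComod C)) := by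
  obtain ⟨e⟩ := C.nonempty_twisted_one_iso
  obtain ⟨e₁⟩ := cotensorFunctor_congr e
  obtain ⟨e₂⟩ := nonempty_twistFunctor_iso (1 : C.Auto)
  obtain ⟨e₃⟩ := nonempty_twistFunctor_one (C := C)
  exact ⟨e₁.symm ≪≫ e₂.symm ≪≫ e₃⟩

theorem nonempty_cotensorFunctor_twisted_mul (f g : C.Auto) :
    Nonempty (cotensorFunctor (C.twisted (f * g)) ≅
      cotensorFunctor (C.twisted f) ⋙ cotensorFunctor (C.twisted g)) := by
  obtain ⟨e⟩ := nonempty_twistFunctor_mul f g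
  obtain ⟨e₁⟩ := nonempty_twistFunctor_iso f
  obtain ⟨e₂⟩ := nonempty_twistFunctor_iso g
  obtain ⟨e₃⟩ := nonempty_twistFunctor_iso (f * g)
  exact ⟨e₃.symm ≪≫ e ≪≫ Functor.isoWhiskerRight e₁ _ ≪≫ Functor.isoWhiskerLeft _ e₂⟩

theorem Coring.regular_isRightInvertible : C.regular.IsRightInvertible := by
  obtain ⟨e⟩ := nonempty_cotensorFunctor_regular (C := C)
  exact Functor.isEquivalence_of_iso e.symm

theorem nonempty_cotensorFunctor_twisted_comp (f g : C.Auto) (h : f * g = 1) :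
    Nonempty (cotensorFunctor (C.twisted f) ⋙ cotensorFunctor (C.twisted g) ≅ 𝟭 (RComod C)) := by
  obtain ⟨e⟩ := nonempty_cotensorFunctor_twisted_mul f g
  rw [h] at e
  obtain ⟨e'⟩ := C.nonempty_twisted_one_iso
  obtain ⟨e₁⟩ := cotensorFunctor_congr e'
  obtain ⟨e₂⟩ := nonempty_cotensorFunctor_regular (C := C)
  exact ⟨e.symm ≪≫ e₁ ≪≫ e₂⟩

/-- The functor of `f⁻¹` is a quasi-inverse. -/
theorem Coring.twisted_isRightInvertible (f : C.Auto) : (C.twisted f).IsRightInvertible := by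
  obtain ⟨e⟩ := nonempty_cotensorFunctor_twisted_comp f f⁻¹ (mul_inv_cancel f)
  obtain ⟨e'⟩ := nonempty_cotensorFunctor_twisted_comp f⁻¹ f (inv_mul_cancel f)
  exact (CategoryTheory.Equivalence.mk _ _ e.symm e').isEquivalence_functor

end twisted

/-- Inner automorphisms are defined by an identity on expressions for `Δ(c)`, so at least one such
expression has to be available. -/
theorem BTensor.exists_eq_sum {A : Type u} [Ring A] {M N : Type u} [AddCommGroup M] [Module Aᵐᵒᵖ M]
    [AddCommGroup N] [Module A N] (z : BTensor A M N) :
    ∃ (n : ℕ) (x : Fin n → M) (y : Fin n → N), z = ∑ i, BTensor.tmul A (x i) (y i) := by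
  induction z using BTensor.induction_on with
  | zero => exact ⟨0, Fin.elim0, Fin.elim0, by simp⟩
  | tmul m n => exact ⟨1, fun _ => m, fun _ => n, by simp⟩
  | add z w hz hw =>
    obtain ⟨n, x, y, rfl⟩ := hz
    obtain ⟨n', x', y', rfl⟩ := hw
    exact ⟨n + n', Fin.append x x', Fin.append y y', by simp [Fin.sum_univ_add]⟩

/-! ### The dual ring `C*` and inner automorphisms -/

section inner

variable {k : Type v} [CommRing k] {A : Type u} [Ring A] [Algebra k A] {C : Coring k A}

namespace Coring

section dual

variable (p q : C →ₗ[Aᵐᵒᵖ] A)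

theorem dualAct_apply (c : C) :
    C.dualAct p c = BTensor.lid (BTensor.map p LinearMap.id (C.comul c)) := rfl

theorem dualAct_eq_sum {c : C} {n : ℕ} {x y : Fin n → C}
    (h : C.comul c = ∑ i, BTensor.tmul A (x i) (y i)) : C.dualAct p c = ∑ i, p (x i) • y i := by
  rw [dualAct_apply, h, map_sum, map_sum]
  rfl

/-- The action of `C*` on `C` is right colinear. -/
theorem comul_dualAct (c : C) :
    C.comul (C.dualAct p c) = BTensor.map (C.dualAct p) LinearMap.id (C.comul c) := by
  have h1 : ∀ z : BTensor A C C, C.comul (BTensor.lid (BTensor.map p LinearMap.id z)) =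
      BTensor.lid (BTensor.map p LinearMap.id (BTensor.map LinearMap.id C.comul.l z)) := by
    intro z
    induction z using BTensor.induction_on with
    | zero => simp only [map_zero]
    | tmul x y => exact C.comul.apply_smul _ _
    | add x y hx hy => simp only [map_add, hx, hy]
  have h2 : ∀ z : BTensor A C C, BTensor.lid (BTensor.map p LinearMap.id
      (BTensor.assoc (BTensor.map C.comul.r LinearMap.id z))) =
      BTensor.map (C.dualAct p) LinearMap.id z := by
    intro z
    induction z using BTensor.induction_on with
    | zero => simp only [map_zero]
    | tmul x y =>
      rw [BTensor.map_tmul, BTensor.map_tmul, dualAct_apply, BimodHom.r_apply]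
      generalize C.comul x = w
      induction w using BTensor.induction_on with
      | zero => simp only [map_zero, BTensor.zero_tmul]
      | tmul x y => rfl
      | add x y hx hy => simp only [map_add, BTensor.add_tmul, hx, hy]
    | add x y hx hy => simp only [map_add, hx, hy]
  rw [← h2, C.coassoc, ← h1]
  rfl

/-- Right colinearity of the action of `p` turns the product of `C*` into composition in the
opposite order. -/
theorem dualAct_dualMul (c : C) : C.dualAct (C.dualMul p q) c = C.dualAct q (C.dualAct p c) := by
  rw [C.dualAct_apply q, comul_dualAct, BTensor.map_map]
  rfl

theorem dualAct_counit (c : C) : C.dualAct C.counit.r c = c := C.counit_comul c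

/-- The action determines `p`. Together with `dualAct_counit_comp` this identifies `C*` with the
right colinear endomorphisms of `C`, with products reversed. -/
theorem counit_dualAct (c : C) : C.counit (C.dualAct p c) = p c := by
  have h : ∀ z : BTensor A C C, C.counit (BTensor.lid (BTensor.map p LinearMap.id z)) =
      p (BTensor.rid (BTensor.map LinearMap.id C.counit.l z)) := by
    intro z
    induction z using BTensor.induction_on with
    | zero => simp only [map_zero]
    | tmul x y =>
      change C.counit (p x • y) = p (op (C.counit y) • x)
      rw [C.counit.apply_smul, p.map_smul]
      rfl
    | add x y hx hy => simp only [map_add, hx, hy]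
  rw [dualAct_apply, h, C.comul_counit]

/-- A right colinear endomorphism is given by the action of an element of `C*`. -/
theorem dualAct_counit_comp (h : C →ₗ[Aᵐᵒᵖ] C)
    (hc : ∀ c, BTensor.map h LinearMap.id (C.comul c) = C.comul (h c)) (c : C) :
    C.dualAct (C.counit.r ∘ₗ h) c = h c := by
  refine Eq.trans ?_ (C.counit_comul (h c))
  rw [← hc, BTensor.map_map]
  rfl

variable {p} in
theorem IsInvertibleDual.dualAct_bijective (hp : C.IsInvertibleDual p) :
    Function.Bijective (C.dualAct p) := by
  obtain ⟨q, hpq, hqp⟩ := hp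
  refine Function.bijective_iff_has_inverse.2 ⟨C.dualAct q, fun c => ?_, fun c => ?_⟩
  · rw [← dualAct_dualMul, hpq, dualAct_counit]
  · rw [← dualAct_dualMul, hqp, dualAct_counit]

end dual

/-- On underlying right comodules the isomorphism is a colinear automorphism `h` of `C`, hence the
action of `p = ε ∘ h`; the inverse of `p` is `ε ∘ h⁻¹`. -/
theorem mem_rInn_of_iso {f : C.Auto} (e : C.twisted f ≅ C.regular) : f ∈ C.rInn := by
  let h : C →ₗ[Aᵐᵒᵖ] C := (e.hom.lin : C.Twisted f →ₗ[Aᵐᵒᵖ] C) ∘ₗ (Twisted.of f).toLinearMap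
  let h' : C →ₗ[Aᵐᵒᵖ] C := (Twisted.of f).symm.toLinearMap ∘ₗ (e.inv.lin : C →ₗ[Aᵐᵒᵖ] C.Twisted f)
  have hh' : ∀ c, h (h' c) = c := fun c => Bicomod.inv_hom_lin e c
  have hh : ∀ c, h' (h c) = c := fun c => Bicomod.hom_inv_lin e (Twisted.of f c)
  have hc : ∀ c, BTensor.map h LinearMap.id (C.comul c) = C.comul (h c) := fun c => by
    refine Eq.trans ?_ (e.hom.comm (Twisted.of f c))
    exact (BTensor.map_map (Twisted.of f).toLinearMap LinearMap.id
      (e.hom.lin : C.Twisted f →ₗ[Aᵐᵒᵖ] C) LinearMap.id (C.comul c)).symm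
  have hc' : ∀ c, BTensor.map h' LinearMap.id (C.comul c) = C.comul (h' c) := fun c => by
    have := hc (h' c)
    rw [hh'] at this
    rw [← this, BTensor.map_map]
    exact (BTensor.map_congr hh (fun _ => rfl) _).trans (BTensor.map_id_id _)
  refine ⟨C.counit.r ∘ₗ h, ⟨C.counit.r ∘ₗ h', LinearMap.ext fun c => ?_,
    LinearMap.ext fun c => ?_⟩, fun c n x y hxy => ?_⟩
  · exact congrArg C.counit ((congrArg h' (dualAct_counit_comp h hc c)).trans (hh c))
  · exact congrArg C.counit ((congrArg h (dualAct_counit_comp h' hc' c)).trans (hh' c))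
  -- `K` is `x ⊗ y ↦ φ(x) p(y)`, well defined because `h` is left linear on `_fC`. Applying `C ⊗ ε`
  -- to left colinearity gives `K (Δ c) = h c`, hence the identity for every expression of `Δ c` at
  -- once.
  · let K : BTensor A C C →+ C := BTensor.rid.comp ((BTensor.map LinearMap.id C.counit.l).comp
      ((BTensor.map LinearMap.id (Bicomod.homL e.hom : C.Twisted f →ₗ[A] C)).comp
        (Twisted.twist f)))
    have h1 : BTensor.map LinearMap.id (Bicomod.homL e.hom : C.Twisted f →ₗ[A] C)
      (Twisted.twist f (C.comul c)) = C.comul (h c) := e.hom.lcomm (Twisted.of f c)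
    have h2 : K (C.comul c) = h c :=
      (congrArg (fun z => BTensor.rid (BTensor.map LinearMap.id C.counit.l z)) h1).trans
        (C.comul_counit (h c))
    rw [← dualAct_eq_sum _ hxy, dualAct_counit_comp h hc, ← h2, hxy, map_sum]
    rfl

section inner

variable {f : C.Auto} {p : C →ₗ[Aᵐᵒᵖ] A}
  (h : ∀ (c : C) (n : ℕ) (x y : Fin n → C), C.comul c = ∑ i, BTensor.tmul A (x i) (y i) →
      ∑ i, op (p (y i)) • f.φ (x i) = ∑ i, p (x i) • y i)

include h

/-- Passing from `c` to `a c` multiplies each `xᵢ` by `a`, and the side of `h` that contains `φ(xᵢ)`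
then acquires the factor `ρ(a)`. -/
theorem dualAct_smul (a : A) (c : C) : C.dualAct p (a • c) = f.ρ a • C.dualAct p c := by
  obtain ⟨n, x, y, hxy⟩ := BTensor.exists_eq_sum (C.comul c)
  have hxy' : C.comul (a • c) = ∑ i, BTensor.tmul A (a • x i) (y i) := by
    rw [C.comul.apply_smul, hxy, Finset.smul_sum]
    rfl
  rw [dualAct_eq_sum p hxy, dualAct_eq_sum p hxy', ← h c n x y hxy, ← h _ n _ y hxy',
    Finset.smul_sum]
  refine Finset.sum_congr rfl fun i _ => ?_
  rw [f.map_smul]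
  exact (smul_comm (f.ρ a) (op (p (y i))) (f.φ (x i))).symm

/-- The action of `p`, as a left linear map on `_fC`. -/
def dualActTwistedL : C.Twisted f →ₗ[A] C :=
  mkLin ((C.dualAct p).toAddMonoidHom.comp (Twisted.of f).symm.toLinearMap.toAddMonoidHom)
    (fun a c => by
      refine (dualAct_smul h (f.ρ.symm a) ((Twisted.of f).symm c)).trans ?_
      rw [AlgEquiv.apply_symm_apply]
      rfl)

/-- The map `x ⊗ y ↦ φ(x) p(y)`. -/
def twistMul : BTensor A C C →ₗ[Aᵐᵒᵖ] C :=
  -- A map `x ⊗ y ↦ φ(x) p(y)` is balanced only if `p(a y) = ρ(a) p(y)`. This holds since `p = ε ∘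
  -- dualAct p` and `dualAct p` is left linear on `_fC`, hence the detour through `dualActTwistedL`.
  mkLin (BTensor.rid.comp ((BTensor.map LinearMap.id (C.counit.l ∘ₗ dualActTwistedL h)).comp
    (Twisted.twist f))) (fun a z => by
      induction z using BTensor.induction_on with
      | zero => simp only [smul_zero, map_zero]
      | tmul x y =>
        change op (C.counit (C.dualAct p (a • y))) • f.φ x =
          a • op (C.counit (C.dualAct p y)) • f.φ x
        rw [(C.dualAct p).map_smul, C.counit.apply_op_smul, smul_smul]
        rfl
      | add x y hx hy => simp only [smul_add, map_add, hx, hy])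

theorem twistMul_tmul (x y : C) : twistMul h (BTensor.tmul A x y) = op (p y) • f.φ x := by
  rw [← counit_dualAct p y]
  rfl

theorem twistMul_comul (c : C) : twistMul h (C.comul c) = C.dualAct p c := by
  obtain ⟨n, x, y, hxy⟩ := BTensor.exists_eq_sum (C.comul c)
  rw [dualAct_eq_sum p hxy, ← h c n x y hxy, hxy, map_sum]
  exact Finset.sum_congr rfl fun i _ => twistMul_tmul h _ _

/-- In iterated notation, `φ(c₁) ⊗ p(c₂) c₃ = φ(c₁) p(c₂) ⊗ c₃ = p(c₁) c₂ ⊗ c₃`. The second equality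
is the inner identity, and the last term is the comultiplication of `p(c₁) c₂` by right colinearity.
-/
theorem map_dualActTwistedL (c : C) :
    BTensor.map LinearMap.id (dualActTwistedL h) (Twisted.twist f (C.comul c)) =
      C.comul (C.dualAct p c) := by
  have h1 : ∀ z : BTensor A C C,
      BTensor.map LinearMap.id (dualActTwistedL h) (Twisted.twist f z) =
      BTensor.map (twistMul h) LinearMap.id
        (BTensor.assoc.symm (BTensor.map LinearMap.id C.comul.l z)) := by
    intro z
    induction z using BTensor.induction_on with
    | zero => simp only [map_zero]
    | tmul x y =>
      change BTensor.tmul A (f.φ x) (C.dualAct p y) = BTensor.map (twistMul h) LinearMap.id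
        (BTensor.assoc.symm (BTensor.tmul A x (C.comul y)))
      rw [dualAct_apply]
      generalize C.comul y = w
      induction w using BTensor.induction_on with
      | zero => simp only [map_zero, BTensor.tmul_zero]
      | tmul y z =>
        rw [BTensor.assoc_symm_tmul, BTensor.map_tmul, BTensor.map_tmul, twistMul_tmul,
          BTensor.op_smul_tmul]
        rfl
      | add x y hx hy => simp only [map_add, BTensor.tmul_add, hx, hy]
    | add x y hx hy => simp only [map_add, hx, hy]
  rw [h1, ← C.coassoc, AddEquiv.symm_apply_apply, BTensor.map_map, comul_dualAct]
  exact BTensor.map_congr (twistMul_comul h) (fun _ => rfl) _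

end inner

theorem nonempty_iso_of_mem_rInn {f : C.Auto} (hf : f ∈ C.rInn) :
    Nonempty (C.twisted f ≅ C.regular) := by
  obtain ⟨p, hp, h⟩ := hf
  refine ⟨Bicomod.isoOfBijective (X := C.twisted f) (Y := C.regular)
    { lin := (C.dualAct p ∘ₗ (Twisted.of f).symm.toLinearMap : C.Twisted f →ₗ[Aᵐᵒᵖ] C)
      comm := fun (m : C.Twisted f) => ?_
      map_smul := (dualActTwistedL h).map_smul
      lcomm := fun (m : C.Twisted f) => ?_ }
      (hp.dualAct_bijective.comp (Twisted.of f).symm.bijective)⟩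
  · obtain ⟨c, rfl⟩ := (Twisted.of f).surjective m
    refine Eq.trans ?_ (comul_dualAct p c).symm
    exact BTensor.map_map (Twisted.of f).toLinearMap LinearMap.id
      (C.dualAct p ∘ₗ (Twisted.of f).symm.toLinearMap) LinearMap.id (C.comul c)
  · obtain ⟨c, rfl⟩ := (Twisted.of f).surjective m
    exact map_dualActTwistedL h c

theorem mem_rInn_iff {f : C.Auto} : f ∈ C.rInn ↔ Nonempty (C.twisted f ≅ C.regular) :=
  ⟨nonempty_iso_of_mem_rInn, fun ⟨e⟩ => mem_rInn_of_iso e⟩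

end Coring

end inner

/-! ### The right Picard group, the homomorphism `Ω` and Morita–Takeuchi invariance -/

section inverse

variable {k : Type v} [CommRing k] {A B : Type u} [Ring A] [Algebra k A] [Ring B] [Algebra k B]
  {C : Coring k A} {D : Coring k B} [C.IsFlat] [D.IsFlat]

/-- Only `Y □ X ≅ D` is known from the construction of `Y`. As `- □ X` is an equivalence, this
forces `- □ Y` to be a quasi-inverse of it, so `Y` is right invertible and the other composite is
the identity as well. -/
theorem Bicomod.IsRightInvertible.exists_inverse {X : Bicomod C D} (hX : X.IsRightInvertible) :
    ∃ Y : Bicomod D C, Y.IsRightInvertible ∧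
      Nonempty (cotensorFunctor Y ⋙ cotensorFunctor X ≅ 𝟭 (RComod D)) ∧
      Nonempty (cotensorFunctor X ⋙ cotensorFunctor Y ≅ 𝟭 (RComod C)) := by
  obtain ⟨Y, ⟨e⟩⟩ := hX.exists_nonempty_regular_iso
  obtain ⟨e₁⟩ := cotensorFunctor_congr e
  obtain ⟨e₂⟩ := hX.cotensorFunctor_cotensor Y
  obtain ⟨e₃⟩ := nonempty_cotensorFunctor_regular (C := D)
  have e₄ : cotensorFunctor Y ⋙ cotensorFunctor X ≅ 𝟭 (RComod D) := e₂.symm ≪≫ e₁.symm ≪≫ e₃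
  have : (cotensorFunctor X).IsEquivalence := hX
  have e₅ : cotensorFunctor Y ≅ (cotensorFunctor X).inv :=
    (Functor.rightUnitor _).symm ≪≫
      Functor.isoWhiskerLeft (cotensorFunctor Y) (cotensorFunctor X).asEquivalence.unitIso ≪≫
      (Functor.associator _ _ _).symm ≪≫
      Functor.isoWhiskerRight e₄ (cotensorFunctor X).inv ≪≫ Functor.leftUnitor _
  exact ⟨Y, Functor.isEquivalence_of_iso e₅.symm, ⟨e₄⟩,
    ⟨Functor.isoWhiskerLeft _ e₅ ≪≫ (cotensorFunctor X).asEquivalence.unitIso.symm⟩⟩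

namespace Coring.RPic

/-- This allows identities in the Picard group to be checked on cotensor functors. -/
theorem mk_eq_mk {X Y : Bicomod C C} {hX : X.IsRightInvertible} {hY : Y.IsRightInvertible} :
    RPic.mk X hX = RPic.mk Y hY ↔ Nonempty (cotensorFunctor X ≅ cotensorFunctor Y) :=
  (Quotient.eq (r := C.rPicSetoid)).trans
    ⟨fun ⟨e⟩ => cotensorFunctor_congr e, fun ⟨e⟩ => Bicomod.nonempty_iso_of_natIso e⟩

@[elab_as_elim]
theorem ind {motive : C.RPic → Prop}
    (h : ∀ (X : Bicomod C C) (hX : X.IsRightInvertible), motive (RPic.mk X hX)) (x : C.RPic) :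
    motive x :=
  Quotient.ind (fun X => h X.1 X.2) x

/-- The unit of the right Picard group. -/
@[reducible] def instOne : One C.RPic := ⟨RPic.mk C.regular C.regular_isRightInvertible⟩

/-- The product of the right Picard group. -/
@[reducible] def instMul : Mul C.RPic :=
  ⟨Quotient.map₂ (sa := C.rPicSetoid) (sb := C.rPicSetoid) (sc := C.rPicSetoid)
    (fun X Y => ⟨X.1.cotensor Y.1, X.2.cotensor Y.2⟩) (fun X X' hX Y Y' hY => by
      obtain ⟨e⟩ := cotensorFunctor_congr hX.some
      obtain ⟨e'⟩ := cotensorFunctor_congr hY.some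
      obtain ⟨e₁⟩ := Y.2.cotensorFunctor_cotensor X.1
      obtain ⟨e₂⟩ := Y'.2.cotensorFunctor_cotensor X'.1
      exact Bicomod.nonempty_iso_of_natIso (e₁ ≪≫ Functor.isoWhiskerRight e _ ≪≫
        Functor.isoWhiskerLeft _ e' ≪≫ e₂.symm))⟩

attribute [local instance] instOne instMul

theorem mk_mul_mk {X Y : Bicomod C C} (hX : X.IsRightInvertible) (hY : Y.IsRightInvertible) :
    RPic.mk X hX * RPic.mk Y hY = RPic.mk (X.cotensor Y) (hX.cotensor hY) := rfl

theorem mk_mul_mk_eq_iff {X Y Z : Bicomod C C} {hX : X.IsRightInvertible}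
    {hY : Y.IsRightInvertible} {hZ : Z.IsRightInvertible} :
    RPic.mk X hX * RPic.mk Y hY = RPic.mk Z hZ ↔
      Nonempty (cotensorFunctor X ⋙ cotensorFunctor Y ≅ cotensorFunctor Z) := by
  obtain ⟨e⟩ := hY.cotensorFunctor_cotensor X
  rw [mk_mul_mk, mk_eq_mk]
  exact ⟨fun ⟨e'⟩ => ⟨e.symm ≪≫ e'⟩, fun ⟨e'⟩ => ⟨e ≪≫ e'⟩⟩

theorem exists_mul_eq_one (x : C.RPic) : ∃ y : C.RPic, y * x = 1 := by
  induction x using ind with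
  | h X hX =>
    obtain ⟨Y, hY, ⟨e⟩, -⟩ := hX.exists_inverse
    obtain ⟨e'⟩ := nonempty_cotensorFunctor_regular (C := C)
    exact ⟨RPic.mk Y hY, mk_mul_mk_eq_iff.2 ⟨e ≪≫ e'.symm⟩⟩

/-- The inverse of the right Picard group. -/
@[reducible] def instInv : Inv C.RPic := ⟨fun x => (exists_mul_eq_one x).choose⟩

attribute [local instance] instInv

/-- Associativity is that of composition of functors; no isomorphism of bicomodules has to be
written down. -/
theorem mul_assoc' (x y z : C.RPic) : x * y * z = x * (y * z) := by
  induction x using ind with | h X hX => ?_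
  induction y using ind with | h Y hY => ?_
  induction z using ind with | h Z hZ => ?_
  obtain ⟨e₁⟩ := hY.cotensorFunctor_cotensor X
  obtain ⟨e₂⟩ := hZ.cotensorFunctor_cotensor Y
  obtain ⟨e₃⟩ := (hY.cotensor hZ).cotensorFunctor_cotensor X
  rw [mk_mul_mk hX hY, mk_mul_mk hY hZ, mk_mul_mk hX]
  exact mk_mul_mk_eq_iff.2 ⟨Functor.isoWhiskerRight e₁ _ ≪≫ Functor.associator _ _ _ ≪≫
    Functor.isoWhiskerLeft _ e₂.symm ≪≫ e₃.symm⟩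

theorem one_mul' (x : C.RPic) : 1 * x = x := by
  induction x using ind with | h X hX => ?_
  obtain ⟨e⟩ := nonempty_cotensorFunctor_regular (C := C)
  exact mk_mul_mk_eq_iff.2 ⟨Functor.isoWhiskerRight e _ ≪≫ Functor.leftUnitor _⟩

/-- The right Picard group of `C`. -/
@[reducible] def group (C : Coring k A) [C.IsFlat] : Group C.RPic :=
  Group.ofLeftAxioms mul_assoc' one_mul' (fun x => (exists_mul_eq_one x).choose_spec)

theorem isCotensorGroup (C : Coring k A) [C.IsFlat] : C.IsCotensorGroup (group C) :=
  ⟨fun _ _ hX hY => ⟨hX.cotensor hY, rfl⟩, C.regular_isRightInvertible, rfl⟩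

attribute [local instance] group

/-- The homomorphism from the automorphism group of `C` to the right Picard group. -/
def ofAuto (C : Coring k A) [C.IsFlat] : C.Auto →* C.RPic :=
  MonoidHom.mk' (fun f => RPic.mk (C.twisted f) (C.twisted_isRightInvertible f)) (fun f g => by
    obtain ⟨e⟩ := nonempty_cotensorFunctor_twisted_mul f g
    exact (mk_mul_mk_eq_iff.2 ⟨e.symm⟩).symm)

/-- The class of `_fC` is trivial exactly when `_fC ≅ C`, and `mem_rInn_iff` applies. In particular
`Inn_r` is a normal subgroup, being a kernel. -/
theorem coe_ker_ofAuto (C : Coring k A) [C.IsFlat] :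
    ((ofAuto C).ker : Set C.Auto) = C.rInn := by
  ext f
  refine MonoidHom.mem_ker.trans ((Quotient.eq (r := C.rPicSetoid)).trans ?_)
  exact mem_rInn_iff.symm

theorem nonempty_cotensorFunctor_conj {X : Bicomod C D} (hX : X.IsRightInvertible)
    (Y : Bicomod D C) {Z : Bicomod C C} (hZ : Z.IsRightInvertible) :
    Nonempty (cotensorFunctor ((Y.cotensor Z).cotensor X) ≅
      cotensorFunctor Y ⋙ cotensorFunctor Z ⋙ cotensorFunctor X) := by
  obtain ⟨e⟩ := hX.cotensorFunctor_cotensor (Y.cotensor Z)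
  obtain ⟨e'⟩ := hZ.cotensorFunctor_cotensor Y
  exact ⟨e ≪≫ Functor.isoWhiskerRight e' _ ≪≫ Functor.associator _ _ _⟩

/-- The map `(Z) ↦ (Y □ Z □ X)`. -/
def conj {X : Bicomod C D} (hX : X.IsRightInvertible) {Y : Bicomod D C}
    (hY : Y.IsRightInvertible) : C.RPic → D.RPic :=
  Quotient.map (sa := C.rPicSetoid) (sb := D.rPicSetoid)
    (fun Z => ⟨(Y.cotensor Z.1).cotensor X, (hY.cotensor Z.2).cotensor hX⟩) (fun Z Z' h => by
      obtain ⟨e⟩ := cotensorFunctor_congr h.some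
      obtain ⟨e₁⟩ := nonempty_cotensorFunctor_conj hX Y Z.2
      obtain ⟨e₂⟩ := nonempty_cotensorFunctor_conj hX Y Z'.2
      exact Bicomod.nonempty_iso_of_natIso (e₁ ≪≫ Functor.isoWhiskerLeft _
        (Functor.isoWhiskerRight e _) ≪≫ e₂.symm))

theorem conj_mk {X : Bicomod C D} (hX : X.IsRightInvertible) {Y : Bicomod D C}
    (hY : Y.IsRightInvertible) {Z : Bicomod C C} (hZ : Z.IsRightInvertible) :
    conj hX hY (RPic.mk Z hZ) =
      RPic.mk ((Y.cotensor Z).cotensor X) ((hY.cotensor hZ).cotensor hX) := rfl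

/-- Conjugating twice puts the functor of `Z` between two copies of a composite that is isomorphic
to the identity. -/
theorem conj_conj {X : Bicomod C D} (hX : X.IsRightInvertible) {Y : Bicomod D C}
    (hY : Y.IsRightInvertible) (e : cotensorFunctor X ⋙ cotensorFunctor Y ≅ 𝟭 (RComod C))
    (x : C.RPic) : conj hY hX (conj hX hY x) = x := by
  induction x using ind with | h Z hZ => ?_
  obtain ⟨e₁⟩ := nonempty_cotensorFunctor_conj hX Y hZ
  obtain ⟨e₂⟩ := nonempty_cotensorFunctor_conj hY X ((hY.cotensor hZ).cotensor hX)
  rw [conj_mk, conj_mk, mk_eq_mk]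
  let P := cotensorFunctor X
  let Q := cotensorFunctor Y
  let R := cotensorFunctor Z
  -- Composites of functors that differ only in their bracketing are definitionally equal.
  have e₃ : P ⋙ (Q ⋙ R ⋙ P) ⋙ Q ≅ (P ⋙ Q) ⋙ R ⋙ (P ⋙ Q) := Iso.refl _
  have e₄ : (P ⋙ Q) ⋙ R ⋙ (P ⋙ Q) ≅ R :=
    Functor.isoWhiskerRight e _ ≪≫ Functor.leftUnitor _ ≪≫ Functor.isoWhiskerLeft R e ≪≫
      Functor.rightUnitor R
  exact ⟨e₂ ≪≫ Functor.isoWhiskerLeft P (Functor.isoWhiskerRight e₁ Q) ≪≫ e₃ ≪≫ e₄⟩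

/-- In the product of the two conjugates, the functors of `X` and `Y` meet in the middle and cancel
by `e`. -/
theorem conj_mul {X : Bicomod C D} (hX : X.IsRightInvertible) {Y : Bicomod D C}
    (hY : Y.IsRightInvertible) (e : cotensorFunctor X ⋙ cotensorFunctor Y ≅ 𝟭 (RComod C))
    (x y : C.RPic) : conj hX hY (x * y) = conj hX hY x * conj hX hY y := by
  induction x using ind with | h Z hZ => ?_
  induction y using ind with | h W hW => ?_
  obtain ⟨e₁⟩ := nonempty_cotensorFunctor_conj hX Y hZ
  obtain ⟨e₂⟩ := nonempty_cotensorFunctor_conj hX Y hW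
  obtain ⟨e₃⟩ := nonempty_cotensorFunctor_conj hX Y (hZ.cotensor hW)
  obtain ⟨e₄⟩ := hW.cotensorFunctor_cotensor Z
  rw [mk_mul_mk, conj_mk, conj_mk, conj_mk, eq_comm, mk_mul_mk_eq_iff]
  let P := cotensorFunctor X
  let Q := cotensorFunctor Y
  let R := cotensorFunctor Z
  let S := cotensorFunctor W
  have e₅ : (Q ⋙ R ⋙ P) ⋙ (Q ⋙ S ⋙ P) ≅ (Q ⋙ R) ⋙ (P ⋙ Q) ⋙ (S ⋙ P) := Iso.refl _
  have e₆ : (Q ⋙ R) ⋙ (S ⋙ P) ≅ Q ⋙ (R ⋙ S) ⋙ P := Iso.refl _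
  exact ⟨Functor.isoWhiskerRight e₁ _ ≪≫ Functor.isoWhiskerLeft _ e₂ ≪≫ e₅ ≪≫
    Functor.isoWhiskerLeft (Q ⋙ R) (Functor.isoWhiskerRight e (S ⋙ P) ≪≫ Functor.leftUnitor _) ≪≫
    e₆ ≪≫ Functor.isoWhiskerLeft Q (Functor.isoWhiskerRight e₄.symm P) ≪≫ e₃.symm⟩

/-- Morita-Takeuchi right equivalent corings have isomorphic right Picard groups. -/
theorem nonempty_mulEquiv (h : C.MTEquiv D) : Nonempty (C.RPic ≃* D.RPic) := by
  obtain ⟨X, hX⟩ := h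
  obtain ⟨Y, hY, ⟨e⟩, ⟨e'⟩⟩ := hX.exists_inverse
  exact ⟨{ toFun := conj hX hY
           invFun := conj hY hX
           left_inv := conj_conj hX hY e'
           right_inv := conj_conj hY hX e
           map_mul' := conj_mul hX hY e' }⟩

end Coring.RPic

end inverse

end

theorem mainTheorem11 {k : Type v} [CommRing k] {A : Type u} [Ring A] [Algebra k A]
    (C : Coring k A) [C.IsFlat] :
    ∃ G : Group C.RPic, C.IsCotensorGroup G ∧
      (∃ Ω : C.Auto →* C.RPic,
        (∀ f : C.Auto, ∃ hf : (C.twisted f).IsRightInvertible,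
          Ω f = Coring.RPic.mk (C.twisted f) hf) ∧
        ∃ (I : Subgroup C.Auto) (_ : I.Normal), (I : Set C.Auto) = C.rInn ∧ Ω.ker = I ∧
          ∃ j : C.Auto ⧸ I →* C.RPic, Function.Injective j ∧
            ∀ f : C.Auto, j (QuotientGroup.mk f) = Ω f) ∧
      ∀ {B : Type u} [Ring B] [Algebra k B] (D : Coring k B) [D.IsFlat], C.MTEquiv D →
        ∃ G' : Group D.RPic, D.IsCotensorGroup G' ∧ Nonempty (C.RPic ≃* D.RPic) := by
  refine ⟨Coring.RPic.group C, Coring.RPic.isCotensorGroup C, ?_, fun D _ h =>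
    ⟨Coring.RPic.group D, Coring.RPic.isCotensorGroup D, Coring.RPic.nonempty_mulEquiv h⟩⟩
  let _ := Coring.RPic.group C
  -- `I` is taken to be the kernel of `Ω`, so normality and exactness are immediate; the content is
  -- that its underlying set is `C.rInn`.
  exact ⟨Coring.RPic.ofAuto C, fun f => ⟨C.twisted_isRightInvertible f, rfl⟩,
    (Coring.RPic.ofAuto C).ker, inferInstance, Coring.RPic.coe_ker_ofAuto C, rfl,
    QuotientGroup.kerLift (Coring.RPic.ofAuto C), QuotientGroup.kerLift_injective _,
    fun f => rfl⟩
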